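/- Let $k$ be a field and $\mathcal B$ a set (of brane labels). **Algebra.** A *basic $\mathcal B$-Frobenius algebra* consists of finite-dimensional unital associative $k$-algebras $A_S$, $S\subseteq\mathcal B$ (the zero algebra is allowed), with nondegenerate symmetric pairings satisfying $\langle ab,c\rangle=\langle a,bc\rangle$, and of algebra maps $r_{S,T}:A_S\to A_T$ for $S\subseteq T$ with $r_{S,S}=\mathrm{id}$ and $r_{T,U}r_{S,T}=r_{S,U}$, such that $A_S=0$ whenever $|S|\ge 2$. Write $A=A_\emptyset$, $\int a=\langle a,1\rangle$, and let $r_S^\dagger:A_S\to A$ be the adjoint of $r_S=r_{\emptyset,S}$. For a basis $(\Delta_i)$ of $A_S$ with Gram matrix $g_{ij}=\langle\Delta_i,\Delta_j\rangle$ and inverse $g^{ij}$, let $e_S=\sum_{i,j}\Delta_i g^{ij}\Delta_j$, and $e=e_\emptyset$. Consider the conditions * (C) $A$ is commutative; * (E) $\sum_{i,j} r_b^\dagger(a_1\Delta_i)\,g^{ij}\,r_b^\dagger(\Delta_j a_2)=e\, r_b^\dagger(a_1a_2)$ for all $b\in\mathcal B$, $a_1,a_2\in A_{\{b\}}$, where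 $(\Delta_i)$ is a basis of $A_{\{b\}}$. **Complexes.** A *colour* is either *closed*, or *open*, i.e. a pair $(S,T)$ of subsets of $\mathcal B$; conjugation is $\overline{(S,T)}=(T,S)$, and closed is self-conjugate. The bar complex $B(\beta)=\bigoplus_n B(\beta)_n$ has $B(S,T)_n=A_S\otimes A^{\otimes n}\otimes A_T$ and, for the closed colour, $B(\beta)_n=A\otimes A^{\otimes n}$. It carries the factorwise pairings and the isomorphisms $B(\beta)\cong B(\bar\beta)$, written $\Delta\mapsto\bar\Delta$, that send $a_S\otimes a_1\otimes\cdots\otimes a_n\otimes a_T$ to $a_T\otimes a_n\otimes\cdots\otimes a_1\otimes a_S$ and, in the closed case, $a_0\otimes a_1\otimes\cdots\otimes a_n$ to $a_0\otimes a_n\otimes\cdots\otimes a_1$. The Hochschild complexes $CH^n(A,A_S\otimes A_T)$ and $CH^n(A,A)$ are isomorphic to these by self-duality of $A$, and carry the transported structure. **Arc graphs.** A *discretely weighted arc graph* $\alpha$ lives on a connected compact oriented surface with boundary and finitely many distinguished points on the boundary, at least one on each boundary circle, which cut the boundary into *windows*. The distinguished points and the finitely many interior punctures are labelled by subsets of $\mathcal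 B$; a distinguished point with label $\emptyset$ is alone on its circle, and the window there is closed. Every other window is open, with colour given by the labels of its initial and terminal endpoints. The arcs run between windows, are pairwise disjoint, not homotopic to each other or to a part of the boundary without points of nonempty label, and have positive integral weights; the *discrete representative* has $m$ parallel leaves for an arc of weight $m$. Every window $w$ is active, i.e. the number $\alpha(w)$ of endpoints of leaves on it is positive. Arc graphs are taken up to homeomorphism. **Correlators.** Assume (C). For an arc graph $\alpha$, or more generally a set of leaves, the multilinear form $Y(\alpha):\bigotimes_w B(\beta_w)\to k$, where $\beta_w$ is the colour of $w$, vanishes unless the degree at each $w$ is $\alpha(w)-1$. In these degrees, on pure tensors, decorate the piece between the $i$-th and the $(i+1)$-st leaf endpoint of each window with the factor $a_i$. Decorate the piece containing a distinguished point with the factor $a_0$ in the closed case, and with $r_S^\dagger(a'_Sa_S)$ if the point has label $S\ne\emptyset$, where $a'_S$ and $a_S$ are the corresponding outer factors of the windows before and after the point. Then $$Y(\alpha)=\prod_{R}\int e^{\,1-\chi(R)}\prod_{s}\mathrm{wt}(s)\prod_{p} r_{\beta(p)}^\dagger(e_{\beta(p)}),$$ where $R$ runs over the components of the complement of the leaves,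 $\chi(R)$ is the Euler characteristic of $R$ (cut open along the leaves) with punctures filled in, $s$ runs over the decorated boundary pieces of $R$, $\mathrm{wt}(s)$ is the decoration of $s$, and $p$ runs over the punctures in $R$, with label $\beta(p)$. On the Hochschild complexes, $Y(\alpha)$ is obtained by transport. For windows $w,w'$ of conjugate colours $\beta,\bar\beta$, $Y(\alpha)\circ_{w,w'}Y(\alpha')$ is obtained by inserting the Casimir element $\sum\Delta_i g^{ij}\otimes\bar\Delta_j$ of $B(\beta)$ into the positions $w$ and $w'$. The self-composition of one correlator at two of its positions is defined in the same way. **Gluing.** Let $w,w'$ be windows of conjugate colours and equal weights, either of two arc graphs $\alpha,\alpha'$ or two different windows of one arc graph $\alpha$. Gluing $w$ to $w'$, reversing orientation, and joining the leaves of the discrete representatives gives the *glued foliation* $\mathcal F$, which may contain closed leaves. When a distinguished point comes to lie in the interior, it becomes a puncture with the same label if $w,w'$ are open, and it is forgotten if they are closed. The result of the gluing, written $\alpha\circ_{w,w'}\alpha'$ for two arc graphs, consists of the leaves of $\mathcal F$ that meet the boundary. Let $Y(\mathcal F)$ be given by the above formula, with $R$ running over the components of the complement of *all* leaves of $\mathcal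 F$, including the closed ones. **Theorem.** Let $(A_S)$ be a basic $\mathcal B$-Frobenius algebra satisfying (C) and (E). Then the c/o structure of discretely weighted arc graphs acts on the complexes $B(\beta)$, and on the isomorphic Hochschild complexes, via the correlation functions $Y$. That is, for all gluings as above, $$Y(\mathcal F)=Y(\alpha)\circ_{w,w'}Y(\alpha'),$$ and $$Y(\alpha\circ_{w,w'}\alpha')=Y(\alpha)\circ_{w,w'}Y(\alpha')$$ whenever no closed leaf of $\mathcal F$ separates two different components of the complement of the leaves of $\mathcal F$ (in particular, whenever $\mathcal F$ has no closed leaves). The analogous two identities hold for self-gluings of $\alpha$ and self-compositions of $Y(\alpha)$. For gluings and self-gluings along closed windows, condition (E) is not needed: (C) suffices. -/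

import Mathlib

open scoped TensorProduct DirectSum

universe u v z

noncomputable section

/-! ## Brane labelled Frobenius algebras -/

/-- The element `∑ i j, g^{ij} f(Δ_i, Δ_j)` obtained by inserting the Casimir element of a bilinear
form on a finite-dimensional space into the two arguments of `f`.  Here `(Δ_i)` is a basis and
`(g^{ij})` is the inverse of the Gram matrix `(⟨Δ_i, Δ_j⟩)`. -/
def insertCasimir {k : Type u} [Field k] {V : Type*} [AddCommGroup V] [Module k V]
    [Module.Finite k V] (form : LinearMap.BilinForm k V) {N : Type*} [AddCommGroup N] [Module k N]
    (f : V → V → N) : N :=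
  ∑ i, ∑ j, (LinearMap.BilinForm.toMatrix (Module.finBasis k V) form)⁻¹ i j •
    f (Module.finBasis k V i) (Module.finBasis k V j)

/-- A system of Frobenius algebras `A_S` indexed by the sets `S` of brane labels, with compatible
algebra maps `r_{S,T} : A_S → A_T` for `S ⊆ T`.  The zero algebra is allowed as an `A_S`. -/
structure BraneFrobenius (k : Type u) [Field k] (B : Type z) where
  A : Set B → Type v
  [ring : ∀ S, Ring (A S)]
  [algebra : ∀ S, Algebra k (A S)]
  [finite : ∀ S, Module.Finite k (A S)]
  form : ∀ S, LinearMap.BilinForm k (A S)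
  form_symm : ∀ S, (form S).IsSymm
  form_nondegenerate : ∀ S, (form S).Nondegenerate
  form_mul : ∀ S (a b c : A S), form S (a * b) c = form S a (b * c)
  res : ∀ {S T : Set B}, S ⊆ T → (A S →ₐ[k] A T)
  res_id : ∀ S, res (subset_refl S) = AlgHom.id k (A S)
  res_comp : ∀ {S T U : Set B} (h : S ⊆ T) (h' : T ⊆ U),
    (res h').comp (res h) = res (h.trans h')

namespace BraneFrobenius

attribute [instance] BraneFrobenius.ring BraneFrobenius.algebra BraneFrobenius.finite

variable {k : Type u} [Field k] {B : Type z} (F : BraneFrobenius.{u, v, z} k B)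

/-- The system is basic: `A_S = 0` as soon as `S` has at least two elements. -/
def IsBasic : Prop := ∀ S : Set B, S.Nontrivial → Subsingleton (F.A S)

/-- Condition (C): `A_∅` is commutative. -/
def ConditionC : Prop := ∀ a b : F.A ∅, a * b = b * a

/-- The integral `∫ a = ⟨a, 1⟩`. -/
def integral (S : Set B) (a : F.A S) : k := F.form S a 1

/-- The adjoint `r_S† : A_S → A_∅` of `r_S = r_{∅,S}`, characterised by
`⟨r_S† b, a⟩ = ⟨b, r_S a⟩`. -/
def resDagger (S : Set B) : F.A S →ₗ[k] F.A ∅ :=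
  ((F.form ∅).toDual (F.form_nondegenerate ∅)).symm.toLinearMap ∘ₗ
    (F.res (Set.empty_subset S)).toLinearMap.dualMap ∘ₗ F.form S

theorem form_resDagger (S : Set B) (b : F.A S) (a : F.A ∅) :
    F.form ∅ (F.resDagger S b) a = F.form S b (F.res (Set.empty_subset S) a) := by
  simp [resDagger]

/-- The Euler element `e_S = ∑ Δ_i g^{ij} Δ_j`. -/
def euler (S : Set B) : F.A S := insertCasimir (F.form S) (fun x y => x * y)

/-- Condition (E), the Euler compatibility condition:
`∑ r_b†(a₁ Δ_i) g^{ij} r_b†(Δ_j a₂) = e_∅ r_b†(a₁ a₂)` for all basic labels `b`. -/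
def ConditionE : Prop := ∀ (b : B) (a₁ a₂ : F.A {b}),
  insertCasimir (F.form {b}) (fun x y => F.resDagger {b} (a₁ * x) * F.resDagger {b} (y * a₂)) =
    F.euler ∅ * F.resDagger {b} (a₁ * a₂)

/-- Under condition (C) the ring `A_∅` is a commutative ring. -/
abbrev emptyCommRing (hC : F.ConditionC) : CommRing (F.A ∅) :=
  { (inferInstance : Ring (F.A ∅)) with mul_comm := hC }

/-- The identification `A_S = A_T` for equal labels `S = T`. -/
def relabel {S T : Set B} (h : S = T) : F.A S ≃ₗ[k] F.A T := h ▸ LinearEquiv.refl k (F.A S)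

end BraneFrobenius

/-! ## Colours of windows and their bar complexes -/

/-- The colour of a window: either closed, or open with the brane labels `S` and `T` of its initial
and its terminal endpoint. -/
inductive Color (B : Type z) : Type z
  | closed : Color B
  | opn (S T : Set B) : Color B

namespace Color

variable {B : Type z}

/-- Brane label of the initial endpoint. -/
def src : Color B → Set B
  | closed => ∅
  | opn S _ => S

/-- Brane label of the terminal endpoint. -/
def tgt : Color B → Set B
  | closed => ∅
  | opn _ T => T

/-- The involution `(S, T) ↦ (T, S)` on colours. -/
def bar : Color B → Color B
  | closed => closed
  | opn S T => opn T S

/-- The distinguished tensor factors of the bar complex: one (`a_0`) for a closed window; two for an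
open window, `false` for `a_S` and `true` for `a_T`. -/
def End : Color B → Type
  | closed => Unit
  | opn _ _ => Bool

instance (c : Color B) : Fintype c.End := match c with
  | closed => inferInstanceAs (Fintype Unit)
  | opn _ _ => inferInstanceAs (Fintype Bool)

instance (c : Color B) : DecidableEq c.End := match c with
  | closed => inferInstanceAs (DecidableEq Unit)
  | opn _ _ => inferInstanceAs (DecidableEq Bool)

/-- The label of the algebra in a distinguished tensor factor. -/
def endLabel : (c : Color B) → c.End → Set B
  | closed => fun _ => ∅
  | opn S T => fun e => match (e : Bool) with
    | false => S
    | true => T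

/-- Positions of the tensor factors in degree `n`: `A_S, A, …, A, A_T` with `n` factors `A = A_∅`
in the open case, `A, A, …, A` with `1 + n` factors in the closed case. -/
abbrev Slot (c : Color B) (n : ℕ) : Type := c.End ⊕ Fin n

/-- The label of the algebra in a given position. -/
def slotLabel (c : Color B) {n : ℕ} : c.Slot n → Set B
  | Sum.inl e => c.endLabel e
  | Sum.inr _ => ∅

/-- Exchange of the two distinguished factors of an open colour. -/
def flipEnd : (c : Color B) → c.End ≃ c.bar.End
  | closed => Equiv.refl Unit
  | opn _ _ => Equiv.boolNot

/-- Reversal of the order of the factors `a_S ⊗ a_1 ⊗ … ⊗ a_n ⊗ a_T ↦ a_T ⊗ a_n ⊗ … ⊗ a_1 ⊗ a_S`;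
in the closed case `a_0 ⊗ a_1 ⊗ … ⊗ a_n ↦ a_0 ⊗ a_n ⊗ … ⊗ a_1`. -/
def flipSlot (c : Color B) (n : ℕ) : c.Slot n ≃ c.bar.Slot n :=
  Equiv.sumCongr c.flipEnd Fin.revPerm

theorem slotLabel_flip (c : Color B) (n : ℕ) (s : c.bar.Slot n) :
    c.slotLabel ((c.flipSlot n).symm s) = c.bar.slotLabel s := by
  cases c with
  | closed => rcases s with e | i <;> rfl
  | opn S T =>
    rcases s with e | i
    · cases (e : Bool) <;> rfl
    · rfl

end Color

/-- Graded spaces `V_β = ⨁ₙ V_β,n` indexed by the colours `β` of windows, with finite-dimensional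
pieces, nondegenerate symmetric pairings, and isomorphisms `V_β ≅ V_β̄`. -/
structure CoefficientSystem (k : Type u) [Field k] (B : Type z) where
  V : Color B → ℕ → Type v
  [addCommGroup : ∀ β n, AddCommGroup (V β n)]
  [module : ∀ β n, Module k (V β n)]
  [finite : ∀ β n, Module.Finite k (V β n)]
  form : ∀ β n, LinearMap.BilinForm k (V β n)
  form_symm : ∀ β n, (form β n).IsSymm
  form_nondegenerate : ∀ β n, (form β n).Nondegenerate
  flip : ∀ β n, V β n ≃ₗ[k] V β.bar n

namespace CoefficientSystem

attribute [instance] CoefficientSystem.addCommGroup CoefficientSystem.module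
  CoefficientSystem.finite

variable {k : Type u} [Field k] {B : Type z} (M : CoefficientSystem.{u, v, z} k B)

/-- The whole graded space `V_β`. -/
abbrev Total (β : Color B) : Type v := ⨁ n, M.V β n

/-- A homogeneous element of degree `n` as an element of `V_β`. -/
def of {β : Color B} {n : ℕ} (x : M.V β n) : M.Total β :=
  DirectSum.lof k ℕ (fun m => M.V β m) n x

/-- Correlators `⨂_{w ∈ W} V_{c(w)} → k`. -/
abbrev Correlator {W : Type} (c : W → Color B) : Type _ :=
  MultilinearMap k (fun w => M.Total (c w)) k

/-- Composition of `Y` and `Y'` along the positions `w` and `w'` of conjugate colours: insertion of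
the Casimir element `∑ Δ_i g^{ij} ⊗ Δ̄_j` of `V_β` at the positions `w` and `w'`, where `β` is the
colour of `w`, evaluated at vectors in the remaining positions.  The Casimir element is the sum of
the Casimir elements of the homogeneous components. -/
def compose {W W' : Type} {c : W → Color B} {c' : W' → Color B} (Y : M.Correlator c)
    (Y' : M.Correlator c') (w : W) (w' : W') (h : c' w' = (c w).bar)
    (x : ∀ t : {t : W ⊕ W' // t ≠ Sum.inl w ∧ t ≠ Sum.inr w'}, M.Total (Sum.elim c c' t.1)) : k :=
  open scoped Classical in
  ∑ᶠ n : ℕ, insertCasimir (M.form (c w) n) (fun Δ Δ' =>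
    Y (fun t => if e : t = w then e ▸ M.of Δ else x ⟨Sum.inl t, by simp [e]⟩) *
    Y' (fun t => if e : t = w' then e ▸ h ▸ M.of (M.flip (c w) n Δ')
      else x ⟨Sum.inr t, by simp [e]⟩))

/-- The analogous self-composition of `Y` along two positions `w` and `w'` of conjugate colours. -/
def selfCompose {W : Type} {c : W → Color B} (Y : M.Correlator c) (w w' : W)
    (h : c w' = (c w).bar) (x : ∀ t : {t : W // t ≠ w ∧ t ≠ w'}, M.Total (c t.1)) : k :=
  open scoped Classical in
  ∑ᶠ n : ℕ, insertCasimir (M.form (c w) n) (fun Δ Δ' =>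
    Y (fun t => if e : t = w then e ▸ M.of Δ
      else if e' : t = w' then e' ▸ h ▸ M.of (M.flip (c w) n Δ')
      else x ⟨t, e, e'⟩))

end CoefficientSystem

namespace BraneFrobenius

variable {k : Type u} [Field k] {B : Type z} (F : BraneFrobenius.{u, v, z} k B)

/-- The degree `n` part of the bar complex of a colour: `A_S ⊗ A^{⊗ n} ⊗ A_T` for an open and
`A ⊗ A^{⊗ n}` for a closed colour. -/
abbrev Bar (c : Color B) (n : ℕ) : Type (max u v) :=
  ⨂[k] s : c.Slot n, F.A (c.slotLabel s)

/-- The pairing `⟨⨂ a_s, ⨂ b_s⟩ = ∏ ⟨a_s, b_s⟩` as an isomorphism to the dual. -/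
def barToDual (c : Color B) (n : ℕ) : F.Bar c n ≃ₗ[k] Module.Dual k (F.Bar c n) :=
  PiTensorProduct.congr (fun s : c.Slot n =>
    (F.form (c.slotLabel s)).toDual (F.form_nondegenerate _)) ≪≫ₗ
  PiTensorProduct.dualDistribEquiv

theorem barToDual_tprod (c : Color B) (n : ℕ) (a b : ∀ s : c.Slot n, F.A (c.slotLabel s)) :
    F.barToDual c n (PiTensorProduct.tprod k a) (PiTensorProduct.tprod k b) =
      ∏ s, F.form (c.slotLabel s) (a s) (b s) := by
  rw [barToDual, LinearEquiv.trans_apply, PiTensorProduct.congr_tprod]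
  exact PiTensorProduct.dualDistrib_apply _ _

theorem barToDual_symm (c : Color B) (n : ℕ) (x y : F.Bar c n) :
    F.barToDual c n x y = F.barToDual c n y x := by
  suffices h : (F.barToDual c n).toLinearMap = (F.barToDual c n).toLinearMap.flip from
    congrArg (fun f => f x y) h
  apply PiTensorProduct.ext
  ext a b
  simp only [LinearMap.compMultilinearMap_apply, LinearEquiv.coe_coe, LinearMap.flip_apply,
    barToDual_tprod]
  exact Finset.prod_congr rfl fun s _ => (F.form_symm _).eq _ _

theorem barToDual_nondegenerate (c : Color B) (n : ℕ) :
    LinearMap.BilinForm.Nondegenerate (F.barToDual c n).toLinearMap := by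
  have h : ∀ x : F.Bar c n, (∀ y, F.barToDual c n x y = 0) → x = 0 := fun x hx =>
    (F.barToDual c n).map_eq_zero_iff.1 (LinearMap.ext hx)
  exact ⟨h, fun y hy => h y fun x => (F.barToDual_symm c n y x).trans (hy x)⟩

/-- The reversal isomorphism between the bar complexes of conjugate colours. -/
def barFlip (c : Color B) (n : ℕ) : F.Bar c n ≃ₗ[k] F.Bar c.bar n :=
  PiTensorProduct.reindex k (fun s : c.Slot n => F.A (c.slotLabel s)) (c.flipSlot n) ≪≫ₗ
  PiTensorProduct.congr (fun s => F.relabel (c.slotLabel_flip n s))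

/-- The brane labelled bar complexes. -/
def barSystem : CoefficientSystem.{u, max u v, z} k B where
  V := F.Bar
  form c n := (F.barToDual c n).toLinearMap
  form_symm c n := ⟨F.barToDual_symm c n⟩
  form_nondegenerate := F.barToDual_nondegenerate
  flip := F.barFlip

/-- The coefficient module of the Hochschild complex of a colour: the tensor product of `A_S` and
`A_T` for an open and `A` for a closed colour. -/
abbrev HochCoeff (c : Color B) : Type (max u v) := ⨂[k] e : c.End, F.A (c.endLabel e)

/-- The Hochschild cochains `CHⁿ(A, M) = Hom(A^{⊗ n}, M)` of a colour. -/
abbrev Hoch (c : Color B) (n : ℕ) : Type (max u v) :=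
  MultilinearMap k (fun _ : Fin n => F.A ∅) (F.HochCoeff c)

/-- The isomorphism from Hochschild cochains to the bar complex given by the self-duality of `A`.
Its inverse sends `m ⊗ a_1 ⊗ … ⊗ a_n` to the cochain `(x_1, …, x_n) ↦ (∏ ⟨a_i, x_i⟩) m`. -/
def hochToBar (c : Color B) (n : ℕ) : F.Hoch c n ≃ₗ[k] F.Bar c n :=
  PiTensorProduct.lift ≪≫ₗ
  (dualTensorHomEquiv k (⨂[k] _ : Fin n, F.A ∅) (F.HochCoeff c)).symm ≪≫ₗ
  TensorProduct.comm k _ _ ≪≫ₗ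
  TensorProduct.congr (LinearEquiv.refl k (F.HochCoeff c))
    (PiTensorProduct.congr (fun _ : Fin n => (F.form ∅).toDual (F.form_nondegenerate ∅)) ≪≫ₗ
      PiTensorProduct.dualDistribEquiv).symm ≪≫ₗ
  PiTensorProduct.tmulEquivDep k (fun s : c.Slot n => F.A (c.slotLabel s))

/-- The brane labelled Hochschild complexes, with the pairings and the reversal isomorphisms carried
over from the isomorphic bar complexes. -/
def hochSystem : CoefficientSystem.{u, max u v, z} k B where
  V := F.Hoch
  form c n := LinearMap.BilinForm.congr (F.hochToBar c n).symm (F.barToDual c n).toLinearMap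
  form_symm c n := ⟨fun _ _ => F.barToDual_symm c n _ _⟩
  form_nondegenerate c n :=
    LinearMap.BilinForm.Nondegenerate.congr _ (F.barToDual_nondegenerate c n)
  flip c n := F.hochToBar c n ≪≫ₗ F.barFlip c n ≪≫ₗ (F.hochToBar c.bar n).symm

end BraneFrobenius

/-! ## Discretely weighted arc graphs -/

theorem exists_return {X : Type} [Finite X] (π : Equiv.Perm X) {p : X → Prop} {x : X} (hx : p x) :
    ∃ n, 0 < n ∧ p ((π ^ n) x) :=
  ⟨orderOf π, orderOf_pos π, by simpa [pow_orderOf_eq_one] using hx⟩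

open scoped Classical in
/-- The first return map of a permutation `π` of a finite set to the subset given by `p`:
`x ↦ πⁿ x` for the least `n ≥ 1` such that `p (πⁿ x)`. -/
def firstReturn {X : Type} [Finite X] (π : Equiv.Perm X) (p : X → Prop) :
    Equiv.Perm {x : X // p x} :=
  Equiv.ofBijective
    (fun x => ⟨(π ^ Nat.find (exists_return π x.2)) x.1, (Nat.find_spec (exists_return π x.2)).2⟩)
    (by
      rw [← Finite.injective_iff_bijective]
      have key : ∀ x y : {x : X // p x},
          Nat.find (exists_return π x.2) ≤ Nat.find (exists_return π y.2) →
          (π ^ Nat.find (exists_return π x.2)) x.1 = (π ^ Nat.find (exists_return π y.2)) y.1 →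
          x = y := by
        intro x y hle heq
        obtain ⟨d, hd⟩ := Nat.exists_eq_add_of_le hle
        have hx : x.1 = (π ^ d) y.1 := by
          rw [hd, pow_add, Equiv.Perm.mul_apply] at heq
          exact (π ^ _).injective heq
        rcases Nat.eq_zero_or_pos d with h0 | h0
        · subst h0
          exact Subtype.ext (by simpa using hx)
        · have hmin := Nat.find_min' (exists_return π y.2) ⟨h0, hx ▸ x.2⟩
          have hpos := (Nat.find_spec (exists_return π x.2)).1
          omega
      intro x y hxy
      have h := congrArg Subtype.val hxy
      rcases le_total (Nat.find (exists_return π x.2)) (Nat.find (exists_return π y.2)) with hl | hl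
      · exact key x y hl h
      · exact (key y x hl h.symm).symm)

/-- Combinatorial data of a discretely weighted arc graph on a brane labelled windowed surface, all
of whose windows are active, up to homeomorphism.  An arc of weight `m` is represented by `m`
parallel leaves (the discrete representative of the arc graph).

* The windows are oriented as part of the boundary of the oriented surface.  `next w` is the window
  that follows `w` on its boundary circle, and the distinguished points are in bijection with the
  windows: `w` corresponds to its initial point.
* `wt w ≥ 1` is the number of endpoints of leaves on `w`.  They are called flags, and are numbered
  along the window as `(w, 0), …, (w, wt w - 1)`.
* `leaf` exchanges the two endpoints of each leaf.
* The boundary of the surface minus the flags consists of the boundary pieces.  The piece that ends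
  at the flag `f` is also denoted by `f`.  The pieces `(w, i)` with `i ≥ 1` contain no
  distinguished point, the piece `(w, 0)` contains the initial point of `w`.
* `Region` is the set of components of the complement of the leaves, `region f` is the one that
  contains the piece `f`, and `chi` is the Euler characteristic of the region, with punctures filled
  in, as a compact surface with boundary obtained by cutting along the leaves.  Together with the
  number of boundary circles, this determines the genus of the region.
* Each puncture lies in a region and carries a set of brane labels. -/
structure ArcDiagram (B : Type z) where
  Window : Type
  [finiteWindow : Finite Window]
  color : Window → Color B
  next : Equiv.Perm Window
  wt : Window → ℕ
  wt_pos : ∀ w, 0 < wt w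
  leaf : Equiv.Perm (Σ w, Fin (wt w))
  Region : Type
  [finiteRegion : Finite Region]
  region : (Σ w, Fin (wt w)) → Region
  chi : Region → ℤ
  Puncture : Type
  [finitePuncture : Finite Puncture]
  punctureRegion : Puncture → Region
  punctureLabel : Puncture → Set B

namespace ArcDiagram

attribute [instance] ArcDiagram.finiteWindow ArcDiagram.finiteRegion ArcDiagram.finitePuncture

variable {B : Type z} (G : ArcDiagram B)

/-- Flags, that is endpoints of leaves; also used to denote the boundary pieces. -/
abbrev Flag : Type := Σ w, Fin (G.wt w)

/-- The first flag on a window. -/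
def firstFlag (w : G.Window) : G.Flag := ⟨w, ⟨0, G.wt_pos w⟩⟩

/-- The flag after `f` on the boundary. -/
def nextFlag (f : G.Flag) : G.Flag :=
  if h : f.2.1 + 1 < G.wt f.1 then ⟨f.1, ⟨f.2.1 + 1, h⟩⟩ else G.firstFlag (G.next f.1)

/-- With the orientation induced by a region, the piece `f` is followed on the boundary of the
region by the leaf at the flag `f` and then by this piece. -/
def nextSide (f : G.Flag) : G.Flag := G.nextFlag (G.leaf f)

/-- The boundary circles of a region. -/
def Circle (r : G.Region) : Type :=
  Quot fun f f' : {f : G.Flag // G.region f = r} => f'.1 = G.nextSide f.1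

/-- The combinatorial data describe a discretely weighted arc graph on a connected brane labelled
windowed surface. -/
structure IsArcGraph : Prop where
  nonempty : Nonempty G.Window
  /-- The two windows at a distinguished point agree on its label. -/
  label_next : ∀ w, (G.color w).tgt = (G.color (G.next w)).src
  /-- A distinguished point with empty label is alone on its boundary circle. -/
  closed_next : ∀ w, G.color w = Color.closed → G.next w = w
  /-- The endpoints of an open window have nonempty labels. -/
  open_label : ∀ w, G.color w ≠ Color.closed → (G.color w).src.Nonempty ∧ (G.color w).tgt.Nonempty
  leaf_leaf : ∀ f, G.leaf (G.leaf f) = f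
  leaf_ne : ∀ f, G.leaf f ≠ f
  region_nextSide : ∀ f, G.region (G.nextSide f) = G.region f
  region_surjective : Function.Surjective G.region
  /-- A region is a connected oriented surface of some genus `g`. -/
  chi_eq : ∀ r, ∃ g : ℕ, G.chi r = 2 - 2 * (g : ℤ) - (Nat.card (G.Circle r) : ℤ)
  connected : ∀ f f' : G.Flag, Relation.EqvGen
    (fun a b => b = G.nextFlag a ∨ b = G.leaf a ∨ G.region a = G.region b) f f'
  /-- No leaf is homotopic to a part of the boundary without points of nonempty label: if a region
  is an unpunctured disc with a single side, then this side contains a distinguished point with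
  nonempty label. -/
  essential : ∀ f, G.nextSide f = f → G.chi (G.region f) = 1 →
    (∀ p, G.punctureRegion p ≠ G.region f) → f.2.1 = 0 ∧ G.color f.1 ≠ Color.closed

/-! ### Gluing -/

variable (w w' : G.Window)

/-- The windows which survive the gluing of `w` and `w'`. -/
def Survives (u : G.Window) : Prop := u ≠ w ∧ u ≠ w'

open scoped Classical in
/-- The orientation reversing identification of the flags of `w` with those of `w'`. -/
def partnerFun (h : G.wt w = G.wt w') (f : G.Flag) : G.Flag :=
  if hf : f.1 = w then
    ⟨w', ⟨G.wt w' - 1 - f.2.1, by have := G.wt_pos w'; omega⟩⟩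
  else if hf' : f.1 = w' then
    ⟨w, ⟨G.wt w - 1 - f.2.1, by have := G.wt_pos w; omega⟩⟩
  else f

theorem partnerFun_partnerFun (hne : w ≠ w') (h : G.wt w = G.wt w') (f : G.Flag) :
    G.partnerFun w w' h (G.partnerFun w w' h f) = f := by
  obtain ⟨u, i, hi⟩ := f
  have ext : ∀ (v : G.Window) (a b : Fin (G.wt v)), a.1 = b.1 → (⟨v, a⟩ : G.Flag) = ⟨v, b⟩ :=
    fun v a b hab => by rw [Fin.ext hab]
  by_cases hu : u = w
  · subst hu
    unfold partnerFun
    rw [dif_pos (show (⟨u, i, hi⟩ : G.Flag).1 = u from rfl), dif_neg (Ne.symm hne), dif_pos rfl]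
    exact ext _ _ _ (show G.wt u - 1 - (G.wt w' - 1 - i) = i by omega)
  · by_cases hu' : u = w'
    · subst hu'
      unfold partnerFun
      rw [dif_neg (show ¬ (⟨u, i, hi⟩ : G.Flag).1 = w from hu),
        dif_pos (show (⟨u, i, hi⟩ : G.Flag).1 = u from rfl), dif_pos rfl]
      exact ext _ _ _ (show G.wt u - 1 - (G.wt w - 1 - i) = i by omega)
    · simp [partnerFun, hu, hu']

/-- The involution of the flags which exchanges the flags of `w` and `w'` and fixes all others. -/
def partner (hne : w ≠ w') (h : G.wt w = G.wt w') : Equiv.Perm G.Flag where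
  toFun := G.partnerFun w w' h
  invFun := G.partnerFun w w' h
  left_inv := G.partnerFun_partnerFun w w' hne h
  right_inv := G.partnerFun_partnerFun w w' hne h

/-- The leaf of the glued foliation through a glued flag `f` is closed: following it, one never
arrives at a surviving window. -/
def OnClosedLeaf (hne : w ≠ w') (h : G.wt w = G.wt w') (f : G.Flag) : Prop :=
  ∀ n : ℕ, ¬ G.Survives w w' ((((G.partner w w' hne h).trans G.leaf) ^ n) f).1

/-- Regions which become adjacent along the glued windows.  The pieces before `f` and after the flag
identified with `f` are glued, along a half if they contain distinguished points. -/
def GluedAlong (hne : w ≠ w') (h : G.wt w = G.wt w') (r r' : G.Region) : Prop :=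
  ∃ f : G.Flag, ¬ G.Survives w w' f.1 ∧ r = G.region f ∧
    r' = G.region (G.nextFlag (G.partner w w' hne h f))

/-- Regions on the two sides of a closed leaf of the glued foliation. -/
def AlongClosedLeaf (hne : w ≠ w') (h : G.wt w = G.wt w') (r r' : G.Region) : Prop :=
  ∃ f : G.Flag, G.OnClosedLeaf w w' hne h f ∧ r = G.region f ∧ r' = G.region (G.nextFlag f)

/-- The initial points of the windows `u` with this property represent, without repetition, the
distinguished points which are in the interior of the glued surface: the point between `w'` and `w`
if `w` follows `w'`; the point between `w` and `w'` if `w'` follows `w`; the common point if both `w`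
and `w'` are alone on their boundary circles. -/
def BecomesInterior (u : G.Window) : Prop :=
  (u = w ∧ (G.next w' = w ∨ (G.next w = w ∧ G.next w' = w'))) ∨ (u = w' ∧ G.next w = w')

open scoped Classical in
/-- The gluing of the windows `w` and `w'` of the same weight.  The regions of the result are the
classes of regions under the equivalence relation generated by `rel`.

* The window after `u` is found by jumping from `w` to the window after `w'`, and from `w'` to the
  window after `w`.
* The leaves are found by following leaves across the glued windows until a surviving window.
* The Euler characteristic of a new region is the sum of those of its parts, minus the number of
  gluings of pieces without distinguished points and of halves of pieces with distinguished points,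
  plus the number of distinguished points which are now in its interior.  These gluings are indexed
  by the flags on `w` and the first flag on `w'`.
* In the open case the points which are now in the interior become punctures with the same label, in
  the closed case they are forgotten. -/
def selfGlueWith (hne : w ≠ w') (h : G.wt w = G.wt w') (rel : G.Region → G.Region → Prop) :
    ArcDiagram B where
  Window := {u : G.Window // u ≠ w ∧ u ≠ w'}
  color u := G.color u.1
  next := firstReturn ((Equiv.swap w w').trans G.next) (G.Survives w w')
  wt u := G.wt u.1
  wt_pos u := G.wt_pos u.1
  leaf := (Equiv.subtypeSigmaEquiv (fun u => Fin (G.wt u)) (G.Survives w w')).permCongr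
    (firstReturn ((G.partner w w' hne h).trans G.leaf) (fun f => G.Survives w w' f.1))
  Region := Quot rel
  region f := Quot.mk rel (G.region ⟨f.1.1, f.2⟩)
  chi c := (∑ᶠ r : {r : G.Region // Quot.mk rel r = c}, G.chi r.1)
    - (Nat.card {f : G.Flag // (f.1 = w ∨ f = G.firstFlag w') ∧ Quot.mk rel (G.region f) = c} : ℤ)
    + (Nat.card {u : G.Window // G.BecomesInterior w w' u ∧
        Quot.mk rel (G.region (G.firstFlag u)) = c} : ℤ)
  Puncture := G.Puncture ⊕ {u : G.Window // G.BecomesInterior w w' u ∧ G.color u ≠ Color.closed}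
  punctureRegion := Sum.elim (fun p => Quot.mk rel (G.punctureRegion p))
    (fun u => Quot.mk rel (G.region (G.firstFlag u.1)))
  punctureLabel := Sum.elim G.punctureLabel (fun u => (G.color u.1).src)

/-- The glued foliation: the surface is cut along all leaves, including closed leaves.  As a diagram
this records the windows, the leaves that meet the boundary, and the components of the complement of
all leaves. -/
def selfGlueFoliation (hne : w ≠ w') (h : G.wt w = G.wt w') : ArcDiagram B :=
  G.selfGlueWith w w' hne h (G.GluedAlong w w' hne h)

/-- The self-gluing of arc graphs: the leaves of the glued foliation which meet the boundary.  The
closed leaves are deleted, so that the regions on both sides of a closed leaf are joined. -/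
def selfGlue (hne : w ≠ w') (h : G.wt w = G.wt w') : ArcDiagram B :=
  G.selfGlueWith w w' hne h
    (fun r r' => G.GluedAlong w w' hne h r r' ∨ G.AlongClosedLeaf w w' hne h r r')

/-- No closed leaf of the glued foliation separates two different components of the complement of
the foliation. -/
def ClosedLeavesNonseparating (hne : w ≠ w') (h : G.wt w = G.wt w') : Prop :=
  ∀ r r', G.AlongClosedLeaf w w' hne h r r' → Relation.EqvGen (G.GluedAlong w w' hne h) r r'

/-- The disjoint union of two diagrams. -/
def disjointUnion (G G' : ArcDiagram B) : ArcDiagram B where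
  Window := G.Window ⊕ G'.Window
  color := Sum.elim G.color G'.color
  next := Equiv.sumCongr G.next G'.next
  wt := Sum.elim G.wt G'.wt
  wt_pos u := by rcases u with u | u; exacts [G.wt_pos u, G'.wt_pos u]
  leaf := (Equiv.sumSigmaDistrib (fun u => Fin (Sum.elim G.wt G'.wt u))).symm.permCongr
    (Equiv.sumCongr G.leaf G'.leaf)
  Region := G.Region ⊕ G'.Region
  region f := Sum.map G.region G'.region
    (Equiv.sumSigmaDistrib (fun u => Fin (Sum.elim G.wt G'.wt u)) f)
  chi := Sum.elim G.chi G'.chi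
  Puncture := G.Puncture ⊕ G'.Puncture
  punctureRegion := Sum.map G.punctureRegion G'.punctureRegion
  punctureLabel := Sum.elim G.punctureLabel G'.punctureLabel

end ArcDiagram

/-! ## Correlation functions -/

namespace BraneFrobenius

variable {k : Type u} [Field k] {B : Type z} (F : BraneFrobenius.{u, v, z} k B)

/-- The decorations of a window of colour `c` with `n + 1` flags: the tuples of factors of the pure
tensors in the bar complex. -/
abbrev Decoration (c : Color B) (n : ℕ) : Type v := ∀ s : c.Slot n, F.A (c.slotLabel s)

variable {F} in
/-- The factor which decorates the initial point: `a_S` in the open and `a_0` in the closed case. -/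
def Decoration.first : {c : Color B} → {n : ℕ} → F.Decoration c n → F.A c.src
  | Color.closed, _, a => a (Sum.inl ())
  | Color.opn _ _, _, a => a (Sum.inl false)

variable {F} in
/-- The factor which decorates the terminal point: `a'_T` in the open case.  A closed window has only
one factor at its distinguished point, and the factor `1` is used here. -/
def Decoration.last : {c : Color B} → {n : ℕ} → F.Decoration c n → F.A c.tgt
  | Color.closed, _, _ => (1 : F.A ∅)
  | Color.opn _ _, _, a => a (Sum.inl true)

variable {F} in
/-- The factor `a_{i+1} ∈ A` which decorates the `i`-th piece without distinguished point, where `i`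
is counted from `0`. -/
def Decoration.interior {c : Color B} {n : ℕ} (a : F.Decoration c n) (i : Fin n) : F.A ∅ :=
  a (Sum.inr i)

variable (G : ArcDiagram B)

open scoped Classical in
/-- The weight of the piece which contains the initial point of `w`: if `S` is the label of this point
and `w₀` is the window before `w`, the weight is `r_S†(a'_S a_S)`, where `a'_S` is the last factor at
`w₀` and `a_S` is the first factor at `w`.  For a closed window this is `a_0`.  The labels of `w₀` and
`w` at this point agree in all arc graphs. -/
def initialWeight (a : ∀ w, F.Decoration (G.color w) (G.wt w - 1)) (w : G.Window) : F.A ∅ :=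
  if h : (G.color (G.next.symm w)).tgt = (G.color w).src then
    F.resDagger (G.color w).src (F.relabel h (a (G.next.symm w)).last * (a w).first)
  else 0

/-- The weight of a boundary piece.  The piece `(w, i)` with `i ≥ 1` has weight `a_i ∈ A`. -/
def sideWeight (a : ∀ w, F.Decoration (G.color w) (G.wt w - 1)) (f : G.Flag) : F.A ∅ :=
  if hi : f.2.1 = 0 then F.initialWeight G a f.1
  else (a f.1).interior ⟨f.2.1 - 1, by have := f.2.2; omega⟩

/-- The local correlator of a region `S`:
`∫ e^{1 - χ(S)} ∏ wt(s) ∏ r_{β(p)}†(e_{β(p)})`, where `s` runs over the decorated sides of `S` and `p`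
over the punctures in `S`. -/
def regionCorrelator (hC : F.ConditionC) (a : ∀ w, F.Decoration (G.color w) (G.wt w - 1))
    (r : G.Region) : k :=
  letI : CommRing (F.A ∅) := F.emptyCommRing hC
  F.integral ∅ (F.euler ∅ ^ (1 - G.chi r).toNat *
    (∏ᶠ f : {f : G.Flag // G.region f = r}, F.sideWeight G a f.1) *
    ∏ᶠ p : {p : G.Puncture // G.punctureRegion p = r},
      F.resDagger (G.punctureLabel p.1) (F.euler (G.punctureLabel p.1)))

/-- The value of the correlator on pure tensors, the product of the local correlators. -/
def pureCorrelator (hC : F.ConditionC) (a : ∀ w, F.Decoration (G.color w) (G.wt w - 1)) : k :=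
  ∏ᶠ r : G.Region, F.regionCorrelator G hC a r

end BraneFrobenius

namespace BraneFrobenius
section Lift
variable {k : Type u} [Field k] {W : Type} [Finite W] {S : W → Type} [∀ w, Finite (S w)]
  {M : ∀ w, S w → Type v} [∀ w s, AddCommGroup (M w s)] [∀ w s, Module k (M w s)]
  [∀ w s, Module.Finite k (M w s)]

open scoped Classical in
/-- Extension from pure tensors by multilinearity. -/
def liftTensors (y : MultilinearMap k (fun p : Σ w, S w => M p.1 p.2) k) :
    MultilinearMap k (fun w => ⨂[k] s, M w s) k :=
  letI := Fintype.ofFinite W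
  letI := fun w => Fintype.ofFinite (S w)
  ∑ κ : ∀ w s, Fin (Module.finrank k (M w s)),
    y (fun p => Module.finBasis k (M p.1 p.2) (κ p.1 p.2)) •
      (MultilinearMap.mkPiAlgebra k W k).compLinearMap
        (fun w => (Basis.piTensorProduct (fun s => Module.finBasis k (M w s))).coord (κ w))

theorem liftTensors_tprod (y : MultilinearMap k (fun p : Σ w, S w => M p.1 p.2) k)
    (a : ∀ p : Σ w, S w, M p.1 p.2) :
    liftTensors y (fun w => PiTensorProduct.tprod k (fun s => a ⟨w, s⟩)) = y a := by
  classical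
  suffices h : (liftTensors y).compMultilinearMap (fun w => PiTensorProduct.tprod k) = y from
    congrArg (fun f => f a) h
  refine Module.Basis.ext_multilinear (fun p : Σ w, S w => Module.finBasis k (M p.1 p.2)) ?_
  intro κ₀
  let _ := Fintype.ofFinite W
  let _ := fun w => Fintype.ofFinite (S w)
  simp only [MultilinearMap.compMultilinearMap_apply, liftTensors, sum_apply,
    smul_apply, MultilinearMap.compLinearMap_apply, MultilinearMap.mkPiAlgebra_apply,
    Module.Basis.coord_apply, Basis.piTensorProduct_repr_tprod_apply, Sigma.curry,
    Module.Basis.repr_self]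
  rw [Finset.sum_eq_single (fun w s => κ₀ ⟨w, s⟩)]
  · simp
  · intro κ _ hκ
    obtain ⟨w, hw⟩ := Function.ne_iff.1 hκ
    obtain ⟨s, hs⟩ := Function.ne_iff.1 hw
    rw [Finset.prod_eq_zero (Finset.mem_univ w), smul_zero]
    exact Finset.prod_eq_zero (Finset.mem_univ s) (Finsupp.single_eq_of_ne hs)
  · simp
end Lift

section Pure
variable {k : Type u} [Field k] {R : Type v} [CommRing R] [Algebra k R] {X Y : Type} [Finite X]
  [Finite Y]

theorem prod_update_aux (π : X → Y) (φ : Y → R →ₗ[k] k) (x₀ : X) (α β : k) (s s₁ s₂ : X → R)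
    (h₁ : ∀ x, x ≠ x₀ → s x = s₁ x) (h₂ : ∀ x, x ≠ x₀ → s x = s₂ x)
    (h₀ : s x₀ = α • s₁ x₀ + β • s₂ x₀) :
    ∏ᶠ y, φ y (∏ᶠ x : {x // π x = y}, s x.1) =
      α * ∏ᶠ y, φ y (∏ᶠ x : {x // π x = y}, s₁ x.1) +
      β * ∏ᶠ y, φ y (∏ᶠ x : {x // π x = y}, s₂ x.1) := by
  classical
  let _ := Fintype.ofFinite X
  let _ := Fintype.ofFinite Y
  simp only [finprod_eq_prod_of_fintype]
  rw [← Finset.mul_prod_erase _ _ (Finset.mem_univ (π x₀)),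
    ← Finset.mul_prod_erase _ _ (Finset.mem_univ (π x₀)),
    ← Finset.mul_prod_erase _ _ (Finset.mem_univ (π x₀))]
  have hne : ∀ t : X → R, (∀ x, x ≠ x₀ → s x = t x) →
      ∏ y ∈ Finset.univ.erase (π x₀), φ y (∏ x : {x // π x = y}, t x.1) =
      ∏ y ∈ Finset.univ.erase (π x₀), φ y (∏ x : {x // π x = y}, s x.1) := by
    intro t ht
    refine Finset.prod_congr rfl fun y hy => ?_
    congr 1
    refine Finset.prod_congr rfl fun x _ => (ht x.1 ?_).symm
    rintro hx
    exact (Finset.mem_erase.1 hy).1 (by rw [← x.2, hx])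
  rw [hne s₁ h₁, hne s₂ h₂, ← mul_assoc, ← mul_assoc, ← add_mul]
  congr 1
  have hm := Finset.mem_univ (⟨x₀, rfl⟩ : {x // π x = π x₀})
  rw [← Finset.mul_prod_erase _ _ hm, ← Finset.mul_prod_erase _ _ hm,
    ← Finset.mul_prod_erase _ _ hm]
  have hne' : ∀ t : X → R, (∀ x, x ≠ x₀ → s x = t x) →
      ∏ x ∈ Finset.univ.erase (⟨x₀, rfl⟩ : {x // π x = π x₀}), t x.1 =
      ∏ x ∈ Finset.univ.erase (⟨x₀, rfl⟩ : {x // π x = π x₀}), s x.1 := by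
    intro t ht
    refine Finset.prod_congr rfl fun x hx => (ht x.1 ?_).symm
    intro h
    exact (Finset.mem_erase.1 hx).1 (Subtype.ext h)
  rw [hne' s₁ h₁, hne' s₂ h₂, h₀, add_mul, smul_mul_assoc, smul_mul_assoc, map_add, map_smul,
    map_smul, smul_eq_mul, smul_eq_mul]
end Pure

variable {k : Type u} [Field k] {B : Type z} (F : BraneFrobenius.{u, v, z} k B)

/-- The kind of a tensor factor: at the initial point, at the terminal point, or neither. -/
def slotKind : (c : Color B) → {n : ℕ} → c.Slot n → Option Bool
  | _, _, Sum.inr _ => none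
  | Color.closed, _, Sum.inl _ => some false
  | Color.opn _ _, _, Sum.inl e => some e

open scoped Classical in
/-- The side of an arc diagram which a tensor factor decorates. -/
def slotSide (G : ArcDiagram B) (p : Σ w, (G.color w).Slot (G.wt w - 1)) : G.Flag :=
  match p.2 with
  | Sum.inr i => ⟨p.1, ⟨i.1 + 1, by have := i.2; omega⟩⟩
  | Sum.inl e => if slotKind (G.color p.1) p.2 = some true then G.firstFlag (G.next p.1)
    else G.firstFlag p.1

theorem slotKind_inj {c : Color B} {n : ℕ} {s s' : c.Slot n} {b : Bool}
    (h : slotKind c s = some b) (h' : slotKind c s' = some b) : s = s' := by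
  cases c with
  | closed =>
    rcases s with e | i
    · rcases s' with e' | i'
      · rfl
      · exact absurd h' (Option.some_ne_none b).symm
    · exact absurd h (Option.some_ne_none b).symm
  | opn S T =>
    rcases s with e | i
    · rcases s' with e' | i'
      · exact congrArg Sum.inl (Option.some.inj (h.trans h'.symm))
      · exact absurd h' (Option.some_ne_none b).symm
    · exact absurd h (Option.some_ne_none b).symm

theorem slotKind_inl (c : Color B) (n : ℕ) (e : c.End)
    (h : slotKind c (Sum.inl e : c.Slot n) ≠ some true) :
    slotKind c (Sum.inl e : c.Slot n) = some false := by
  cases c with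
  | closed => rfl
  | opn S T => exact congrArg some (Bool.eq_false_iff.2 fun he => h (congrArg some he))

section
variable {F}

theorem first_congr {c : Color B} {n : ℕ} {d d' : F.Decoration c n}
    (h : ∀ s, slotKind c s = some false → d s = d' s) : d.first = d'.first := by
  cases c with
  | closed => exact h (Sum.inl ()) rfl
  | opn S T => exact h (Sum.inl false) rfl

theorem last_congr {c : Color B} {n : ℕ} {d d' : F.Decoration c n}
    (h : ∀ s, slotKind c s = some true → d s = d' s) : d.last = d'.last := by
  cases c with
  | closed => rfl
  | opn S T => exact h (Sum.inl true) rfl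

theorem first_linear {c : Color B} {n : ℕ} {d d₁ d₂ : F.Decoration c n} {α β : k}
    (h : ∀ s, slotKind c s = some false → d s = α • d₁ s + β • d₂ s) :
    d.first = α • d₁.first + β • d₂.first := by
  cases c with
  | closed => exact h (Sum.inl ()) rfl
  | opn S T => exact h (Sum.inl false) rfl

theorem last_linear {c : Color B} {n : ℕ} {d d₁ d₂ : F.Decoration c n} {α β : k} {s : c.Slot n}
    (hs : slotKind c s = some true) (h : d s = α • d₁ s + β • d₂ s) :
    d.last = α • d₁.last + β • d₂.last := by
  cases c with
  | closed => rcases s with e | i <;> simp [slotKind] at hs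
  | opn S T =>
    rcases s with e | i
    · have he : e = true := Option.some.inj hs
      subst he
      exact h
    · simp [slotKind] at hs

end

section
variable {G : ArcDiagram B} {p : Σ w, (G.color w).Slot (G.wt w - 1)}
  {a a₁ a₂ : ∀ p : Σ w, (G.color w).Slot (G.wt w - 1), F.A ((G.color p.1).slotLabel p.2)}

theorem sideWeight_firstFlag (d : ∀ w, F.Decoration (G.color w) (G.wt w - 1)) (w : G.Window) :
    F.sideWeight G d (G.firstFlag w) = F.initialWeight G d w := dif_pos rfl

theorem sideWeight_congr (h : ∀ q, q ≠ p → a q = a₁ q) {f : G.Flag} (hf : f ≠ slotSide G p) :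
    F.sideWeight G (fun w s => a ⟨w, s⟩) f = F.sideWeight G (fun w s => a₁ ⟨w, s⟩) f := by
  obtain ⟨u, i, hi⟩ := f
  unfold sideWeight
  by_cases h0 : i = 0
  · subst h0
    rw [dif_pos rfl, dif_pos rfl]
    have e1 : Decoration.first (F := F) (fun s => a ⟨u, s⟩) =
        Decoration.first (F := F) (fun s => a₁ ⟨u, s⟩) := by
      refine first_congr fun s hs => h _ ?_
      rintro rfl
      apply hf
      rcases s with e | j
      · simp only [slotSide, hs]
        rw [if_neg (by simp)]
        rfl
      · simp [slotKind] at hs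
    have e2 : Decoration.last (F := F) (fun s => a ⟨G.next.symm u, s⟩) =
        Decoration.last (F := F) (fun s => a₁ ⟨G.next.symm u, s⟩) := by
      refine last_congr fun s hs => h _ ?_
      rintro rfl
      apply hf
      rcases s with e | j
      · simp only [slotSide, hs]
        rw [if_pos trivial, Equiv.apply_symm_apply]
        rfl
      · simp [slotKind] at hs
    simp only [initialWeight, e1, e2]
  · rw [dif_neg h0, dif_neg h0]
    refine h _ ?_
    rintro rfl
    apply hf
    simp only [slotSide]
    congr
    omega

theorem sideWeight_linear {α β : k} (h₁ : ∀ q, q ≠ p → a q = a₁ q) (h₂ : ∀ q, q ≠ p → a q = a₂ q)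
    (h : a p = α • a₁ p + β • a₂ p) :
    F.sideWeight G (fun w s => a ⟨w, s⟩) (slotSide G p) =
      α • F.sideWeight G (fun w s => a₁ ⟨w, s⟩) (slotSide G p) +
      β • F.sideWeight G (fun w s => a₂ ⟨w, s⟩) (slotSide G p) := by
  obtain ⟨w, s⟩ := p
  rcases s with e | j
  · have key : ∀ (d d' : ∀ p : Σ w, (G.color w).Slot (G.wt w - 1), F.A ((G.color p.1).slotLabel p.2))
        (hd : ∀ q, q ≠ ⟨w, Sum.inl e⟩ → d q = d' q) (u : G.Window) (b : Bool)
        (_ : slotKind (G.color w) (Sum.inl e : (G.color w).Slot (G.wt w - 1)) ≠ some b)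
        (s : (G.color u).Slot (G.wt u - 1)), slotKind (G.color u) s = some b →
        d ⟨u, s⟩ = d' ⟨u, s⟩ := by
      intro d d' hd u b hb s hs
      refine hd _ fun hq => hb ?_
      rw [← hs]
      exact (congrArg (fun q : Σ w, (G.color w).Slot (G.wt w - 1) =>
        slotKind (G.color q.1) q.2) hq).symm
    by_cases hk : slotKind (G.color w) (Sum.inl e : (G.color w).Slot (G.wt w - 1)) = some true
    · obtain ⟨u, rfl⟩ : ∃ u, w = G.next.symm u := ⟨G.next w, (G.next.symm_apply_apply w).symm⟩
      have hs : slotSide G ⟨G.next.symm u, Sum.inl e⟩ = G.firstFlag u := by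
        simp [slotSide, hk]
      have hb : slotKind (G.color (G.next.symm u)) (Sum.inl e : (G.color (G.next.symm u)).Slot
          (G.wt (G.next.symm u) - 1)) ≠ some false := by rw [hk]; simp
      have f1 : Decoration.first (F := F) (fun s => a ⟨u, s⟩) =
          Decoration.first (F := F) (fun s => a₁ ⟨u, s⟩) := first_congr (key a a₁ h₁ u false hb)
      have f2 : Decoration.first (F := F) (fun s => a₁ ⟨u, s⟩) =
          Decoration.first (F := F) (fun s => a₂ ⟨u, s⟩) :=
        f1.symm.trans (first_congr (key a a₂ h₂ u false hb))
      have l := last_linear (F := F) (d := fun s => a ⟨G.next.symm u, s⟩)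
        (d₁ := fun s => a₁ ⟨G.next.symm u, s⟩) (d₂ := fun s => a₂ ⟨G.next.symm u, s⟩) hk h
      rw [hs, sideWeight_firstFlag, sideWeight_firstFlag, sideWeight_firstFlag]
      unfold initialWeight
      split_ifs with hl
      · rw [l, f1, ← f2]
        simp only [map_add, map_smul, add_mul, smul_mul_assoc]
      · simp
    · have hk' := slotKind_inl _ _ _ hk
      have hs : slotSide G ⟨w, Sum.inl e⟩ = G.firstFlag w := by simp [slotSide, hk]
      have l1 : Decoration.last (F := F) (fun s => a ⟨G.next.symm w, s⟩) =
          Decoration.last (F := F) (fun s => a₁ ⟨G.next.symm w, s⟩) :=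
        last_congr (key a a₁ h₁ _ true hk)
      have l2 : Decoration.last (F := F) (fun s => a₁ ⟨G.next.symm w, s⟩) =
          Decoration.last (F := F) (fun s => a₂ ⟨G.next.symm w, s⟩) :=
        l1.symm.trans (last_congr (key a a₂ h₂ _ true hk))
      have f := first_linear (F := F) (d := fun s => a ⟨w, s⟩) (d₁ := fun s => a₁ ⟨w, s⟩)
        (d₂ := fun s => a₂ ⟨w, s⟩) (α := α) (β := β) (by
          intro s hs
          obtain rfl := slotKind_inj hs hk'
          exact h)
      rw [hs, sideWeight_firstFlag, sideWeight_firstFlag, sideWeight_firstFlag]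
      unfold initialWeight
      split_ifs with hl
      · rw [f, l1, ← l2]
        simp only [map_add, map_smul, mul_add, mul_smul_comm]
      · simp
  · have hs : slotSide G ⟨w, Sum.inr j⟩ = ⟨w, ⟨j.1 + 1, by have := j.2; omega⟩⟩ := rfl
    rw [hs]
    unfold sideWeight
    rw [dif_neg (Nat.succ_ne_zero _), dif_neg (Nat.succ_ne_zero _), dif_neg (Nat.succ_ne_zero _)]
    exact h
end

theorem pureCorrelator_linear (hC : F.ConditionC) (G : ArcDiagram B)
    {p : Σ w, (G.color w).Slot (G.wt w - 1)}
    {a a₁ a₂ : ∀ p : Σ w, (G.color w).Slot (G.wt w - 1), F.A ((G.color p.1).slotLabel p.2)}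
    {α β : k} (h₁ : ∀ q, q ≠ p → a q = a₁ q) (h₂ : ∀ q, q ≠ p → a q = a₂ q)
    (h : a p = α • a₁ p + β • a₂ p) :
    F.pureCorrelator G hC (fun w s => a ⟨w, s⟩) =
      α * F.pureCorrelator G hC (fun w s => a₁ ⟨w, s⟩) +
      β * F.pureCorrelator G hC (fun w s => a₂ ⟨w, s⟩) := by
  let I : CommRing (F.A ∅) := F.emptyCommRing hC
  let c : G.Region → F.A ∅ := fun r => F.euler ∅ ^ (1 - G.chi r).toNat
  let e : G.Region → F.A ∅ := fun r => ∏ᶠ p : {p : G.Puncture // G.punctureRegion p = r},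
      F.resDagger (G.punctureLabel p.1) (F.euler (G.punctureLabel p.1))
  let φ : G.Region → F.A ∅ →ₗ[k] k := fun r => (F.form ∅).flip 1 ∘ₗ
    LinearMap.mulRight k (e r) ∘ₗ LinearMap.mulLeft k (c r)
  exact prod_update_aux (k := k) (R := F.A ∅) G.region φ (slotSide G p) α β
    (F.sideWeight G (fun w s => a ⟨w, s⟩)) (F.sideWeight G (fun w s => a₁ ⟨w, s⟩))
    (F.sideWeight G (fun w s => a₂ ⟨w, s⟩)) (fun f hf => F.sideWeight_congr h₁ hf)
    (fun f hf => F.sideWeight_congr h₂ hf) (F.sideWeight_linear h₁ h₂ h)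

open scoped Classical in
/-- `pureCorrelator` is multilinear in the tensor factors. -/
def factorCorrelator (hC : F.ConditionC) (G : ArcDiagram B) : MultilinearMap k
    (fun p : Σ w, (G.color w).Slot (G.wt w - 1) => F.A ((G.color p.1).slotLabel p.2)) k :=
  MultilinearMap.mk' (fun a => F.pureCorrelator G hC (fun w s => a ⟨w, s⟩))
    (fun m i x y => by
      have := F.pureCorrelator_linear hC G (p := i) (a := Function.update m i (x + y))
        (a₁ := Function.update m i x) (a₂ := Function.update m i y) (α := 1) (β := 1)
        (fun q hq => by simp [hq]) (fun q hq => by simp [hq]) (by simp)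
      simpa only [one_mul] using this)
    (fun m i c x => by
      have := F.pureCorrelator_linear hC G (p := i) (a := Function.update m i (c • x))
        (a₁ := Function.update m i x) (a₂ := Function.update m i x) (α := c) (β := 0)
        (fun q hq => by simp [hq]) (fun q hq => by simp [hq]) (by simp)
      simpa only [zero_mul, add_zero, smul_eq_mul] using this)

/-- The correlator `Y(G)` in the only degrees in which it does not vanish: degree `wt w - 1` at each
window `w`. -/
def barCorrelatorPart (hC : F.ConditionC) (G : ArcDiagram B) :
    MultilinearMap k (fun w => F.Bar (G.color w) (G.wt w - 1)) k :=
  liftTensors (F.factorCorrelator hC G)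

theorem barCorrelatorPart_tprod (hC : F.ConditionC) (G : ArcDiagram B)
    (a : ∀ w, F.Decoration (G.color w) (G.wt w - 1)) :
    F.barCorrelatorPart hC G (fun w => PiTensorProduct.tprod k (a w)) = F.pureCorrelator G hC a := by
  unfold barCorrelatorPart
  have h := liftTensors_tprod (k := k) (S := fun w : G.Window => (G.color w).Slot (G.wt w - 1))
    (M := fun w s => F.A ((G.color w).slotLabel s))
  exact h (F.factorCorrelator hC G) (fun p => a p.1 p.2)

/-- The correlator `Y(G)` on the brane labelled bar complexes. -/
def barCorrelator (hC : F.ConditionC) (G : ArcDiagram B) : F.barSystem.Correlator G.color :=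
  (F.barCorrelatorPart hC G).compLinearMap (fun w =>
    DirectSum.component k ℕ (fun n => F.Bar (G.color w) n) (G.wt w - 1))

/-- The correlator `Y(G)` on the isomorphic Hochschild complexes. -/
def hochCorrelator (hC : F.ConditionC) (G : ArcDiagram B) : F.hochSystem.Correlator G.color :=
  (F.barCorrelatorPart hC G).compLinearMap (fun w =>
    (F.hochToBar (G.color w) (G.wt w - 1)).toLinearMap ∘ₗ
      DirectSum.component k ℕ (fun n => F.Hoch (G.color w) n) (G.wt w - 1))

end BraneFrobenius

/-! ## Actions via correlation functions -/

namespace ArcDiagram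

variable {B : Type z}

/-- The gluing `G ∘_{w,w'} G'` of windows of two different arc graphs, of the same weight. -/
def glue (G G' : ArcDiagram B) (w : G.Window) (w' : G'.Window) (h : G.wt w = G'.wt w') :
    ArcDiagram B :=
  (G.disjointUnion G').selfGlue (Sum.inl w) (Sum.inr w') Sum.inl_ne_inr h

/-- The glued foliation for windows of two different arc graphs. -/
def glueFoliation (G G' : ArcDiagram B) (w : G.Window) (w' : G'.Window) (h : G.wt w = G'.wt w') :
    ArcDiagram B :=
  (G.disjointUnion G').selfGlueFoliation (Sum.inl w) (Sum.inr w') Sum.inl_ne_inr h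

end ArcDiagram

variable {k : Type u} [Field k] {B : Type z}

/-- The gluings of discretely weighted arc graphs along windows with colours in `P` act on the graded
spaces `M` via the correlators `Y`: gluing corresponds to composition of correlators, and
self-gluing to self-composition.  Windows can be glued if they have the same weight and conjugate
colours.  The identities are asserted for the glued foliation in all cases, and for the glued arc
graph, in which closed leaves are deleted, whenever no closed leaf separates two components of the
complement of the glued foliation; in particular, whenever there are no closed leaves. -/
def ActsViaCorrelators (M : CoefficientSystem.{u, v, z} k B)
    (Y : ∀ G : ArcDiagram B, M.Correlator G.color) (P : Color B → Prop) : Prop :=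
  (∀ (G G' : ArcDiagram B), G.IsArcGraph → G'.IsArcGraph →
    ∀ (w : G.Window) (w' : G'.Window) (hwt : G.wt w = G'.wt w')
      (hcol : G'.color w' = (G.color w).bar), P (G.color w) →
      (∀ x, Y (G.glueFoliation G' w w' hwt) x = M.compose (Y G) (Y G') w w' hcol x) ∧
      ((G.disjointUnion G').ClosedLeavesNonseparating (Sum.inl w) (Sum.inr w')
          Sum.inl_ne_inr hwt →
        ∀ x, Y (G.glue G' w w' hwt) x = M.compose (Y G) (Y G') w w' hcol x)) ∧
  (∀ (G : ArcDiagram B), G.IsArcGraph →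
    ∀ (w w' : G.Window) (hne : w ≠ w') (hwt : G.wt w = G.wt w')
      (hcol : G.color w' = (G.color w).bar), P (G.color w) →
      (∀ x, Y (G.selfGlueFoliation w w' hne hwt) x = M.selfCompose (Y G) w w' hcol x) ∧
      (G.ClosedLeavesNonseparating w w' hne hwt →
        ∀ x, Y (G.selfGlue w w' hne hwt) x = M.selfCompose (Y G) w w' hcol x))

end

/-!
Write `Y(G)` on pure tensors as a product over the regions `r` of `∫ e^{1 - χ(r)} X(r)`, where `X(r)`
is the product of the weights of the boundary pieces and of the punctures in `r`.  The Casimir element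
of a bar complex is the tensor product of the Casimir elements of its factors, so composing along `w`
and `w'` means inserting, one tensor factor after the other, a pair of dual bases `(b_i)`, `(d_i)` of
some `A_S` at the two boundary pieces which the factor decorates.  One insertion glues these pieces.
If they lie in different regions, then the two integrals are merged into one,
`∑ ∫ x r_S†(u b_i) ∫ y r_S†(d_i v) = ∫ x y r_S†(u v)`,
because `r_S†` is the adjoint of an algebra map.  If they lie in the same region, then a factor `e`
appears, `∑ r_S†(u b_i) r_S†(d_i v) = e r_S†(u v)`: this is condition (E), which is not needed for
`S = ∅`, where it is the definition of `e`.  Both identities say that the Euler characteristic of a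
glued region is the sum of those of its parts minus the number of gluings along intervals.  They are
recorded by `RegionGluing.Glues`, and `RegionGluing.Glues.sum_gluedValue` is one such insertion; the
regions that have been glued so far are kept track of as the classes of the equivalence relation
generated by a list of pairs of regions.  Condition (E) is stated for labels with one element; for
larger labels it is trivial because `A_S = 0`.

The factors without distinguished points are inserted first, then, for open windows, those at the
initial and at the terminal point of `w`.  If the end of one window is immediately followed by the
beginning of the other, then the insertion does not glue two pieces but folds up a single one, and the
distinguished point between the windows becomes a puncture of weight `r_S†(∑ b_i d_i) = r_S†(e_S)`.
This is why the second end has to be treated with the cyclic order of the windows that results from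
gluing the first one, `RegionGluing.reroute`.  The identities
`BraneFrobenius.sum_pureCorrelator_closed` and `BraneFrobenius.sum_pureCorrelator_open` express the
composition by the list of all gluings.  The list generates the adjacency of regions in the glued
surface and contains the number of gluings that is prescribed by the formula for the Euler
characteristics in a glued diagram (`ArcDiagram.countP_closedPairs`, `ArcDiagram.countP_openPairs`).
Hence the result is the correlator of the glued foliation, `BraneFrobenius.pureCorrelator_glue`.  If no
closed leaf separates two regions, then deleting closed leaves does not change the regions.

The general case follows by multilinearity.  Gluing two arc graphs is the self-gluing of their disjoint
union, whose correlator is the product of the two correlators.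
-/

noncomputable section

/-! ### Gluing regions along a list of pairs -/

namespace RegionGluing

section classMap
variable {R : Type*} [DecidableEq R]

/-- A representative function for the classes of regions after the regions in each pair of the list
have been glued: two regions are glued to each other if and only if they have the same image. -/
def classMap : List (R × R) → R → R
  | [] => id
  | e :: l => fun r => if classMap l r = classMap l e.2 then classMap l e.1 else classMap l r

/-- The fibres of `classMap l` are the classes of the equivalence relation generated by `l`, in the
form of a universal property. -/
theorem classMap_le_iff (l : List (R × R)) (t : Setoid R) :
    (∀ a b, classMap l a = classMap l b → t a b) ↔ ∀ e ∈ l, t e.1 e.2 := by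
  induction l with
  | nil => simp [classMap]
  | cons e l ih =>
    rw [List.forall_mem_cons, ← ih]
    constructor
    · refine fun H => ⟨H _ _ (by simp [classMap]), fun a b hab => H _ _ (by simp [classMap, hab])⟩
    · rintro ⟨he, H⟩ a b hab
      simp only [classMap] at hab
      split_ifs at hab with ha hb hb
      · exact H _ _ (ha.trans hb.symm)
      · exact t.trans (H _ _ ha) (t.trans (t.symm he) (H _ _ hab))
      · exact t.trans (H _ _ hab) (t.trans he (t.symm (H _ _ hb)))
      · exact H _ _ hab

theorem classMap_eq_of_mem {l : List (R × R)} {e : R × R} (he : e ∈ l) :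
    classMap l e.1 = classMap l e.2 :=
  (classMap_le_iff l (Setoid.ker (classMap l))).1 (fun _ _ h => h) e he

end classMap

section foldMul
variable {R Q A : Type*} [Fintype R] [DecidableEq Q] [CommMonoid A]

/-- The push-forward of a function along `π`, multiplying the values in each fibre. -/
def foldMul (π : R → Q) (X : R → A) (q : Q) : A := ∏ r with π r = q, X r

theorem foldMul_mul (π : R → Q) (X Y : R → A) :
    foldMul π (X * Y) = foldMul π X * foldMul π Y :=
  funext fun _ => Finset.prod_mul_distrib

theorem foldMul_one (π : R → Q) : foldMul π (1 : R → A) = 1 :=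
  funext fun _ => Finset.prod_eq_one fun _ _ => rfl

theorem foldMul_mulSingle [DecidableEq R] (π : R → Q) (r : R) (x : A) :
    foldMul π (Pi.mulSingle r x) = Pi.mulSingle (π r) x := by
  funext q
  rw [foldMul, Finset.prod_filter]
  by_cases h : π r = q
  · subst h
    rw [Finset.prod_eq_single r (by
      intro b _ hb
      rw [Pi.mulSingle_eq_of_ne hb, ite_self]) (by simp)]
    simp
  · rw [Pi.mulSingle_eq_of_ne (Ne.symm h)]
    refine Finset.prod_eq_one fun b _ => ?_
    split_ifs with hb
    · rw [Pi.mulSingle_eq_of_ne (fun h' : b = r => h (by rw [← h']; exact hb))]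
    · rfl

theorem foldMul_prod {ι : Type*} (π : R → Q) (s : Finset ι) (X : ι → R → A) :
    foldMul π (∏ i ∈ s, X i) = ∏ i ∈ s, foldMul π (X i) := by
  classical
  induction s using Finset.induction_on with
  | empty => funext q; simp [foldMul]
  | insert i s hi ih => rw [Finset.prod_insert hi, Finset.prod_insert hi, foldMul_mul, ih]

end foldMul

section merge
variable {R : Type*} [DecidableEq R] {l : List (R × R)} {a b : R}

theorem classMap_cons_of_eq (h : classMap l a = classMap l b) :
    classMap ((a, b) :: l) = classMap l := by
  funext r
  simp only [classMap]
  split_ifs with hr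
  exacts [h.trans hr.symm, rfl]

theorem classMap_cons_eq_left (r : R) :
    classMap ((a, b) :: l) r = classMap l a ↔
      classMap l r = classMap l a ∨ classMap l r = classMap l b := by
  simp only [classMap]
  split_ifs with hr <;> simp [hr]

theorem classMap_cons_eq_iff {q : R} (ha : q ≠ classMap l a) (hb : q ≠ classMap l b) (r : R) :
    classMap ((a, b) :: l) r = q ↔ classMap l r = q := by
  simp only [classMap]
  split_ifs with hr
  · exact ⟨fun h => absurd h.symm ha, fun h => absurd (h.symm.trans hr) hb⟩
  · rfl

theorem classMap_cons_ne (h : classMap l a ≠ classMap l b) (r : R) :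
    classMap ((a, b) :: l) r ≠ classMap l b := by
  simp only [classMap]
  split_ifs with hr
  exacts [h, hr]

theorem image_classMap_cons [Fintype R] (h : classMap l a ≠ classMap l b) :
    Finset.univ.image (classMap ((a, b) :: l)) =
      (Finset.univ.image (classMap l)).erase (classMap l b) := by
  ext q
  simp only [Finset.mem_image, Finset.mem_univ, true_and, Finset.mem_erase]
  constructor
  · rintro ⟨r, rfl⟩
    refine ⟨classMap_cons_ne h r, ?_⟩
    simp only [classMap]
    split_ifs
    exacts [⟨a, rfl⟩, ⟨r, rfl⟩]
  · rintro ⟨hq, r, rfl⟩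
    exact ⟨r, if_neg hq⟩

theorem countP_or {E : Type*} (p p' : E → Prop) [DecidablePred p] [DecidablePred p']
    (h : ∀ x, p x → ¬ p' x) (m : List E) :
    m.countP (fun x => p x ∨ p' x) = m.countP (fun x => p x) + m.countP (fun x => p' x) := by
  induction m with
  | nil => rfl
  | cons x m ih =>
    simp only [List.countP_cons, ih, decide_eq_true_eq]
    have := h x
    by_cases hp : p x <;> by_cases hp' : p' x <;> simp_all <;> omega

theorem countP_class_cons_left (h : classMap l a ≠ classMap l b) (m : List (R × R)) :
    m.countP (fun e => classMap ((a, b) :: l) e.1 = classMap l a) =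
      m.countP (fun e => classMap l e.1 = classMap l a) +
        m.countP (fun e => classMap l e.1 = classMap l b) := by
  simp only [classMap_cons_eq_left]
  exact countP_or _ _ (fun x hx hx' => h (hx.symm.trans hx')) m

theorem filter_class_cons_left [Fintype R] :
    Finset.univ.filter (fun r => classMap ((a, b) :: l) r = classMap l a) =
      Finset.univ.filter (fun r => classMap l r = classMap l a) ∪
        Finset.univ.filter (fun r => classMap l r = classMap l b) := by
  ext r
  simp [classMap_cons_eq_left]

theorem disjoint_filter_class [Fintype R] (h : classMap l a ≠ classMap l b) :
    Disjoint (Finset.univ.filter (fun r => classMap l r = classMap l a))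
      (Finset.univ.filter (fun r => classMap l r = classMap l b)) :=
  Finset.disjoint_filter.2 fun _ _ hx hx' => h (hx.symm.trans hx')

end merge

section gluedValue
variable {k A R ι : Type*} [Field k] [CommRing A] [Algebra k A] [Fintype R] [DecidableEq R]
  [Fintype ι]

/-- The first Betti number of the graph whose vertices are the regions in the class `q` and whose
edges are the gluings between them. -/
def excess (l : List (R × R)) (q : R) : ℕ :=
  l.countP (fun e => classMap l e.1 = q) + 1 - Finset.card {r | classMap l r = q}

/-- A class of regions is connected, so the number of its gluings is at least the number of its
regions minus one; in particular the subtraction in `excess` is not truncated. -/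
theorem card_class_le (l : List (R × R)) (q : R) :
    Finset.card {r | classMap l r = q} ≤ l.countP (fun e => classMap l e.1 = q) + 1 := by
  induction l generalizing q with
  | nil =>
    refine Finset.card_le_one.2 fun x hx y hy => ?_
    exact (Finset.mem_filter.1 hx).2.trans (Finset.mem_filter.1 hy).2.symm
  | cons e l ih =>
    obtain ⟨a, b⟩ := e
    by_cases h : classMap l a = classMap l b
    · rw [classMap_cons_of_eq h, List.countP_cons]
      exact (ih q).trans (by omega)
    · rw [List.countP_cons]
      by_cases ha : q = classMap l a
      · subst ha
        rw [filter_class_cons_left, Finset.card_union_of_disjoint (disjoint_filter_class h),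
          countP_class_cons_left h, if_pos (by simp [classMap_cons_eq_left])]
        have := ih (classMap l a)
        have := ih (classMap l b)
        omega
      · by_cases hb : q = classMap l b
        · subst hb
          simp [classMap_cons_ne h]
        · simp only [classMap_cons_eq_iff ha hb]
          exact (ih q).trans (by omega)

/-- The product over the classes of glued regions of `φ (e ^ b * ∏ X)`, where `b` is the first Betti
number of the class and the product is over its regions. -/
def gluedValue (φ : A →ₗ[k] k) (e : A) (l : List (R × R)) (X : R → A) : k :=
  ∏ q ∈ Finset.univ.image (classMap l), φ (e ^ excess l q * foldMul (classMap l) X q)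

/-- The identities which make it possible to glue two pieces of boundary with weights `f i` and
`g i`, summed over `i`, to a piece of weight `h`: the first is used if both pieces belong to the same
region, the second if they belong to different regions. -/
structure Glues (φ : A →ₗ[k] k) (e : A) (f g : ι → A) (h : A) : Prop where
  sum_mul : ∑ i, f i * g i = e * h
  sum_apply : ∀ x y, ∑ i, φ (x * f i) * φ (y * g i) = φ (x * y * h)

/-- Gluing along one more pair of boundary pieces, in the regions `a` and `b`.  If these are already
in the same class, then its first Betti number increases by one; otherwise two classes are joined and
their Betti numbers add up. -/
theorem Glues.sum_gluedValue {φ : A →ₗ[k] k} {e : A} {f g : ι → A} {h : A} (H : Glues φ e f g h)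
    (l : List (R × R)) (X : R → A) (a b : R) :
    ∑ i, gluedValue φ e l (X * (Pi.mulSingle a (f i) * Pi.mulSingle b (g i))) =
      gluedValue φ e ((a, b) :: l) (X * Pi.mulSingle b h) := by
  have mem : ∀ r, classMap l r ∈ Finset.univ.image (classMap l) := fun r =>
    Finset.mem_image_of_mem _ (Finset.mem_univ r)
  by_cases hab : classMap l a = classMap l b
  · have hex : excess ((a, b) :: l) (classMap l b) = excess l (classMap l b) + 1 := by
      have := card_class_le l (classMap l b)
      simp only [excess, classMap_cons_of_eq hab, List.countP_cons, hab, decide_true, if_true]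
      omega
    have hne : ∀ q, q ≠ classMap l b → excess ((a, b) :: l) q = excess l q := by
      intro q hq
      have h' : ¬ classMap l a = q := fun h' => hq (h'.symm.trans hab)
      simp [excess, classMap_cons_of_eq hab, h']
    unfold gluedValue
    rw [classMap_cons_of_eq hab]
    simp only [← Finset.mul_prod_erase _ _ (mem b), foldMul_mul, foldMul_mulSingle, hab]
    rw [Finset.sum_congr rfl (g := fun i => φ (e ^ excess l (classMap l b) *
        foldMul (classMap l) X (classMap l b) * (f i * g i)) *
        ∏ q ∈ (Finset.univ.image (classMap l)).erase (classMap l b),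
          φ (e ^ excess ((a, b) :: l) q * foldMul (classMap l) X q))]
    · rw [← Finset.sum_mul, ← map_sum, ← Finset.mul_sum, H.sum_mul, hex]
      congr 1
      · congr 1
        simp only [Pi.mul_apply, Pi.mulSingle_eq_same]
        ring
      · refine Finset.prod_congr rfl fun q hq => ?_
        simp [Pi.mulSingle_eq_of_ne (Finset.ne_of_mem_erase hq)]
    · intro i _
      congr 1
      · congr 1
        simp only [Pi.mul_apply, Pi.mulSingle_eq_same]
        ring
      · refine Finset.prod_congr rfl fun q hq => ?_
        simp [Pi.mulSingle_eq_of_ne (Finset.ne_of_mem_erase hq), hne q (Finset.ne_of_mem_erase hq)]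
  · have hmem : classMap l a ∈ (Finset.univ.image (classMap l)).erase (classMap l b) :=
      Finset.mem_erase.2 ⟨hab, mem a⟩
    have hex : excess ((a, b) :: l) (classMap l a) =
        excess l (classMap l a) + excess l (classMap l b) := by
      have := card_class_le l (classMap l a)
      have := card_class_le l (classMap l b)
      simp only [excess]
      rw [List.countP_cons, filter_class_cons_left,
        Finset.card_union_of_disjoint (disjoint_filter_class hab), countP_class_cons_left hab,
        if_pos (by simp [classMap_cons_eq_left])]
      omega
    have hne : ∀ q, q ≠ classMap l a → q ≠ classMap l b →
        excess ((a, b) :: l) q = excess l q := by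
      intro q hqa hqb
      have h' : ¬ classMap l a = q := fun h' => hqa h'.symm
      simp only [excess, List.countP_cons, classMap_cons_eq_iff hqa hqb, h', decide_false,
        Bool.false_eq_true, if_false, add_zero]
    have hfold : foldMul (classMap ((a, b) :: l)) X (classMap l a) =
        foldMul (classMap l) X (classMap l a) * foldMul (classMap l) X (classMap l b) := by
      simp only [foldMul]
      rw [filter_class_cons_left, Finset.prod_union (disjoint_filter_class hab)]
    have hfold' : ∀ q, q ≠ classMap l a → q ≠ classMap l b →
        foldMul (classMap ((a, b) :: l)) X q = foldMul (classMap l) X q := by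
      intro q hqa hqb
      simp only [foldMul, classMap_cons_eq_iff hqa hqb]
    have hb : classMap ((a, b) :: l) b = classMap l a := (classMap_cons_eq_left b).2 (Or.inr rfl)
    unfold gluedValue
    rw [image_classMap_cons hab]
    simp only [← Finset.mul_prod_erase _ _ (mem b), ← Finset.mul_prod_erase _ _ hmem,
      foldMul_mul, foldMul_mulSingle, Pi.mul_apply, Pi.mulSingle_eq_same,
      Pi.mulSingle_eq_of_ne hab, Pi.mulSingle_eq_of_ne (Ne.symm hab), mul_one, one_mul, hb, hex,
      hfold]
    rw [Finset.sum_congr rfl (g := fun i =>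
        (φ (e ^ excess l (classMap l a) * foldMul (classMap l) X (classMap l a) * f i) *
        φ (e ^ excess l (classMap l b) * foldMul (classMap l) X (classMap l b) * g i)) *
        ∏ q ∈ ((Finset.univ.image (classMap l)).erase (classMap l b)).erase (classMap l a),
          φ (e ^ excess l q * foldMul (classMap l) X q))]
    · rw [← Finset.sum_mul, H.sum_apply]
      congr 1
      · congr 1
        ring
      · refine Finset.prod_congr rfl fun q hq => ?_
        have hqa := Finset.ne_of_mem_erase hq
        have hqb := Finset.ne_of_mem_erase (Finset.mem_of_mem_erase hq)
        rw [Pi.mulSingle_eq_of_ne hqa, mul_one, hne q hqa hqb, hfold' q hqa hqb]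
    · intro i _
      rw [← mul_assoc, mul_comm (φ _) (φ _), ← mul_assoc (e ^ _), ← mul_assoc (e ^ _)]
      congr 1
      refine Finset.prod_congr rfl fun q hq => ?_
      have hqa := Finset.ne_of_mem_erase hq
      have hqb := Finset.ne_of_mem_erase (Finset.mem_of_mem_erase hq)
      rw [Pi.mulSingle_eq_of_ne hqa, Pi.mulSingle_eq_of_ne hqb, mul_one, mul_one]

end gluedValue
end RegionGluing

/-! ### Dual pairs and Casimir elements -/

section DualPair
variable {k V ι κ : Type*} [Field k] [AddCommGroup V] [Module k V] [Fintype ι] [Fintype κ]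

/-- Two finite families which are dual with respect to a bilinear form, so that
`∑ i, b i ⊗ d i` is its Casimir element. -/
structure IsDualPair (form : LinearMap.BilinForm k V) (b d : ι → V) : Prop where
  sum_left : ∀ x, ∑ i, form x (d i) • b i = x
  sum_right : ∀ x, ∑ i, form x (b i) • d i = x

theorem IsDualPair.symm {form : LinearMap.BilinForm k V} {b d : ι → V}
    (h : IsDualPair form b d) : IsDualPair form d b := ⟨h.2, h.1⟩

/-- The Casimir element does not depend on the choice of the dual pair. -/
theorem IsDualPair.sum_eq {form : LinearMap.BilinForm k V} (hs : form.IsSymm) {b d : ι → V}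
    {b' d' : κ → V} (h : IsDualPair form b d) (h' : IsDualPair form b' d')
    {N : Type*} [AddCommGroup N] [Module k N] (f : V →ₗ[k] V →ₗ[k] N) :
    ∑ i, f (b i) (d i) = ∑ j, f (b' j) (d' j) := by
  calc ∑ i, f (b i) (d i) = ∑ i, ∑ j, f (b' j) (form (b i) (d' j) • d i) := by
        refine Finset.sum_congr rfl fun i _ => ?_
        conv_lhs => rw [← h'.sum_left (b i)]
        simp [map_sum, LinearMap.sum_apply]
    _ = ∑ j, f (b' j) (d' j) := by
        rw [Finset.sum_comm]
        refine Finset.sum_congr rfl fun j _ => ?_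
        rw [← map_sum]
        conv_rhs => rw [← h.sum_right (d' j)]
        simp only [fun i => hs.eq (b i) (d' j)]

variable [Module.Finite k V]

/-- The family dual to the basis used in `insertCasimir`. -/
def dualVec (form : LinearMap.BilinForm k V) (i : Fin (Module.finrank k V)) : V :=
  ∑ j, (LinearMap.BilinForm.toMatrix (Module.finBasis k V) form)⁻¹ i j • Module.finBasis k V j

theorem isDualPair_finBasis {form : LinearMap.BilinForm k V} (hs : form.IsSymm)
    (hn : form.Nondegenerate) : IsDualPair form (Module.finBasis k V) (dualVec form) := by
  set b := Module.finBasis k V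
  have hdet : IsUnit (LinearMap.BilinForm.toMatrix b form).det :=
    (LinearMap.BilinForm.nondegenerate_iff_det_ne_zero b).1 hn |>.isUnit
  have hd : ∀ i j, form (dualVec form i) (b j) = if i = j then 1 else 0 := by
    intro i j
    have := congrFun (congrFun (Matrix.nonsing_inv_mul _ hdet) i) j
    rw [Matrix.mul_apply, Matrix.one_apply] at this
    rw [← this]
    simp [dualVec, LinearMap.sum_apply, b, LinearMap.BilinForm.toMatrix_apply]
  have hleft : ∀ x, ∑ i, form x (dualVec form i) • b i = x := by
    intro x
    conv_rhs => rw [← b.sum_repr x]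
    refine Finset.sum_congr rfl fun i _ => congrArg (· • b i) ?_
    calc form x (dualVec form i) = form (dualVec form i) (∑ j, b.repr x j • b j) := by
          rw [b.sum_repr, hs.eq]
      _ = b.repr x i := by
          rw [map_sum, Finset.sum_eq_single i (by
            intro j _ hj
            rw [map_smul, hd, if_neg hj.symm, smul_zero]) (by simp)]
          simp [hd]
  refine ⟨hleft, fun x => ?_⟩
  rw [← sub_eq_zero]
  refine hn.1 _ fun y => ?_
  conv_lhs => rw [← hleft y]
  have h1 : ∀ j, form x (b j) = ∑ i, form x (b i) * form (dualVec form i) (b j) := by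
    intro j
    simp [hd]
  simp [LinearMap.sum_apply, ← h1]

theorem insertCasimir_eq_sum {form : LinearMap.BilinForm k V} (hs : form.IsSymm)
    (hn : form.Nondegenerate) {b d : ι → V} (h : IsDualPair form b d) {N : Type*}
    [AddCommGroup N] [Module k N] (f : V →ₗ[k] V →ₗ[k] N) :
    insertCasimir form (fun x y => f x y) = ∑ i, f (b i) (d i) := by
  rw [h.sum_eq hs (isDualPair_finBasis hs hn)]
  simp [insertCasimir, dualVec]

end DualPair

/-! ### Weights of boundary pieces -/

namespace BraneFrobenius
open RegionGluing

variable {k : Type u} [Field k] {B : Type z} (F : BraneFrobenius.{u, v, z} k B)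

/-- A fixed basis of `A_S`. -/
def vec (S : Set B) (i : Fin (Module.finrank k (F.A S))) : F.A S := Module.finBasis k (F.A S) i

/-- The basis of `A_S` dual to `vec`. -/
def covec (S : Set B) (i : Fin (Module.finrank k (F.A S))) : F.A S := dualVec (F.form S) i

theorem isDualPair_vec (S : Set B) : IsDualPair (F.form S) (F.vec S) (F.covec S) :=
  isDualPair_finBasis (F.form_symm S) (F.form_nondegenerate S)

theorem insertCasimir_eq {ι : Type*} [Fintype ι] {S : Set B} {b d : ι → F.A S}
    (h : IsDualPair (F.form S) b d)
    {N : Type*} [AddCommGroup N] [Module k N] (f : F.A S →ₗ[k] F.A S →ₗ[k] N) :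
    insertCasimir (F.form S) (fun x y => f x y) = ∑ i, f (b i) (d i) :=
  insertCasimir_eq_sum (F.form_symm S) (F.form_nondegenerate S) h f

theorem sum_mul_eq_euler {ι : Type*} [Fintype ι] {S : Set B} {b d : ι → F.A S}
    (h : IsDualPair (F.form S) b d) : ∑ i, b i * d i = F.euler S :=
  (F.insertCasimir_eq h (LinearMap.mul k (F.A S))).symm

/-- The integral on `A = A_∅` as a linear form. -/
def integralForm : F.A ∅ →ₗ[k] k := (F.form ∅).flip 1

theorem form_eq_integral (S : Set B) (x y : F.A S) : F.form S x y = F.form S (x * y) 1 := by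
  rw [F.form_mul, mul_one]

theorem sum_form_mul_form {ι : Type*} [Fintype ι] {S : Set B} {b d : ι → F.A S}
    (h : IsDualPair (F.form S) b d) (x y : F.A S) :
    ∑ i, F.form S x (b i) * F.form S y (d i) = F.form S x y := by
  conv_rhs => rw [← h.sum_left y, map_sum]
  refine Finset.sum_congr rfl fun i _ => ?_
  rw [map_smul, smul_eq_mul, mul_comm]

/-- Under condition (C) the ring `A = A_∅` is commutative. -/
instance emptyCommRingOfFact [hC : Fact F.ConditionC] : CommRing (F.A ∅) := F.emptyCommRing hC.out

/-- Dual bases of `A` glue two pieces without distinguished points. -/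
theorem glues_of_isDualPair [Fact F.ConditionC] {ι : Type*} [Fintype ι] {b d : ι → F.A ∅}
    (h : IsDualPair (F.form ∅) b d) :
    Glues F.integralForm (F.euler ∅) b d 1 := by
  refine ⟨(F.sum_mul_eq_euler h).trans (mul_one _).symm, fun x y => ?_⟩
  calc ∑ i, F.form ∅ (x * b i) 1 * F.form ∅ (y * d i) 1
      = ∑ i, F.form ∅ x (b i) * F.form ∅ y (d i) := by
        simp only [← form_eq_integral]
    _ = F.form ∅ (x * y * 1) 1 := by rw [F.sum_form_mul_form h, mul_one, ← F.form_eq_integral]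

/-- Condition (E) for an arbitrary nonempty label `S`: if `S` has at least two elements then
`A_S = 0`. -/
theorem sum_resDagger_mul_resDagger (hF : F.IsBasic) (hE : F.ConditionE) {S : Set B}
    (hS : S.Nonempty) {ι : Type*} [Fintype ι] {b d : ι → F.A S} (h : IsDualPair (F.form S) b d)
    (x y : F.A S) :
    ∑ i, F.resDagger S (x * b i) * F.resDagger S (d i * y) =
      F.euler ∅ * F.resDagger S (x * y) := by
  rcases S.subsingleton_or_nontrivial with h1 | h1
  · obtain ⟨c, rfl⟩ := h1.eq_empty_or_singleton.resolve_left hS.ne_empty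
    rw [← hE c x y]
    exact (F.insertCasimir_eq h ((LinearMap.mul k (F.A ∅)).compl₁₂
      (F.resDagger {c} ∘ₗ LinearMap.mulLeft k x) (F.resDagger {c} ∘ₗ LinearMap.mulRight k y))).symm
  · have := hF S h1
    simp [Subsingleton.elim x 0]

/-- Cyclic invariance of the integral of a product. -/
theorem form_mul_cycle (S : Set B) (a b c : F.A S) :
    F.form S (a * b) c = F.form S (c * a) b := by
  rw [(F.form_symm S).eq, ← F.form_mul]

theorem integral_mul_resDagger (S : Set B) (x : F.A ∅) (y : F.A S) :
    F.form ∅ (x * F.resDagger S y) 1 = F.form S y (F.res (Set.empty_subset S) x) := by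
  rw [← F.form_eq_integral, (F.form_symm ∅).eq]
  exact F.form_resDagger S y x

/-- Dual bases of `A_S` glue two pieces along the halves after and before distinguished points with
label `S`. -/
theorem glues_resDagger [Fact F.ConditionC] (hF : F.IsBasic) (hE : F.ConditionE) {S : Set B}
    (hS : S.Nonempty) {ι : Type*} [Fintype ι] {b d : ι → F.A S} (h : IsDualPair (F.form S) b d)
    (x y : F.A S) :
    Glues F.integralForm (F.euler ∅) (fun i => F.resDagger S (x * b i))
      (fun i => F.resDagger S (d i * y)) (F.resDagger S (x * y)) := by
  refine ⟨F.sum_resDagger_mul_resDagger hF hE hS h x y, fun p q => ?_⟩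
  set r := F.res (Set.empty_subset S)
  calc ∑ i, F.form ∅ (p * F.resDagger S (x * b i)) 1 * F.form ∅ (q * F.resDagger S (d i * y)) 1
      = ∑ i, F.form S (r p * x) (b i) * F.form S (y * r q) (d i) := by
        refine Finset.sum_congr rfl fun i _ => ?_
        rw [F.integral_mul_resDagger, F.integral_mul_resDagger, F.form_mul_cycle S x,
          F.form_mul S (d i) y, (F.form_symm S).eq (d i)]
    _ = F.form ∅ (p * q * F.resDagger S (x * y)) 1 := by
        rw [F.sum_form_mul_form h, F.integral_mul_resDagger]
        change _ = F.form S (x * y) (r (p * q))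
        rw [mul_comm p q, map_mul r, ← F.form_mul S (x * y), (F.form_symm S).eq _ (r p), F.form_mul,
          mul_assoc]

/-- The weight `r_S†(x y)` of a piece that contains a point with label `S`, where `x` and `y` are
the factors before and after the point; it is zero if the labels of `x` and `y` differ. -/
def pointWeight (x y : Σ S, F.A S) : F.A ∅ :=
  if h : x.1 = y.1 then F.resDagger y.1 (F.relabel h x.2 * y.2) else 0

theorem pointWeight_mk (S : Set B) (x y : F.A S) :
    F.pointWeight ⟨S, x⟩ ⟨S, y⟩ = F.resDagger S (x * y) := dif_pos rfl

theorem resDagger_empty (x : F.A ∅) : F.resDagger ∅ x = x := by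
  refine LinearMap.BilinForm.Nondegenerate.ker_eq_bot (F.form_nondegenerate ∅) |> fun h =>
    (LinearMap.ker_eq_bot.1 h) (LinearMap.ext fun a => ?_)
  rw [F.form_resDagger, F.res_id]
  rfl

end BraneFrobenius

/-! ### Gluing along several pieces -/

namespace RegionGluing

section
variable {k A R ι : Type*} [Field k] [CommRing A] [Algebra k A] [Fintype R] [DecidableEq R]
  [Fintype ι]

theorem sum_gluedValue_mulSingle (φ : A →ₗ[k] k) (e : A) (l : List (R × R)) (X : R → A) (a : R)
    (f : ι → A) :
    ∑ i, gluedValue φ e l (X * Pi.mulSingle a (f i)) =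
      gluedValue φ e l (X * Pi.mulSingle a (∑ i, f i)) := by
  have mem : classMap l a ∈ Finset.univ.image (classMap l) :=
    Finset.mem_image_of_mem _ (Finset.mem_univ a)
  unfold gluedValue
  simp only [← Finset.mul_prod_erase _ _ mem, foldMul_mul, foldMul_mulSingle, Pi.mul_apply,
    Pi.mulSingle_eq_same, Finset.mul_sum, map_sum, Finset.sum_mul]
  refine Finset.sum_congr rfl fun i _ => congrArg (_ * ·) (Finset.prod_congr rfl fun q hq => ?_)
  rw [Pi.mulSingle_eq_of_ne (Finset.ne_of_mem_erase hq),
    Pi.mulSingle_eq_of_ne (Finset.ne_of_mem_erase hq)]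

theorem sum_gluedValue_pi {φ : A →ₗ[k] k} {e : A} {f g : ι → A} (H : Glues φ e f g 1) {n : ℕ}
    (p q : Fin n → R) (l : List (R × R)) (X : R → A) :
    ∑ κ : Fin n → ι, gluedValue φ e l
      (X * ∏ j, (Pi.mulSingle (p j) (f (κ j)) * Pi.mulSingle (q j) (g (κ j)))) =
      gluedValue φ e (List.ofFn (fun j => (p j, q j)) ++ l) X := by
  induction n generalizing l X with
  | zero => simp
  | succ n ih =>
    rw [← (Fin.consEquiv fun _ => ι).sum_comp, Fintype.sum_prod_type]
    simp only [Fin.prod_univ_succ, Fin.consEquiv_apply, Fin.cons_zero, Fin.cons_succ,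
      ← mul_assoc X, ih (fun j => p j.succ) (fun j => q j.succ)]
    simp only [mul_assoc X]
    rw [H.sum_gluedValue, List.ofFn_succ, Pi.mulSingle_one, mul_one]
    rfl

theorem sum_gluedValue_pi_rev {φ : A →ₗ[k] k} {e : A} {f g : ι → A} (H : Glues φ e f g 1) {n : ℕ}
    (p q : Fin n → R) (l : List (R × R)) (X : R → A) :
    ∑ κ : Fin n → ι, gluedValue φ e l
      (X * ((∏ j, Pi.mulSingle (p j) (f (κ j))) * ∏ j, Pi.mulSingle (q j) (g (κ j.rev)))) =
      gluedValue φ e (List.ofFn (fun j => (p j, q j.rev)) ++ l) X := by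
  rw [← sum_gluedValue_pi H]
  refine Finset.sum_congr rfl fun κ _ => ?_
  rw [Finset.prod_mul_distrib]
  refine congrArg (fun Z => gluedValue _ _ _ (X * (_ * Z))) ?_
  refine Fintype.prod_equiv Fin.revPerm _ _ fun j => ?_
  simp

/-- The value computed with any other set of representatives `Q` of the classes.  If the weights of
the regions contain the powers of `e` prescribed by Euler characteristics `χ`, then the result has
the powers of `e` prescribed by the Euler characteristics `χ'` of the glued regions. -/
theorem gluedValue_eq_prod {Q : Type*} [Fintype Q] [DecidableEq Q] (φ : A →ₗ[k] k) (e : A)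
    (l : List (R × R)) (X : R → A) (χ : R → ℤ) (hχ : ∀ r, χ r ≤ 1) (mk : R → Q)
    (hmk : Function.Surjective mk) (h : ∀ a b, classMap l a = classMap l b ↔ mk a = mk b)
    (χ' : Q → ℤ) (hχ' : ∀ c, χ' c = ∑ r with mk r = c, χ r -
      (l.countP (fun p => mk p.1 = c) : ℤ)) :
    gluedValue φ e l ((fun r => e ^ (1 - χ r).toNat) * X) =
      ∏ c, φ (e ^ (1 - χ' c).toNat * foldMul mk X c) := by
  have hs : ∀ r, Finset.univ.filter (fun x => classMap l x = classMap l r) =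
      Finset.univ.filter (fun x => mk x = mk r) := fun r =>
    Finset.filter_congr fun x _ => h x r
  symm
  refine Finset.prod_bij (fun c _ => classMap l (Function.surjInv hmk c)) (fun c _ =>
    Finset.mem_image_of_mem _ (Finset.mem_univ _)) (fun c _ c' _ hc => ?_) (fun q hq => ?_)
    (fun c _ => ?_)
  · simpa [Function.surjInv_eq hmk] using (h _ _).1 hc
  · obtain ⟨r, -, rfl⟩ := Finset.mem_image.1 hq
    exact ⟨mk r, Finset.mem_univ _, (h _ _).2 (Function.surjInv_eq hmk _)⟩
  · obtain ⟨r, rfl⟩ := hmk c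
    have hr : classMap l (Function.surjInv hmk (mk r)) = classMap l r :=
      (h _ _).2 (Function.surjInv_eq hmk _)
    rw [hr, foldMul_mul, Pi.mul_apply, ← mul_assoc]
    have h2 : foldMul (classMap l) X (classMap l r) = foldMul mk X (mk r) := by
      rw [foldMul, foldMul, hs]
    have h1 : foldMul (classMap l) (fun r => e ^ (1 - χ r).toNat) (classMap l r) =
        e ^ ∑ x with mk x = mk r, (1 - χ x).toNat := by
      rw [foldMul, hs, Finset.prod_pow_eq_pow_sum]
    rw [h1, h2, ← pow_add]
    congr 3
    have hle := card_class_le l (classMap l r)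
    have hsum : ((∑ x with mk x = mk r, (1 - χ x).toNat : ℕ) : ℤ) =
        Finset.card {x | mk x = mk r} - ∑ x with mk x = mk r, χ x := by
      push_cast
      rw [Finset.card_eq_sum_ones, Nat.cast_sum, ← Finset.sum_sub_distrib]
      refine Finset.sum_congr rfl fun x _ => ?_
      have := hχ x
      omega
    have hc := hχ' (mk r)
    simp only [excess, h] at hle ⊢
    omega

theorem gluedValue_nil (φ : A →ₗ[k] k) (e : A) (X : R → A) :
    gluedValue φ e [] X = ∏ r, φ (X r) := by
  have := gluedValue_eq_prod φ e [] X (fun _ => 1) (fun _ => le_rfl) id Function.surjective_id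
    (fun _ _ => Iff.rfl) (fun _ => 1) (by simp [Finset.filter_eq'])
  have h1 : (fun _ : R => e ^ (1 - (1 : ℤ)).toNat) * X = X := by
    funext r
    simp
  rw [h1] at this
  rw [this]
  refine Finset.prod_congr rfl fun r _ => ?_
  simp [foldMul, Finset.filter_eq']

end

/-! ### Gluing the ends of two windows -/

section
variable {k A R W P ι : Type*} [Field k] [CommRing A] [Algebra k A] [Fintype R] [DecidableEq R]
  [DecidableEq W] [Fintype ι]

/-- The product of the weights of the boundary pieces at the initial points of the windows in `U`.
The piece at the initial point of `u` lies in the region `loc u`, and its weight is formed from the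
factor `y u` after this point and from the last factor `x` of the window before `u`. -/
def pointContent (pw : P → P → A) (loc : W → R) (σ : Equiv.Perm W) (U : Finset W) (x y : W → P) :
    R → A :=
  ∏ u ∈ U, Pi.mulSingle (loc u) (pw (x (σ.symm u)) (y u))

/-- The successor map after the end of the window `w₂` has been glued to the beginning of `w₁`: the
window before `w₁` is now followed by the window after `w₂`. -/
def reroute (σ : Equiv.Perm W) (w₁ w₂ : W) : Equiv.Perm W := σ.trans (Equiv.swap (σ w₂) w₁)

/-- The pair of regions which are glued along the end of `w₂` and the beginning of `w₁`.  There is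
none if `w₁` follows `w₂`, as a piece of boundary is then folded up. -/
def endPair (loc : W → R) (σ : Equiv.Perm W) (w₁ w₂ : W) : List (R × R) :=
  if σ w₂ = w₁ then [] else [(loc w₁, loc (σ w₂))]

/-- The factor of the point between `w₂` and `w₁` if `w₁` follows `w₂`, so that this point comes to
lie in the interior. -/
def endContent (loc : W → R) (σ : Equiv.Perm W) (w₁ w₂ : W) (p : A) : R → A :=
  if σ w₂ = w₁ then Pi.mulSingle (loc w₁) p else 1

/-- Insertion of dual bases at the end of `w₂` and the beginning of `w₁`: the pieces of boundary at
these points are glued along a half, or a single piece is folded up. -/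
theorem sum_gluedValue_pointContent {φ : A →ₗ[k] k} {e : A} (pw : P → P → A) (loc : W → R)
    (σ : Equiv.Perm W) (U : Finset W) (x y : W → P) (w₁ w₂ : W) (h₁ : w₁ ∈ U) (h₂ : σ w₂ ∈ U)
    (b d : ι → P) (p : A) (hself : ∑ i, pw (d i) (b i) = p)
    (hglue : σ w₂ ≠ w₁ → Glues φ e (fun i => pw (x (σ.symm w₁)) (b i))
      (fun i => pw (d i) (y (σ w₂))) (pw (x (σ.symm w₁)) (y (σ w₂))))
    (l : List (R × R)) (X : R → A) :
    ∑ i, gluedValue φ e l (X * pointContent pw loc σ U (Function.update x w₂ (d i))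
        (Function.update y w₁ (b i))) =
      gluedValue φ e (endPair loc σ w₁ w₂ ++ l)
        (X * endContent loc σ w₁ w₂ p *
          pointContent pw loc (reroute σ w₁ w₂) (U.erase w₁) x y) := by
  have hx : ∀ u, u ≠ σ w₂ → ∀ c, Function.update x w₂ c (σ.symm u) = x (σ.symm u) :=
    fun u hu c => Function.update_of_ne (fun h => hu (by rw [← h, Equiv.apply_symm_apply])) _ _
  by_cases h : σ w₂ = w₁
  · have hr : reroute σ w₁ w₂ = σ := by
      rw [reroute, h, Equiv.swap_self]
      rfl
    rw [endPair, endContent, if_pos h, if_pos h, hr, ← hself, List.nil_append, mul_right_comm,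
      ← sum_gluedValue_mulSingle]
    refine Finset.sum_congr rfl fun i _ => congrArg _ ?_
    rw [pointContent, ← Finset.mul_prod_erase _ _ h₁, mul_assoc, mul_comm (pointContent _ _ _ _ _ _)]
    congr 2
    · simp [← h]
    · refine Finset.prod_congr rfl fun u hu => ?_
      have hu1 := Finset.ne_of_mem_erase hu
      rw [hx u (h ▸ hu1), Function.update_of_ne hu1]
  · have hm : σ w₂ ∈ U.erase w₁ := Finset.mem_erase.2 ⟨h, h₂⟩
    rw [endPair, endContent, if_neg h, if_neg h, mul_one, pointContent,
      ← Finset.mul_prod_erase _ _ hm, mul_comm (Pi.mulSingle _ _), ← mul_assoc]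
    have hsymm : (reroute σ w₁ w₂).symm (σ w₂) = σ.symm w₁ := by simp [reroute]
    rw [hsymm, List.singleton_append, ← (hglue h).sum_gluedValue]
    refine Finset.sum_congr rfl fun i _ => congrArg _ ?_
    rw [pointContent, ← Finset.mul_prod_erase _ _ h₁, ← Finset.mul_prod_erase _ _ hm, mul_assoc,
      mul_comm (∏ _ ∈ _, _), ← mul_assoc (Pi.mulSingle _ _)]
    congr 2
    · rw [hx _ (Ne.symm h), Function.update_self, Equiv.symm_apply_apply, Function.update_self,
        Function.update_of_ne h]
    · refine Finset.prod_congr rfl fun u hu => ?_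
      have hu2 := Finset.ne_of_mem_erase hu
      have hu1 := Finset.ne_of_mem_erase (Finset.mem_of_mem_erase hu)
      rw [hx u hu2, Function.update_of_ne hu1]
      simp [reroute, Equiv.swap_apply_of_ne_of_ne hu2 hu1]

end
end RegionGluing

/-! ### First return maps -/

theorem firstReturn_eq {X : Type} [Finite X] (π : Equiv.Perm X) (p : X → Prop) (x : {x : X // p x})
    (n : ℕ) (hn : 0 < n) (hp : p ((π ^ n) x.1)) (hlt : ∀ m, 0 < m → m < n → ¬ p ((π ^ m) x.1)) :
    (firstReturn π p x).1 = (π ^ n) x.1 := by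
  classical
  have h : Nat.find (exists_return π x.2) = n :=
    (Nat.find_eq_iff _).2 ⟨⟨hn, hp⟩, fun m hm h => hlt m h.1 hm h.2⟩
  rw [← h]
  unfold firstReturn
  rw [Equiv.ofBijective_apply]

open RegionGluing in
/-- The windows that follow each other after the gluing of `w` and `w'` are found by first gluing
the end of `w'` to the beginning of `w`, and then the end of `w` to the beginning of `w'`. -/
theorem firstReturn_swap {W : Type} [Finite W] [DecidableEq W] (σ : Equiv.Perm W) {w w' : W}
    (hne : w ≠ w') (u : {u : W // u ≠ w ∧ u ≠ w'}) :
    (firstReturn ((Equiv.swap w w').trans σ) (fun u => u ≠ w ∧ u ≠ w') u).1 =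
      reroute (reroute σ w w') w' w u.1 := by
  obtain ⟨u, hu, hu'⟩ := u
  set π := (Equiv.swap w w').trans σ with hπ
  have hπu : π u = σ u := by simp [hπ, Equiv.swap_apply_of_ne_of_ne hu hu']
  have hπw : π w = σ w' := by simp [hπ]
  have hπw' : π w' = σ w := by simp [hπ]
  have h12 : ∀ v, reroute (reroute σ w w') w' w v = Equiv.swap (Equiv.swap (σ w') w (σ w)) w'
    (Equiv.swap (σ w') w (σ v)) := fun v => rfl
  have inj : ∀ {v v'}, v ≠ v' → σ v ≠ σ v' := fun h => σ.injective.ne h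
  have huw := inj hu
  have huw' := inj hu'
  have hww' := inj hne
  rw [h12]
  by_cases h1 : σ u = w
  · have e1 : Equiv.swap (σ w') w (σ u) = σ w' := by rw [h1, Equiv.swap_apply_right]
    have e2 : Equiv.swap (σ w') w (σ w) = σ w :=
      Equiv.swap_apply_of_ne_of_ne hww' (fun h => huw (h1.trans h.symm))
    by_cases h2 : σ w' = w'
    · rw [firstReturn_eq π _ _ 3 (by norm_num)]
      · rw [e1, e2, h2, Equiv.swap_apply_right]
        simp [pow_succ, hπu, h1, hπw, h2, hπw']
      · simp only [pow_succ, pow_zero, one_mul, Equiv.Perm.mul_apply, hπu, h1, hπw, h2, hπw']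
        exact ⟨fun h => huw (h1.trans h.symm), by rw [← h2]; exact hww'⟩
      · intro m hm hm'
        interval_cases m <;> simp [pow_succ, hπu, h1, hπw, h2]
    · rw [firstReturn_eq π _ _ 2 (by norm_num)]
      · rw [e1, e2, Equiv.swap_apply_of_ne_of_ne hww'.symm h2]
        simp [pow_succ, hπu, h1, hπw]
      · simp only [pow_succ, pow_zero, one_mul, Equiv.Perm.mul_apply, hπu, h1, hπw]
        exact ⟨fun h => huw' (h1.trans h.symm), h2⟩
      · intro m hm hm'
        interval_cases m
        simp [hπu, h1]
  · have e1 : Equiv.swap (σ w') w (σ u) = σ u := Equiv.swap_apply_of_ne_of_ne huw' h1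
    by_cases h2 : σ u = w'
    · rw [e1, h2, Equiv.swap_apply_right]
      by_cases h3 : σ w = w
      · rw [h3, Equiv.swap_apply_right, firstReturn_eq π _ _ 3 (by norm_num)]
        · simp [pow_succ, hπu, h2, hπw', h3, hπw]
        · simp only [pow_succ, pow_zero, one_mul, Equiv.Perm.mul_apply, hπu, h2, hπw', h3, hπw]
          exact ⟨by rw [← h3]; exact hww'.symm, fun h => huw' (h2.trans h.symm)⟩
        · intro m hm hm'
          interval_cases m <;> simp [pow_succ, hπu, h2, hπw', h3]
      · rw [Equiv.swap_apply_of_ne_of_ne hww' h3, firstReturn_eq π _ _ 2 (by norm_num)]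
        · simp [pow_succ, hπu, h2, hπw']
        · simp only [pow_succ, pow_zero, one_mul, Equiv.Perm.mul_apply, hπu, h2, hπw']
          exact ⟨h3, fun h => huw (h2.trans h.symm)⟩
        · intro m hm hm'
          interval_cases m
          simp [hπu, h2]
    · rw [e1, firstReturn_eq π _ _ 1 (by norm_num)]
      · rw [Equiv.swap_apply_of_ne_of_ne _ h2]
        · simp [hπu]
        · by_cases h3 : σ w = w
          · rw [h3, Equiv.swap_apply_right]
            exact huw'
          · rwa [Equiv.swap_apply_of_ne_of_ne hww' h3]
      · simp only [pow_one, hπu]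
        exact ⟨h1, h2⟩
      · intro m hm hm'
        omega

/-! ### Correlators as products over regions -/

theorem prod_mulSingle_apply {ι R A : Type*} [Fintype ι] [DecidableEq R] [CommMonoid A]
    (loc : ι → R) (x : ι → A) (r : R) :
    (∏ i, Pi.mulSingle (loc i) (x i) : R → A) r = ∏ i with loc i = r, x i := by
  rw [Finset.prod_apply, Finset.prod_filter]
  refine Finset.prod_congr rfl fun i _ => ?_
  by_cases h : loc i = r
  · subst h
    simp
  · rw [if_neg h, Pi.mulSingle_eq_of_ne (Ne.symm h)]

@[to_additive]
theorem Fin.prod_univ_of_pos {A : Type*} [CommMonoid A] {m : ℕ} (hm : 0 < m) (f : Fin m → A) :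
    ∏ i, f i = f ⟨0, hm⟩ * ∏ j : Fin (m - 1), f ⟨j.1 + 1, by omega⟩ := by
  obtain ⟨n, rfl⟩ : ∃ n, m = n + 1 := ⟨m - 1, by omega⟩
  exact Fin.prod_univ_succ f

/-- The region that contains the boundary piece at the initial point of a window. -/
def ArcDiagram.pointRegion {B : Type z} (G : ArcDiagram B) (u : G.Window) : G.Region :=
  G.region (G.firstFlag u)

/-- The `j`-th piece without distinguished point on a window, where `j` is counted from `0`. -/
def ArcDiagram.innerFlag {B : Type z} (G : ArcDiagram B) (u : G.Window) (j : Fin (G.wt u - 1)) :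
    G.Flag := ⟨u, ⟨j.1 + 1, by omega⟩⟩

namespace BraneFrobenius
open RegionGluing

variable {k : Type u} [Field k] {B : Type z} (F : BraneFrobenius.{u, v, z} k B)
  [hC : Fact F.ConditionC] (G : ArcDiagram B)

/-- The factor at the beginning of each window, together with its label. -/
def firstFactor (a : ∀ w, F.Decoration (G.color w) (G.wt w - 1)) (w : G.Window) : Σ S, F.A S :=
  ⟨(G.color w).src, (a w).first⟩

/-- The factor at the end of each window, together with its label. -/
def lastFactor (a : ∀ w, F.Decoration (G.color w) (G.wt w - 1)) (w : G.Window) : Σ S, F.A S :=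
  ⟨(G.color w).tgt, (a w).last⟩

variable [DecidableEq G.Region]

/-- The product of the factors of the punctures in each region. -/
def punctureContent [Fintype G.Puncture] : G.Region → F.A ∅ :=
  ∏ p, Pi.mulSingle (G.punctureRegion p)
    (F.resDagger (G.punctureLabel p) (F.euler (G.punctureLabel p)))

/-- The product of the weights of the pieces of the window `w` without distinguished points, in each
region. -/
def innerContent (w : G.Window) (d : F.Decoration (G.color w) (G.wt w - 1)) : G.Region → F.A ∅ :=
  ∏ j, Pi.mulSingle (G.region (G.innerFlag w j)) (d.interior j)

/-- The correlator on pure tensors, with the boundary pieces sorted by windows instead of by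
regions. -/
theorem pureCorrelator_eq [Fintype G.Window] [Fintype G.Region] [Fintype G.Puncture]
    (a : ∀ w, F.Decoration (G.color w) (G.wt w - 1)) :
    F.pureCorrelator G hC.out a = ∏ r, F.integralForm (F.euler ∅ ^ (1 - G.chi r).toNat *
      (F.punctureContent G * (∏ w, F.innerContent G w (a w)) *
        pointContent F.pointWeight G.pointRegion G.next Finset.univ (F.lastFactor G a)
          (F.firstFactor G a)) r) := by
  have hflag : (∏ f : G.Flag, Pi.mulSingle (G.region f) (F.sideWeight G a f) : G.Region → F.A ∅) =
      (∏ w, F.innerContent G w (a w)) *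
        pointContent F.pointWeight G.pointRegion G.next Finset.univ (F.lastFactor G a)
          (F.firstFactor G a) := by
    rw [Fintype.prod_sigma, pointContent, ← Finset.prod_mul_distrib]
    refine Finset.prod_congr rfl fun w _ => ?_
    rw [Fin.prod_univ_of_pos (G.wt_pos w), mul_comm]
    rfl
  rw [pureCorrelator, finprod_eq_prod_of_fintype]
  refine Finset.prod_congr rfl fun r _ => ?_
  rw [mul_assoc, ← hflag, Pi.mul_apply, punctureContent, prod_mulSingle_apply,
    prod_mulSingle_apply, regionCorrelator]
  change F.form ∅ _ 1 = F.form ∅ _ 1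
  rw [mul_comm (∏ i with G.punctureRegion i = r, _), ← mul_assoc]
  have e1 := finprod_eq_prod_of_fintype
    (fun f : {f : G.Flag // G.region f = r} => F.sideWeight G a f.1)
  have e2 := finprod_eq_prod_of_fintype
    (fun p : {p : G.Puncture // G.punctureRegion p = r} =>
      F.resDagger (G.punctureLabel p.1) (F.euler (G.punctureLabel p.1)))
  rw [Finset.prod_subtype _ (p := fun f => G.region f = r) (by simp),
    Finset.prod_subtype _ (p := fun p => G.punctureRegion p = r) (by simp), ← e1, ← e2]

end BraneFrobenius

/-! ### Families on the windows of a diagram -/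

section extendPair
variable {W : Type} {V : W → Type*} {w w' : W}

open scoped Classical in
/-- The extension of a family on the complement of `{w, w'}` by values at `w` and `w'`. -/
def extendPair (y : ∀ u : {u // u ≠ w ∧ u ≠ w'}, V u.1) (p : V w) (q : V w') (u : W) : V u :=
  if e : u = w then e ▸ p else if e' : u = w' then e' ▸ q else y ⟨u, e, e'⟩

variable (y : ∀ u : {u // u ≠ w ∧ u ≠ w'}, V u.1) (p : V w) (q : V w')

theorem extendPair_left : extendPair y p q w = p := dif_pos rfl

theorem extendPair_right (hne : w ≠ w') : extendPair y p q w' = q := by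
  rw [extendPair, dif_neg hne.symm, dif_pos rfl]

theorem extendPair_of_ne (u : {u // u ≠ w ∧ u ≠ w'}) : extendPair y p q u.1 = y u := by
  rw [extendPair, dif_neg u.2.1, dif_neg u.2.2]

theorem map_extendPair {V' : W → Type*} (f : ∀ u, V u → V' u) (u : W) :
    f u (extendPair y p q u) = extendPair (fun u => f u.1 (y u)) (f w p) (f w' q) u := by
  unfold extendPair
  split_ifs with e e'
  · subst e; rfl
  · subst e'; rfl
  · rfl

theorem extendPair_eq_update [DecidableEq W] {P : Type*} (hne : w ≠ w')
    (y : {u // u ≠ w ∧ u ≠ w'} → P) (p p₀ q q₀ : P) :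
    extendPair (V := fun _ => P) y p q =
      Function.update (Function.update (extendPair (V := fun _ => P) y p₀ q₀) w p) w' q := by
  funext u
  by_cases h' : u = w'
  · subst h'
    rw [Function.update_self, extendPair_right _ _ _ hne]
  · rw [Function.update_of_ne h']
    by_cases h : u = w
    · subst h
      rw [Function.update_self, extendPair_left]
    · rw [Function.update_of_ne h]
      exact (extendPair_of_ne (V := fun _ => P) y p q ⟨u, h, h'⟩).trans
        (extendPair_of_ne (V := fun _ => P) y p₀ q₀ ⟨u, h, h'⟩).symm

theorem prod_extendPair [Fintype W] [DecidableEq W] {A : Type*} [CommMonoid A] (hne : w ≠ w')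
    (f : ∀ u, V u → A) :
    ∏ u, f u (extendPair y p q u) =
      (∏ u : {u // u ≠ w ∧ u ≠ w'}, f u.1 (y u)) * (f w p * f w' q) := by
  have hm : w' ∈ Finset.univ.erase w := Finset.mem_erase.2 ⟨hne.symm, Finset.mem_univ _⟩
  rw [← Finset.mul_prod_erase _ _ (Finset.mem_univ w), ← Finset.mul_prod_erase _ _ hm,
    Finset.prod_subtype (F := inferInstance) _ (p := fun u => u ≠ w ∧ u ≠ w') (by simp [and_comm]),
    extendPair_left, extendPair_right _ _ _ hne, ← mul_assoc, mul_comm]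
  simp only [extendPair_of_ne]

end extendPair

namespace BraneFrobenius
open RegionGluing

variable {k : Type u} [Field k] {B : Type z} (F : BraneFrobenius.{u, v, z} k B)

section
variable {F}

/-- The same decoration of a window whose colour and weight are given in a different form. -/
def Decoration.cast {c c' : Color B} {n n' : ℕ} (hc : c = c') (hn : n = n')
    (d : F.Decoration c n) : F.Decoration c' n' := hc ▸ hn ▸ d

theorem Decoration.cast_first {c c' : Color B} {n n' : ℕ} (hc : c = c') (hn : n = n')
    (d : F.Decoration c n) :
    (⟨c'.src, (d.cast hc hn).first⟩ : Σ S, F.A S) = ⟨c.src, d.first⟩ := by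
  subst hc hn
  rfl

theorem Decoration.cast_last {c c' : Color B} {n n' : ℕ} (hc : c = c') (hn : n = n')
    (d : F.Decoration c n) :
    (⟨c'.tgt, (d.cast hc hn).last⟩ : Σ S, F.A S) = ⟨c.tgt, d.last⟩ := by
  subst hc hn
  rfl

/-- The reversed decoration, of the conjugate colour. -/
def Decoration.flip {c : Color B} {n : ℕ} (d : F.Decoration c n) : F.Decoration c.bar n :=
  fun s => F.relabel (c.slotLabel_flip n s) (d ((c.flipSlot n).symm s))

theorem Decoration.flip_interior {c : Color B} {n : ℕ} (d : F.Decoration c n) (j : Fin n) :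
    d.flip.interior j = d.interior j.rev := by
  cases c <;> rfl

end

/-- The tuples of basis vectors. -/
def vecs (c : Color B) (n : ℕ) (κ : ∀ s : c.Slot n, Fin (Module.finrank k (F.A (c.slotLabel s)))) :
    F.Decoration c n := fun s => F.vec _ (κ s)

/-- The tuples of vectors of the dual bases. -/
def covecs (c : Color B) (n : ℕ)
    (κ : ∀ s : c.Slot n, Fin (Module.finrank k (F.A (c.slotLabel s)))) :
    F.Decoration c n := fun s => F.covec _ (κ s)

/-- A sum over the tuples of dual basis vectors at a closed window, sorted by tensor factors. -/
theorem sum_closed (n : ℕ) (Φ : F.Decoration Color.closed n → F.Decoration Color.closed n → k)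
    (Ψ : F.A ∅ → (Fin n → F.A ∅) → F.A ∅ → (Fin n → F.A ∅) → k)
    (h : ∀ a b, Φ a b = Ψ a.first a.interior b.first b.interior) :
    ∑ κ, Φ (F.vecs Color.closed n κ) (F.covecs Color.closed n κ) =
      ∑ i, ∑ κ : Fin n → _, Ψ (F.vec ∅ i) (fun j => F.vec ∅ (κ j)) (F.covec ∅ i)
        (fun j => F.covec ∅ (κ j)) := by
  rw [← Fintype.sum_prod_type']
  refine Fintype.sum_equiv
    { toFun := fun κ => (κ (Sum.inl ()), fun j => κ (Sum.inr j))
      invFun := fun p s => match s with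
        | Sum.inl _ => p.1
        | Sum.inr j => p.2 j
      left_inv := fun κ => funext fun s => by rcases s with s | j <;> rfl
      right_inv := fun p => rfl } _ _ fun κ => ?_
  exact h _ _

/-- A sum over the tuples of dual basis vectors at an open window, sorted by tensor factors. -/
theorem sum_open (S T : Set B) (n : ℕ)
    (Φ : F.Decoration (Color.opn S T) n → F.Decoration (Color.opn S T) n → k)
    (Ψ : F.A S → F.A T → (Fin n → F.A ∅) → F.A S → F.A T → (Fin n → F.A ∅) → k)
    (h : ∀ a b, Φ a b = Ψ a.first a.last a.interior b.first b.last b.interior) :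
    ∑ κ, Φ (F.vecs (Color.opn S T) n κ) (F.covecs (Color.opn S T) n κ) =
      ∑ i, ∑ i', ∑ κ : Fin n → _, Ψ (F.vec S i') (F.vec T i) (fun j => F.vec ∅ (κ j))
        (F.covec S i') (F.covec T i) (fun j => F.covec ∅ (κ j)) := by
  simp only [← Fintype.sum_prod_type']
  let E : (∀ s : (Color.opn S T).Slot n,
      Fin (Module.finrank k (F.A ((Color.opn S T).slotLabel s)))) ≃
      Fin (Module.finrank k (F.A T)) × Fin (Module.finrank k (F.A S)) ×
        (Fin n → Fin (Module.finrank k (F.A ∅))) :=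
    { toFun := fun κ => (κ (Sum.inl true), κ (Sum.inl false), fun j => κ (Sum.inr j))
      invFun := fun p s => match (s : Bool ⊕ Fin n) with
        | Sum.inl true => p.1
        | Sum.inl false => p.2.1
        | Sum.inr j => p.2.2 j
      left_inv := fun κ => funext fun s => by
        rcases s with (s : Bool) | j
        · cases s <;> rfl
        · rfl
      right_inv := fun p => rfl }
  exact Fintype.sum_equiv E _ _ fun κ => h _ _

theorem glues_pointWeight [Fact F.ConditionC] (hF : F.IsBasic) (hE : F.ConditionE) {S : Set B}
    (hS : S.Nonempty) {ι : Type*} [Fintype ι] {b d : ι → F.A S} (h : IsDualPair (F.form S) b d)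
    (x y : Σ S, F.A S) (hx : x.1 = S) (hy : y.1 = S) :
    Glues F.integralForm (F.euler ∅) (fun i => F.pointWeight x ⟨S, b i⟩)
      (fun i => F.pointWeight ⟨S, d i⟩ y) (F.pointWeight x y) := by
  obtain ⟨S', x⟩ := x
  obtain ⟨T', y⟩ := y
  obtain rfl : S' = S := hx
  obtain rfl : T' = S' := hy
  simp only [pointWeight_mk]
  exact F.glues_resDagger hF hE hS h x y

/-- If dual bases are inserted on the two sides of one point, then the point becomes a puncture. -/
theorem sum_pointWeight {S : Set B} {ι : Type*} [Fintype ι] {b d : ι → F.A S}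
    (h : IsDualPair (F.form S) b d) :
    ∑ i, F.pointWeight ⟨S, b i⟩ ⟨S, d i⟩ = F.resDagger S (F.euler S) := by
  simp only [pointWeight_mk]
  rw [← map_sum, F.sum_mul_eq_euler h]

end BraneFrobenius

/-! ### Insertion of the Casimir element at two windows -/

namespace BraneFrobenius
open RegionGluing

variable {k : Type u} [Field k] {B : Type z} (F : BraneFrobenius.{u, v, z} k B)
  [hC : Fact F.ConditionC] (G : ArcDiagram B) {w w' : G.Window}

theorem innerContent_cast [DecidableEq G.Region] {c : Color B} {n : ℕ} (u : G.Window)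
    (hc : c = G.color u) (hn : n = G.wt u - 1) (d : F.Decoration c n) :
    F.innerContent G u (d.cast hc hn) =
      ∏ j, Pi.mulSingle (G.region (G.innerFlag u (Fin.cast hn j))) (d.interior j) := by
  subst hc hn
  rfl

/-- The pairs of regions which are glued along pieces without distinguished points. -/
def innerPairs (w w' : G.Window) (h : G.wt w = G.wt w') : List (G.Region × G.Region) :=
  List.ofFn fun j : Fin (G.wt w - 1) => (G.region (G.innerFlag w j),
    G.region (G.innerFlag w' (Fin.cast (by rw [h]) j.rev)))

theorem sum_inner [Fintype G.Region] [DecidableEq G.Region] (h : G.wt w = G.wt w')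
    (X : G.Region → F.A ∅) :
    ∑ κ : Fin (G.wt w - 1) → Fin (Module.finrank k (F.A ∅)),
      gluedValue F.integralForm (F.euler ∅) [] (X *
        ((∏ j, Pi.mulSingle (G.region (G.innerFlag w j)) (F.vec ∅ (κ j))) *
        ∏ j, Pi.mulSingle (G.region (G.innerFlag w' (Fin.cast (by rw [h]) j)))
          (F.covec ∅ (κ j.rev)))) =
      gluedValue F.integralForm (F.euler ∅) (innerPairs G w w' h) X := by
  rw [sum_gluedValue_pi_rev (F.glues_of_isDualPair (F.isDualPair_vec ∅)), List.append_nil]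
  rfl

section
variable (a : ∀ u : {u : G.Window // u ≠ w ∧ u ≠ w'}, F.Decoration (G.color u) (G.wt u - 1))

/-- The factors at the beginnings of the surviving windows. -/
def firstFactors : G.Window → Σ S, F.A S :=
  extendPair (V := fun _ => Σ S, F.A S) (fun u => ⟨(G.color u.1).src, (a u).first⟩) ⟨∅, 0⟩ ⟨∅, 0⟩

/-- The factors at the ends of the surviving windows. -/
def lastFactors : G.Window → Σ S, F.A S :=
  extendPair (V := fun _ => Σ S, F.A S) (fun u => ⟨(G.color u.1).tgt, (a u).last⟩) ⟨∅, 0⟩ ⟨∅, 0⟩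

theorem firstFactors_fst {u : G.Window} (h : u ≠ w) (h' : u ≠ w') :
    (F.firstFactors G a u).1 = (G.color u).src :=
  congrArg Sigma.fst (extendPair_of_ne (V := fun _ => Σ S, F.A S) _ _ _ ⟨u, h, h'⟩)

theorem lastFactors_fst {u : G.Window} (h : u ≠ w) (h' : u ≠ w') :
    (F.lastFactors G a u).1 = (G.color u).tgt :=
  congrArg Sigma.fst (extendPair_of_ne (V := fun _ => Σ S, F.A S) _ _ _ ⟨u, h, h'⟩)

variable [Fintype G.Window] [DecidableEq G.Window] [Fintype G.Region] [DecidableEq G.Region]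
  [Fintype G.Puncture]

/-- The contributions of the Euler characteristics of the regions, of the punctures, and of the
pieces without distinguished points of the surviving windows. -/
def fixedContent : G.Region → F.A ∅ :=
  (fun r => F.euler ∅ ^ (1 - G.chi r).toNat) *
    (F.punctureContent G * ∏ u : {u // u ≠ w ∧ u ≠ w'}, F.innerContent G u.1 (a u))

theorem pureCorrelator_extendPair (hne : w ≠ w') (δ : F.Decoration (G.color w) (G.wt w - 1))
    (δ' : F.Decoration (G.color w') (G.wt w' - 1)) :
    F.pureCorrelator G hC.out
        (extendPair (V := fun u => F.Decoration (G.color u) (G.wt u - 1)) a δ δ') =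
      gluedValue F.integralForm (F.euler ∅) [] (F.fixedContent G a *
        pointContent F.pointWeight G.pointRegion G.next Finset.univ
          (Function.update (Function.update (F.lastFactors G a) w ⟨_, δ.last⟩) w' ⟨_, δ'.last⟩)
          (Function.update (Function.update (F.firstFactors G a) w' ⟨_, δ'.first⟩) w
            ⟨_, δ.first⟩) *
        (F.innerContent G w δ * F.innerContent G w' δ')) := by
  have h1 : F.lastFactor G
      (extendPair (V := fun u => F.Decoration (G.color u) (G.wt u - 1)) a δ δ') =
      Function.update (Function.update (F.lastFactors G a) w ⟨_, δ.last⟩) w' ⟨_, δ'.last⟩ := by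
    rw [lastFactors, ← extendPair_eq_update hne]
    exact funext fun u => map_extendPair (V := fun u => F.Decoration (G.color u) (G.wt u - 1))
      a δ δ' (V' := fun _ => Σ S, F.A S) (fun u d => ⟨(G.color u).tgt, d.last⟩) u
  have h2 : F.firstFactor G
      (extendPair (V := fun u => F.Decoration (G.color u) (G.wt u - 1)) a δ δ') =
      Function.update (Function.update (F.firstFactors G a) w' ⟨_, δ'.first⟩) w
        ⟨_, δ.first⟩ := by
    rw [Function.update_comm hne.symm, firstFactors, ← extendPair_eq_update hne]
    exact funext fun u => map_extendPair (V := fun u => F.Decoration (G.color u) (G.wt u - 1))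
      a δ δ' (V' := fun _ => Σ S, F.A S) (fun u d => ⟨(G.color u).src, d.first⟩) u
  rw [pureCorrelator_eq, gluedValue_nil, h1, h2,
    prod_extendPair (V := fun u => F.Decoration (G.color u) (G.wt u - 1)) a δ δ' hne
      (F.innerContent G)]
  refine Finset.prod_congr rfl fun r _ => congrArg _ ?_
  simp only [fixedContent, Pi.mul_apply]
  ring

variable (hne : w ≠ w') (hwt : G.wt w = G.wt w') (hcol : G.color w' = (G.color w).bar)
include hne

/-- Insertion of the Casimir element at two closed windows, as a sequence of gluings. -/
theorem sum_pureCorrelator_closed (hc : G.color w = Color.closed) (hw : G.next w = w)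
    (hw' : G.next w' = w') :
    ∑ κ, F.pureCorrelator G hC.out
      (extendPair (V := fun u => F.Decoration (G.color u) (G.wt u - 1)) a
        (F.vecs (G.color w) (G.wt w - 1) κ)
        ((F.covecs (G.color w) (G.wt w - 1) κ).flip.cast hcol.symm (by rw [hwt]))) =
      gluedValue F.integralForm (F.euler ∅)
        ((G.pointRegion w, G.pointRegion w') :: innerPairs G w w' hwt)
        (F.fixedContent G a * pointContent F.pointWeight G.pointRegion
          (reroute (reroute G.next w w') w' w) ((Finset.univ.erase w).erase w')
          (F.lastFactors G a) (F.firstFactors G a)) := by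
  have key : ∀ c (hc : c = G.color w) (hc' : c.bar = G.color w'), c = Color.closed →
      ∑ κ, F.pureCorrelator G hC.out
        (extendPair (V := fun u => F.Decoration (G.color u) (G.wt u - 1)) a
          ((F.vecs c (G.wt w - 1) κ).cast hc rfl)
          ((F.covecs c (G.wt w - 1) κ).flip.cast hc' (by rw [hwt]))) =
      gluedValue F.integralForm (F.euler ∅)
        ((G.pointRegion w, G.pointRegion w') :: innerPairs G w w' hwt)
        (F.fixedContent G a * pointContent F.pointWeight G.pointRegion
          (reroute (reroute G.next w w') w' w) ((Finset.univ.erase w).erase w')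
          (F.lastFactors G a) (F.firstFactors G a)) := by
    rintro _ hc hc' rfl
    refine Eq.trans (F.sum_closed (G.wt w - 1) (fun δ δ' => F.pureCorrelator G hC.out
      (extendPair (V := fun u => F.Decoration (G.color u) (G.wt u - 1)) a (δ.cast hc rfl)
        (δ'.flip.cast hc' (by rw [hwt])))) (fun s m s' m' =>
      gluedValue F.integralForm (F.euler ∅) [] (F.fixedContent G a *
        pointContent F.pointWeight G.pointRegion G.next Finset.univ
          (Function.update (Function.update (F.lastFactors G a) w ⟨∅, 1⟩) w' ⟨∅, 1⟩)
          (Function.update (Function.update (F.firstFactors G a) w' ⟨∅, s'⟩) w ⟨∅, s⟩) *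
        ((∏ j, Pi.mulSingle (G.region (G.innerFlag w j)) (m j)) *
          ∏ j, Pi.mulSingle (G.region (G.innerFlag w' (Fin.cast (by rw [hwt]) j)))
            (m' j.rev)))) ?_) ?_
    swap
    · simp only [F.sum_inner G hwt]
      have hpc : ∀ s s' : F.A ∅, pointContent F.pointWeight G.pointRegion G.next Finset.univ
          (Function.update (Function.update (F.lastFactors G a) w ⟨∅, 1⟩) w' ⟨∅, 1⟩)
          (Function.update (Function.update (F.firstFactors G a) w' ⟨∅, s'⟩) w ⟨∅, s⟩) =
          pointContent F.pointWeight G.pointRegion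
          (reroute (reroute G.next w w') w' w) ((Finset.univ.erase w).erase w')
          (F.lastFactors G a) (F.firstFactors G a) *
          (Pi.mulSingle (G.pointRegion w) s * Pi.mulSingle (G.pointRegion w') s') := by
        intro s s'
        have hsw : G.next.symm w = w := by rw [Equiv.symm_apply_eq, hw]
        have hsw' : G.next.symm w' = w' := by rw [Equiv.symm_apply_eq, hw']
        have hm : w' ∈ Finset.univ.erase w := Finset.mem_erase.2 ⟨hne.symm, Finset.mem_univ _⟩
        rw [pointContent, ← Finset.mul_prod_erase _ _ (Finset.mem_univ w),
          ← Finset.mul_prod_erase _ _ hm, ← mul_assoc, mul_comm]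
        congr 1
        · refine Finset.prod_congr rfl fun u hu => ?_
          have hu' := Finset.ne_of_mem_erase hu
          have hu1 := Finset.ne_of_mem_erase (Finset.mem_of_mem_erase hu)
          have h1 : G.next.symm u ≠ w := fun h => hu1 (by rw [← hw, ← h, Equiv.apply_symm_apply])
          have h2 : G.next.symm u ≠ w' := fun h =>
            hu' (by rw [← hw', ← h, Equiv.apply_symm_apply])
          rw [Function.update_of_ne h2, Function.update_of_ne h1, Function.update_of_ne hu1,
            Function.update_of_ne hu']
          simp [reroute, hw, hw', Equiv.swap_apply_of_ne_of_ne hu' hu1]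
        · rw [hsw, hsw', Function.update_self, Function.update_self, Function.update_of_ne hne,
            Function.update_self, Function.update_of_ne hne.symm, Function.update_self,
            pointWeight_mk, pointWeight_mk, resDagger_empty, resDagger_empty, one_mul, one_mul]
      simp only [hpc, ← mul_assoc (F.fixedContent G a)]
      rw [(F.glues_of_isDualPair (F.isDualPair_vec ∅)).sum_gluedValue, Pi.mulSingle_one, mul_one]
    · intro δ δ'
      rw [F.pureCorrelator_extendPair G a hne, Decoration.cast_first, Decoration.cast_first,
        Decoration.cast_last, Decoration.cast_last, innerContent_cast, innerContent_cast]
      simp only [Decoration.flip_interior]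
      rfl
  exact key _ rfl hcol.symm hc

/-- Insertion of the Casimir element at two open windows, as a sequence of gluings: first along the
pieces without distinguished points, then at the initial point and at the terminal point of `w`. -/
theorem sum_pureCorrelator_open (hF : F.IsBasic) (hE : F.ConditionE)
    (hl : ∀ u, (G.color u).tgt = (G.color (G.next u)).src)
    (hc : G.color w ≠ Color.closed) (hS : (G.color w).src.Nonempty)
    (hT : (G.color w).tgt.Nonempty) :
    ∑ κ, F.pureCorrelator G hC.out
      (extendPair (V := fun u => F.Decoration (G.color u) (G.wt u - 1)) a
        (F.vecs (G.color w) (G.wt w - 1) κ)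
        ((F.covecs (G.color w) (G.wt w - 1) κ).flip.cast hcol.symm (by rw [hwt]))) =
      gluedValue F.integralForm (F.euler ∅)
        (endPair G.pointRegion (reroute G.next w w') w' w ++
          (endPair G.pointRegion G.next w w' ++ innerPairs G w w' hwt))
        (F.fixedContent G a *
          endContent G.pointRegion G.next w w'
            (F.resDagger (G.color w).src (F.euler (G.color w).src)) *
          endContent G.pointRegion (reroute G.next w w') w' w
            (F.resDagger (G.color w).tgt (F.euler (G.color w).tgt)) *
          pointContent F.pointWeight G.pointRegion
            (reroute (reroute G.next w w') w' w) ((Finset.univ.erase w).erase w')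
            (F.lastFactors G a) (F.firstFactors G a)) := by
  have key : ∀ c (hc₀ : c = G.color w) (hc' : c.bar = G.color w'), c ≠ Color.closed →
      c.src.Nonempty → c.tgt.Nonempty →
      ∑ κ, F.pureCorrelator G hC.out
        (extendPair (V := fun u => F.Decoration (G.color u) (G.wt u - 1)) a
          ((F.vecs c (G.wt w - 1) κ).cast hc₀ rfl)
          ((F.covecs c (G.wt w - 1) κ).flip.cast hc' (by rw [hwt]))) =
      gluedValue F.integralForm (F.euler ∅)
        (endPair G.pointRegion (reroute G.next w w') w' w ++
          (endPair G.pointRegion G.next w w' ++ innerPairs G w w' hwt))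
        (F.fixedContent G a *
          endContent G.pointRegion G.next w w' (F.resDagger c.src (F.euler c.src)) *
          endContent G.pointRegion (reroute G.next w w') w' w
            (F.resDagger c.tgt (F.euler c.tgt)) *
          pointContent F.pointWeight G.pointRegion
            (reroute (reroute G.next w w') w' w) ((Finset.univ.erase w).erase w')
            (F.lastFactors G a) (F.firstFactors G a)) := by
    rintro c hc₀ hc' hcl hS hT
    obtain ⟨S, T, rfl⟩ : ∃ S T, c = Color.opn S T := by
      cases c with
      | closed => exact absurd rfl hcl
      | opn S T => exact ⟨S, T, rfl⟩
    replace hS : S.Nonempty := hS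
    replace hT : T.Nonempty := hT
    have hws : (G.color w).src = S := by rw [← hc₀]; rfl
    have hwt' : (G.color w).tgt = T := by rw [← hc₀]; rfl
    have hws' : (G.color w').src = T := by rw [← hc']; rfl
    have hwt'' : (G.color w').tgt = S := by rw [← hc']; rfl
    set σ₁ := reroute G.next w w' with hσ₁
    have hσ₁w' : σ₁ w' = w := by simp [hσ₁, reroute]
    have hσ₁w : σ₁ w ≠ w := fun h => hne (σ₁.injective (h.trans hσ₁w'.symm))
    -- the labels still agree at all points after the first gluing
    have hl₁ : ∀ u, u ≠ w' → (G.color u).tgt = (G.color (σ₁ u)).src := by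
      intro u hu
      by_cases h : G.next u = w
      · have : σ₁ u = G.next w' := by simp [hσ₁, reroute, h]
        rw [this, ← hl w', hl u, h, hws, hwt'']
      · have : σ₁ u = G.next u :=
          Equiv.swap_apply_of_ne_of_ne (G.next.injective.ne hu) h
        rw [this, hl u]
    refine Eq.trans (F.sum_open S T (G.wt w - 1) (fun δ δ' => F.pureCorrelator G hC.out
      (extendPair (V := fun u => F.Decoration (G.color u) (G.wt u - 1)) a (δ.cast hc₀ rfl)
        (δ'.flip.cast hc' (by rw [hwt])))) (fun s t m s' t' m' =>
      gluedValue F.integralForm (F.euler ∅) [] (F.fixedContent G a *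
        pointContent F.pointWeight G.pointRegion G.next Finset.univ
          (Function.update (Function.update (F.lastFactors G a) w ⟨T, t⟩) w' ⟨S, s'⟩)
          (Function.update (Function.update (F.firstFactors G a) w' ⟨T, t'⟩) w ⟨S, s⟩) *
        ((∏ j, Pi.mulSingle (G.region (G.innerFlag w j)) (m j)) *
          ∏ j, Pi.mulSingle (G.region (G.innerFlag w' (Fin.cast (by rw [hwt]) j)))
            (m' j.rev)))) ?_) ?_
    swap
    · simp only [F.sum_inner G hwt]
      have hinitial : ∀ t t' : F.A T, ∑ i, gluedValue F.integralForm (F.euler ∅)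
          (innerPairs G w w' hwt) (F.fixedContent G a *
          pointContent F.pointWeight G.pointRegion G.next Finset.univ
            (Function.update (Function.update (F.lastFactors G a) w ⟨T, t⟩) w' ⟨S, F.covec S i⟩)
            (Function.update (Function.update (F.firstFactors G a) w' ⟨T, t'⟩) w
              ⟨S, F.vec S i⟩)) =
          gluedValue F.integralForm (F.euler ∅)
            (endPair G.pointRegion G.next w w' ++ innerPairs G w w' hwt)
            (F.fixedContent G a * endContent G.pointRegion G.next w w'
              (F.resDagger S (F.euler S)) *
            pointContent F.pointWeight G.pointRegion σ₁ (Finset.univ.erase w)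
              (Function.update (F.lastFactors G a) w ⟨T, t⟩)
              (Function.update (F.firstFactors G a) w' ⟨T, t'⟩)) := by
        intro t t'
        refine sum_gluedValue_pointContent F.pointWeight G.pointRegion G.next Finset.univ _ _ w w'
          (Finset.mem_univ _) (Finset.mem_univ _) (fun i => ⟨S, F.vec S i⟩)
          (fun i => ⟨S, F.covec S i⟩) _ (F.sum_pointWeight (F.isDualPair_vec S).symm)
          (fun h => F.glues_pointWeight hF hE hS (F.isDualPair_vec S) _ _ ?_ ?_) _ _
        · have h' : G.next.symm w ≠ w' := fun h' => h (by rw [← h', Equiv.apply_symm_apply])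
          have h1 := hl (G.next.symm w)
          rw [Equiv.apply_symm_apply, hws] at h1
          by_cases hw : G.next.symm w = w
          · rw [hw, Function.update_self]
            rw [hw] at h1
            exact hwt'.symm.trans h1
          · rw [Function.update_of_ne hw, F.lastFactors_fst G a hw h', h1]
        · have h1 := hl w'
          by_cases hw : G.next w' = w'
          · rw [hw, Function.update_self]
            rw [hw] at h1
            exact hws'.symm.trans (h1.symm.trans hwt'')
          · rw [Function.update_of_ne hw, F.firstFactors_fst G a h hw, ← h1, hwt'']
      simp only [hinitial]
      refine sum_gluedValue_pointContent F.pointWeight G.pointRegion σ₁ (Finset.univ.erase w) _ _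
        w' w (Finset.mem_erase.2 ⟨hne.symm, Finset.mem_univ _⟩)
        (Finset.mem_erase.2 ⟨hσ₁w, Finset.mem_univ _⟩) (fun i => ⟨T, F.covec T i⟩)
        (fun i => ⟨T, F.vec T i⟩) _ (F.sum_pointWeight (F.isDualPair_vec T))
        (fun h => F.glues_pointWeight hF hE hT (F.isDualPair_vec T).symm _ _ ?_ ?_) _ _
      · have h1 : σ₁.symm w' ≠ w := fun h' => h (by rw [← h', Equiv.apply_symm_apply])
        have h2 : σ₁.symm w' ≠ w' := fun h' => hne (by
          rw [← hσ₁w', ← h', Equiv.apply_symm_apply, h'])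
        rw [F.lastFactors_fst G a h1 h2, hl₁ _ h2, Equiv.apply_symm_apply, hws']
      · rw [F.firstFactors_fst G a hσ₁w h, ← hl₁ _ hne, hwt']
    · intro δ δ'
      rw [F.pureCorrelator_extendPair G a hne, Decoration.cast_first, Decoration.cast_first,
        Decoration.cast_last, Decoration.cast_last, innerContent_cast, innerContent_cast]
      simp only [Decoration.flip_interior]
      rfl
  exact key _ rfl hcol.symm hc hS hT

end

end BraneFrobenius

/-! ### The pieces of boundary that are glued -/

namespace ArcDiagram
open RegionGluing

variable {B : Type z} (G : ArcDiagram B) {w w' : G.Window}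

theorem eq_firstFlag_or_innerFlag (u : G.Window) (i : Fin (G.wt u)) :
    (⟨u, i⟩ : G.Flag) = G.firstFlag u ∨ ∃ j, (⟨u, i⟩ : G.Flag) = G.innerFlag u j := by
  obtain ⟨i, hi⟩ := i
  rcases i with _ | i
  · exact Or.inl rfl
  · exact Or.inr ⟨⟨i, by omega⟩, rfl⟩

theorem nextFlag_last (u : G.Window) (i : Fin (G.wt u)) (hi : i.1 + 1 = G.wt u) :
    G.nextFlag ⟨u, i⟩ = G.firstFlag (G.next u) := dif_neg (by simp [hi])

theorem nextFlag_inner (u : G.Window) (i : Fin (G.wt u)) (j : Fin (G.wt u - 1))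
    (h : i.1 = j.1) : G.nextFlag ⟨u, i⟩ = G.innerFlag u j := by
  have hj := j.2
  have hi : i.1 + 1 < G.wt u := by omega
  rw [nextFlag, dif_pos hi]
  exact congrArg (fun x => (⟨u, x⟩ : G.Flag)) (Fin.ext (by simp [h]))

variable (hne : w ≠ w') (h : G.wt w = G.wt w')

theorem partner_left (i : Fin (G.wt w)) :
    G.partner w w' hne h ⟨w, i⟩ = ⟨w', ⟨G.wt w' - 1 - i, by omega⟩⟩ := dif_pos rfl

theorem partner_right (i : Fin (G.wt w')) :
    G.partner w w' hne h ⟨w', i⟩ = ⟨w, ⟨G.wt w - 1 - i, by omega⟩⟩ :=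
  (dif_neg hne.symm).trans (dif_pos rfl)

/-- An equivalence relation contains the pairs of regions that become adjacent as soon as it
contains those at the two ends and along the pieces without distinguished points. -/
theorem gluedAlong_le_iff (t : Setoid G.Region) :
    (∀ r r', G.GluedAlong w w' hne h r r' → t r r') ↔
      t (G.pointRegion w) (G.pointRegion (G.next w')) ∧
      t (G.pointRegion w') (G.pointRegion (G.next w)) ∧
      ∀ j : Fin (G.wt w - 1), t (G.region (G.innerFlag w j))
        (G.region (G.innerFlag w' (Fin.cast (by rw [h]) j.rev))) := by
  have hw := G.wt_pos w
  have hw' := G.wt_pos w'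
  have e1 : G.nextFlag (G.partner w w' hne h (G.firstFlag w)) = G.firstFlag (G.next w') := by
    rw [firstFlag, partner_left]
    exact G.nextFlag_last _ _ (by simp; omega)
  have e2 : G.nextFlag (G.partner w w' hne h (G.firstFlag w')) = G.firstFlag (G.next w) := by
    rw [firstFlag, partner_right]
    exact G.nextFlag_last _ _ (by simp; omega)
  have e3 : ∀ j : Fin (G.wt w - 1), G.nextFlag (G.partner w w' hne h (G.innerFlag w j)) =
      G.innerFlag w' (Fin.cast (by rw [h]) j.rev) := by
    intro j
    rw [innerFlag, partner_left]
    exact G.nextFlag_inner _ _ _ (by simp [Fin.val_rev]; omega)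
  have e4 : ∀ j : Fin (G.wt w' - 1), G.nextFlag (G.partner w w' hne h (G.innerFlag w' j)) =
      G.innerFlag w (Fin.cast (by rw [h]) j.rev) := by
    intro j
    rw [innerFlag, partner_right]
    exact G.nextFlag_inner _ _ _ (by simp [Fin.val_rev]; omega)
  constructor
  · intro H
    refine ⟨H _ _ ⟨G.firstFlag w, fun hs => hs.1 rfl, rfl, by rw [e1]; rfl⟩,
      H _ _ ⟨G.firstFlag w', fun hs => hs.2 rfl, rfl, by rw [e2]; rfl⟩, fun j =>
      H _ _ ⟨G.innerFlag w j, fun hs => hs.1 rfl, rfl, by rw [e3]⟩⟩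
  · rintro ⟨h1, h2, h3⟩ _ _ ⟨⟨u, i⟩, hu, rfl, rfl⟩
    have hu' : u = w ∨ u = w' := by
      by_contra hc
      exact hu (not_or.1 hc)
    rcases hu' with rfl | rfl
    · rcases G.eq_firstFlag_or_innerFlag u i with hf | ⟨j, hf⟩
      · rw [hf, e1]
        exact h1
      · rw [hf, e3]
        exact h3 j
    · rcases G.eq_firstFlag_or_innerFlag u i with hf | ⟨j, hf⟩
      · rw [hf, e2]
        exact h2
      · rw [hf, e4]
        have := t.symm (h3 (Fin.cast (by rw [h]) j.rev))
        convert this using 4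
        ext
        simp [Fin.val_rev]
        omega

theorem forall_mem_innerPairs (t : Setoid G.Region) :
    (∀ e ∈ BraneFrobenius.innerPairs G w w' h, t e.1 e.2) ↔
      ∀ j : Fin (G.wt w - 1), t (G.region (G.innerFlag w j))
        (G.region (G.innerFlag w' (Fin.cast (by rw [h]) j.rev))) := by
  rw [BraneFrobenius.innerPairs, List.forall_mem_ofFn_iff]

/-- The gluings along two closed windows generate the adjacency of regions. -/
theorem forall_mem_closedPairs (hw : G.next w = w) (hw' : G.next w' = w') (t : Setoid G.Region) :
    (∀ e ∈ (G.pointRegion w, G.pointRegion w') :: BraneFrobenius.innerPairs G w w' h,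
      t e.1 e.2) ↔ ∀ r r', G.GluedAlong w w' hne h r r' → t r r' := by
  rw [gluedAlong_le_iff, List.forall_mem_cons, forall_mem_innerPairs, hw, hw']
  exact ⟨fun H => ⟨H.1, t.symm H.1, H.2⟩, fun H => ⟨H.1, H.2.2⟩⟩

theorem forall_mem_endPair {W R : Type*} [DecidableEq W] (loc : W → R) (σ : Equiv.Perm W)
    (w₁ w₂ : W) (t : Setoid R) :
    (∀ e ∈ endPair loc σ w₁ w₂, t e.1 e.2) ↔ t (loc w₁) (loc (σ w₂)) := by
  rw [endPair]
  split_ifs with hs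
  · simp [hs]
  · simp

/-- The gluings along two open windows generate the adjacency of regions. -/
theorem forall_mem_openPairs [DecidableEq G.Window] (t : Setoid G.Region) :
    (∀ e ∈ endPair G.pointRegion (reroute G.next w w') w' w ++
      (endPair G.pointRegion G.next w w' ++ BraneFrobenius.innerPairs G w w' h), t e.1 e.2) ↔
      ∀ r r', G.GluedAlong w w' hne h r r' → t r r' := by
  rw [gluedAlong_le_iff]
  simp only [List.forall_mem_append, forall_mem_endPair, forall_mem_innerPairs]
  by_cases hw : G.next w = w
  · have : reroute G.next w w' w = G.next w' := by simp [reroute, hw]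
    rw [this, hw]
    exact ⟨fun H => ⟨H.2.1, t.trans H.1 (t.symm H.2.1), H.2.2⟩,
      fun H => ⟨t.trans H.2.1 H.1, H.1, H.2.2⟩⟩
  · have : reroute G.next w w' w = G.next w :=
      Equiv.swap_apply_of_ne_of_ne (G.next.injective.ne hne) hw
    rw [this]
    exact ⟨fun H => ⟨H.2.1, H.1, H.2.2⟩, fun H => ⟨H.2.1, H.1, H.2.2⟩⟩

/-! ### Counting the gluings -/

theorem countP_ofFn {E : Type*} {n : ℕ} (f : Fin n → E) (p : E → Prop) [DecidablePred p] :
    (List.ofFn f).countP (fun e => p e) = ∑ j, if p (f j) then 1 else 0 := by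
  induction n with
  | zero => simp
  | succ n ih =>
    rw [List.ofFn_succ, List.countP_cons, ih, Fin.sum_univ_succ, add_comm]
    simp

theorem countP_innerPairs (p : G.Region → Prop) [DecidablePred p] :
    (BraneFrobenius.innerPairs G w w' h).countP (fun e => p e.1) =
      ∑ j, if p (G.region (G.innerFlag w j)) then 1 else 0 :=
  countP_ofFn _ _

theorem countP_endPair {W R : Type*} [DecidableEq W] (loc : W → R) (σ : Equiv.Perm W)
    (w₁ w₂ : W) (p : R → Prop) [DecidablePred p] :
    (endPair loc σ w₁ w₂).countP (fun e => p e.1) =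
      if σ w₂ = w₁ then 0 else if p (loc w₁) then 1 else 0 := by
  rw [endPair]
  split_ifs <;> simp [*]

include hne in
theorem card_glued (p : G.Region → Prop) [DecidablePred p] :
    Nat.card {f : G.Flag // (f.1 = w ∨ f = G.firstFlag w') ∧ p (G.region f)} =
      (if p (G.pointRegion w) then 1 else 0) + (if p (G.pointRegion w') then 1 else 0) +
        ∑ j, if p (G.region (G.innerFlag w j)) then 1 else 0 := by
  classical
  let _ := Fintype.ofFinite G.Window
  have hone : ∀ f : G.Flag, (if (f.1 = w ∨ f = G.firstFlag w') ∧ p (G.region f) then 1 else 0) =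
      (if f.1 = w then (if p (G.region f) then 1 else 0) else 0) +
        (if f = G.firstFlag w' then (if p (G.pointRegion w') then 1 else 0) else 0) := by
    intro f
    by_cases hf : f = G.firstFlag w'
    · subst hf
      have : (G.firstFlag w').1 ≠ w := hne.symm
      simp only [this, or_true, true_and, if_false, if_true, zero_add]
      rfl
    · simp [hf, ite_and]
  rw [Nat.card_eq_fintype_card, Fintype.card_subtype, Finset.card_filter]
  simp only [hone]
  rw [Finset.sum_add_distrib, Finset.sum_ite_eq' Finset.univ (G.firstFlag w'),
    if_pos (Finset.mem_univ _), Fintype.sum_sigma, Finset.sum_eq_single w]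
  · simp only [if_true]
    rw [Fin.sum_univ_of_pos (G.wt_pos w), add_right_comm]
    rfl
  · intro u _ hu
    simp [hu]
  · simp

@[to_additive]
theorem prod_ite_pair {W M : Type*} [Fintype W] [DecidableEq W] [CommMonoid M] {w w' : W}
    (hne : w ≠ w') (p q : Prop) [Decidable p] [Decidable q] (g : W → M) :
    (∏ u, if (u = w ∧ p) ∨ (u = w' ∧ q) then g u else 1) =
      (if p then g w else 1) * (if q then g w' else 1) := by
  rw [← Finset.mul_prod_erase _ _ (Finset.mem_univ w), ← Finset.mul_prod_erase _ _
    (Finset.mem_erase.2 ⟨hne.symm, Finset.mem_univ _⟩), Finset.prod_eq_one, mul_one]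
  · simp [hne, hne.symm]
  · intro u hu
    have hu' := Finset.ne_of_mem_erase hu
    have hu1 := Finset.ne_of_mem_erase (Finset.mem_of_mem_erase hu)
    simp [hu', hu1]

include hne in
open scoped Classical in
theorem card_becomesInterior (p : G.Region → Prop) :
    Nat.card {u : G.Window // G.BecomesInterior w w' u ∧ p (G.region (G.firstFlag u))} =
      (if G.next w' = w ∨ (G.next w = w ∧ G.next w' = w') then
        (if p (G.pointRegion w) then 1 else 0) else 0) +
      (if G.next w = w' then (if p (G.pointRegion w') then 1 else 0) else 0) := by
  let _ := Fintype.ofFinite G.Window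
  rw [Nat.card_eq_fintype_card, Fintype.card_subtype, Finset.card_filter,
    ← sum_ite_pair hne _ _ (fun u => if p (G.pointRegion u) then 1 else 0)]
  refine Finset.sum_congr rfl fun u _ => ?_
  rw [ite_and]
  congr!

include hne in
/-- The number of gluings along two closed windows. -/
theorem countP_closedPairs (hw : G.next w = w) (hw' : G.next w' = w') (p : G.Region → Prop)
    [DecidablePred p] (hp : p (G.pointRegion w) ↔ p (G.pointRegion w')) :
    (((G.pointRegion w, G.pointRegion w') :: BraneFrobenius.innerPairs G w w' h).countP
      (fun e => p e.1) : ℤ) =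
      Nat.card {f : G.Flag // (f.1 = w ∨ f = G.firstFlag w') ∧ p (G.region f)} -
      Nat.card {u : G.Window // G.BecomesInterior w w' u ∧ p (G.region (G.firstFlag u))} := by
  rw [G.card_glued hne, G.card_becomesInterior hne, List.countP_cons, countP_innerPairs]
  have h1 : ¬ (w = w') := hne
  by_cases hpw : p (G.pointRegion w)
  · have := hp.1 hpw
    simp [hw, hw', h1, hpw, this]
    ring
  · have : ¬ p (G.pointRegion w') := fun h => hpw (hp.2 h)
    simp [hw, hw', h1, hpw, this]

include hne in
/-- The number of gluings along two open windows. -/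
theorem countP_openPairs [DecidableEq G.Window] (p : G.Region → Prop) [DecidablePred p]
    (hp : p (G.pointRegion w) ↔ p (G.pointRegion (G.next w'))) :
    ((endPair G.pointRegion (reroute G.next w w') w' w ++
      (endPair G.pointRegion G.next w w' ++ BraneFrobenius.innerPairs G w w' h)).countP
      (fun e => p e.1) : ℤ) =
      Nat.card {f : G.Flag // (f.1 = w ∨ f = G.firstFlag w') ∧ p (G.region f)} -
      Nat.card {u : G.Window // G.BecomesInterior w w' u ∧ p (G.region (G.firstFlag u))} := by
  rw [G.card_glued hne, G.card_becomesInterior hne, List.countP_append, List.countP_append,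
    countP_innerPairs, countP_endPair, countP_endPair]
  have h1 : ¬ (w = w') := hne
  have h2 : ¬ (w' = w) := hne.symm
  by_cases hw : G.next w = w
  · have e : reroute G.next w w' w = G.next w' := by simp [reroute, hw]
    have e' : G.next w' ≠ w := fun e' => hne (G.next.injective (hw.trans e'.symm))
    by_cases hw' : G.next w' = w'
    · rw [hw'] at hp
      by_cases hpw : p (G.pointRegion w)
      · have := hp.1 hpw
        simp [hw, hw', h1, h2, e, hpw, this]
        ring
      · have : ¬ p (G.pointRegion w') := fun h => hpw (hp.2 h)
        simp [hw, hw', h1, h2, e, hpw, this]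
    · simp [hw, hw', h1, e, e']
      ring
  · have e : reroute G.next w w' w = G.next w :=
      Equiv.swap_apply_of_ne_of_ne (G.next.injective.ne hne) hw
    by_cases hw1 : G.next w = w' <;> by_cases hw2 : G.next w' = w <;>
      simp [hw, hw1, hw2, h1, h2, e] <;> ring

end ArcDiagram

/-! ### Gluing of correlators on pure tensors -/

namespace BraneFrobenius
open RegionGluing

variable {k : Type u} [Field k] {B : Type z} (F : BraneFrobenius.{u, v, z} k B)
  [hC : Fact F.ConditionC] (G : ArcDiagram B) {w w' : G.Window}

/-- The contributions of the distinguished points which become punctures, with regions in any set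
`Q` of classes of regions. -/
def newPunctureContent {Q : Type*} [DecidableEq Q] (w w' : G.Window) (mk : G.Region → Q) :
    Q → F.A ∅ :=
  letI := Fintype.ofFinite {u : G.Window // G.BecomesInterior w w' u ∧ G.color u ≠ Color.closed}
  ∏ u : {u : G.Window // G.BecomesInterior w w' u ∧ G.color u ≠ Color.closed},
    Pi.mulSingle (mk (G.pointRegion u.1))
      (F.resDagger (G.color u.1).src (F.euler (G.color u.1).src))

section
variable (hne : w ≠ w') (h : G.wt w = G.wt w') (rel : G.Region → G.Region → Prop)

instance [Fintype G.Window] [DecidableEq G.Window] :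
    Fintype (G.selfGlueWith w w' hne h rel).Window :=
  inferInstanceAs (Fintype {u : G.Window // u ≠ w ∧ u ≠ w'})

instance [Fintype G.Puncture] : Fintype (G.selfGlueWith w w' hne h rel).Puncture :=
  letI := Fintype.ofFinite {u : G.Window // G.BecomesInterior w w' u ∧ G.color u ≠ Color.closed}
  inferInstanceAs (Fintype (G.Puncture ⊕
    {u : G.Window // G.BecomesInterior w w' u ∧ G.color u ≠ Color.closed}))

/-- The class of a region after gluing. -/
def glueRegion (r : G.Region) : (G.selfGlueWith w w' hne h rel).Region := Quot.mk rel r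

variable [Fintype G.Region] [DecidableEq G.Region]
  [DecidableEq (G.selfGlueWith w w' hne h rel).Region]

theorem punctureContent_selfGlueWith [Fintype G.Puncture] :
    F.punctureContent (G.selfGlueWith w w' hne h rel) =
      foldMul (glueRegion G hne h rel) (F.punctureContent G) *
        F.newPunctureContent G w w' (glueRegion G hne h rel) := by
  rw [punctureContent, punctureContent, foldMul_prod]
  simp only [foldMul_mulSingle]
  let _ := Fintype.ofFinite {u : G.Window // G.BecomesInterior w w' u ∧ G.color u ≠ Color.closed}
  exact Fintype.prod_sum_type _

variable [Fintype G.Window] [DecidableEq G.Window]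
  (a : ∀ u : {u : G.Window // u ≠ w ∧ u ≠ w'}, F.Decoration (G.color u) (G.wt u - 1))

theorem innerContent_selfGlueWith :
    ∏ u : (G.selfGlueWith w w' hne h rel).Window,
      F.innerContent (G.selfGlueWith w w' hne h rel) u (a u) =
        foldMul (glueRegion G hne h rel)
          (∏ u : {u // u ≠ w ∧ u ≠ w'}, F.innerContent G u.1 (a u)) := by
  rw [foldMul_prod]
  refine Finset.prod_congr rfl fun u _ => ?_
  refine Eq.trans ?_ (foldMul_prod _ _ _).symm
  simp only [foldMul_mulSingle]
  rfl

theorem pointContent_selfGlueWith :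
    pointContent F.pointWeight (G.selfGlueWith w w' hne h rel).pointRegion
      (G.selfGlueWith w w' hne h rel).next Finset.univ
      (F.lastFactor (G.selfGlueWith w w' hne h rel) a)
      (F.firstFactor (G.selfGlueWith w w' hne h rel) a) =
    foldMul (glueRegion G hne h rel) (pointContent F.pointWeight G.pointRegion
      (reroute (reroute G.next w w') w' w) ((Finset.univ.erase w).erase w')
      (F.lastFactors G a) (F.firstFactors G a)) := by
  rw [pointContent, pointContent, foldMul_prod,
    Finset.prod_subtype (F := inferInstance) ((Finset.univ.erase w).erase w')
      (p := fun u => u ≠ w ∧ u ≠ w') (by simp [and_comm])]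
  refine Finset.prod_congr rfl fun u _ => ?_
  rw [foldMul_mulSingle]
  have hu : (reroute (reroute G.next w w') w' w).symm u.1 =
      ((G.selfGlueWith w w' hne h rel).next.symm u).1 := by
    rw [Equiv.symm_apply_eq]
    obtain ⟨u, rfl⟩ := (G.selfGlueWith w w' hne h rel).next.surjective u
    rw [Equiv.symm_apply_apply]
    rw [← firstReturn_swap G.next hne u]
    have hsw : @Equiv.swap G.Window (fun _ _ => Classical.propDecidable _) w w' =
        Equiv.swap w w' := by congr!
    exact congrArg (fun σ => (firstReturn (σ.trans G.next) (fun u => u ≠ w ∧ u ≠ w') u).1) hsw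
  have h1 : F.lastFactors G a ((G.selfGlueWith w w' hne h rel).next.symm u).1 =
      F.lastFactor (G.selfGlueWith w w' hne h rel) a
        ((G.selfGlueWith w w' hne h rel).next.symm u) :=
    extendPair_of_ne (V := fun _ => Σ S, F.A S) _ _ _ _
  have h2 : F.firstFactors G a u.1 = F.firstFactor (G.selfGlueWith w w' hne h rel) a u :=
    extendPair_of_ne (V := fun _ => Σ S, F.A S) _ _ _ _
  rw [hu, h1, h2]
  rfl

end

/-- The correlator of a glued diagram, in terms of the regions of the original one.  Here `l` is any
list of pairs of regions which generates the same equivalence relation as the gluing and has the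
right number of pairs in each class, and `P` collects the contributions of the new punctures. -/
theorem pureCorrelator_selfGlueWith [Fintype G.Window] [DecidableEq G.Window] [Fintype G.Region]
    [DecidableEq G.Region] [Fintype G.Puncture] (hχ : ∀ r, G.chi r ≤ 1) (hne : w ≠ w')
    (h : G.wt w = G.wt w') (rel : G.Region → G.Region → Prop)
    (hrel : ∀ t : Setoid G.Region, (∀ r r', rel r r' → t r r') ↔
      ∀ r r', G.GluedAlong w w' hne h r r' → t r r')
    (l : List (G.Region × G.Region))
    (hl : ∀ t : Setoid G.Region, (∀ e ∈ l, t e.1 e.2) ↔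
      ∀ r r', G.GluedAlong w w' hne h r r' → t r r')
    (hcount : ∀ (p : G.Region → Prop) [DecidablePred p],
      (∀ r r', G.GluedAlong w w' hne h r r' → (p r ↔ p r')) →
      (l.countP (fun e => p e.1) : ℤ) =
        Nat.card {f : G.Flag // (f.1 = w ∨ f = G.firstFlag w') ∧ p (G.region f)} -
        Nat.card {u : G.Window // G.BecomesInterior w w' u ∧ p (G.region (G.firstFlag u))})
    (P : G.Region → F.A ∅)
    (hP : ∀ {Q : Type} [DecidableEq Q] (mk : G.Region → Q),
      (∀ r r', G.GluedAlong w w' hne h r r' → mk r = mk r') →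
      foldMul mk P = F.newPunctureContent G w w' mk)
    (a : ∀ u : {u : G.Window // u ≠ w ∧ u ≠ w'}, F.Decoration (G.color u) (G.wt u - 1)) :
    F.pureCorrelator (G.selfGlueWith w w' hne h rel) hC.out a =
      gluedValue F.integralForm (F.euler ∅) l (F.fixedContent G a * P *
        pointContent F.pointWeight G.pointRegion (reroute (reroute G.next w w') w' w)
          ((Finset.univ.erase w).erase w') (F.lastFactors G a) (F.firstFactors G a)) := by
  classical
  let _ : Fintype (G.selfGlueWith w w' hne h rel).Region := Fintype.ofFinite _
  let mk := glueRegion G hne h rel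
  have hmk : ∀ a b, mk a = mk b ↔ ∀ t : Setoid G.Region, (∀ r r', rel r r' → t r r') → t a b := by
    intro a b
    constructor
    · intro hab t ht
      exact Relation.EqvGen.rec (fun x y hxy => ht _ _ hxy) t.refl (fun _ _ _ ih => t.symm ih)
        (fun _ _ _ _ _ ih ih' => t.trans ih ih') (Quot.eqvGen_exact hab)
    · exact fun H => H (Setoid.ker mk) fun r r' hr => Quot.sound hr
  have hclass : ∀ a b, classMap l a = classMap l b ↔ mk a = mk b := by
    intro a b
    rw [hmk]
    constructor
    · exact fun hab t ht => (classMap_le_iff l t).2 ((hl t).2 ((hrel t).1 ht)) a b hab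
    · exact fun H => H (Setoid.ker (classMap l))
        ((hrel _).2 ((hl _).1 fun e he => classMap_eq_of_mem he))
  have hglued : ∀ r r', G.GluedAlong w w' hne h r r' → mk r = mk r' :=
    (hrel (Setoid.ker mk)).1 fun r r' hr => Quot.sound hr
  rw [fixedContent, mul_assoc, mul_assoc, gluedValue_eq_prod F.integralForm (F.euler ∅) l _ G.chi hχ
    mk Quot.mk_surjective hclass (G.selfGlueWith w w' hne h rel).chi]
  · refine (F.pureCorrelator_eq (G.selfGlueWith w w' hne h rel) a).trans ?_
    refine Finset.prod_congr rfl fun c _ => ?_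
    refine congrArg (fun x : F.A ∅ => F.integralForm
      (F.euler ∅ ^ (1 - (G.selfGlueWith w w' hne h rel).chi c).toNat * x)) ?_
    refine congrFun ?_ c
    refine (congrArg₂ (· * ·) (congrArg₂ (· * ·) (F.punctureContent_selfGlueWith G hne h rel)
      (F.innerContent_selfGlueWith G hne h rel a))
      (F.pointContent_selfGlueWith G hne h rel a)).trans ?_
    rw [← hP mk hglued]
    simp only [foldMul_mul, mk]
    ring
  · intro c
    have := hcount (fun r => mk r = c) (fun r r' hr => by rw [hglued r r' hr])
    rw [this]
    change (∑ᶠ r : {r : G.Region // Quot.mk rel r = c}, G.chi r.1) - _ + _ = _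
    rw [finsum_eq_sum_of_fintype, Finset.sum_subtype (F := inferInstance) _
      (p := fun r => Quot.mk rel r = c) (fun r => by
        rw [Finset.mem_filter]
        exact ⟨And.right, fun h => ⟨Finset.mem_univ _, h⟩⟩), sub_sub_eq_add_sub,
      sub_add_eq_add_sub]
    rfl

open scoped Classical in
theorem newPunctureContent_eq [Fintype G.Window] {Q : Type*} [DecidableEq Q] (hne : w ≠ w')
    (mk : G.Region → Q) :
    F.newPunctureContent G w w' mk =
      (if (G.next w' = w ∨ (G.next w = w ∧ G.next w' = w')) then
        (if G.color w ≠ Color.closed then Pi.mulSingle (mk (G.pointRegion w))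
          (F.resDagger (G.color w).src (F.euler (G.color w).src)) else 1) else 1) *
      (if G.next w = w' then
        (if G.color w' ≠ Color.closed then Pi.mulSingle (mk (G.pointRegion w'))
          (F.resDagger (G.color w').src (F.euler (G.color w').src)) else 1) else 1) := by
  refine Eq.trans ?_ (ArcDiagram.prod_ite_pair hne _ _ (fun u => if G.color u ≠ Color.closed then
    (Pi.mulSingle (mk (G.pointRegion u)) (F.resDagger (G.color u).src (F.euler (G.color u).src)) :
      Q → F.A ∅) else 1))
  rw [newPunctureContent, ← Finset.prod_subtype
    (Finset.univ.filter fun u => G.BecomesInterior w w' u ∧ G.color u ≠ Color.closed) (by simp)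
    (fun u => (Pi.mulSingle (mk (G.pointRegion u))
      (F.resDagger (G.color u).src (F.euler (G.color u).src)) : Q → F.A ∅)), Finset.prod_filter]
  refine Finset.prod_congr rfl fun u _ => ?_
  rw [ite_and]
  congr!

/-- The gluing formula on pure tensors: the correlator of a glued diagram is obtained by inserting
dual bases in all tensor factors at the two windows. -/
theorem pureCorrelator_glue (hG : ∀ r, G.chi r ≤ 1)
    (hl : ∀ u, (G.color u).tgt = (G.color (G.next u)).src)
    (hclosed : ∀ u, G.color u = Color.closed → G.next u = u)
    (hopen : ∀ u, G.color u ≠ Color.closed → (G.color u).src.Nonempty ∧ (G.color u).tgt.Nonempty)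
    (hne : w ≠ w') (h : G.wt w = G.wt w') (hcol : G.color w' = (G.color w).bar)
    (hE : G.color w = Color.closed ∨ (F.IsBasic ∧ F.ConditionE))
    (rel : G.Region → G.Region → Prop)
    (hrel : ∀ t : Setoid G.Region, (∀ r r', rel r r' → t r r') ↔
      ∀ r r', G.GluedAlong w w' hne h r r' → t r r')
    (a : ∀ u : {u : G.Window // u ≠ w ∧ u ≠ w'}, F.Decoration (G.color u) (G.wt u - 1)) :
    F.pureCorrelator (G.selfGlueWith w w' hne h rel) hC.out a =
      ∑ κ, F.pureCorrelator G hC.out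
        (extendPair (V := fun u => F.Decoration (G.color u) (G.wt u - 1)) a
          (F.vecs (G.color w) (G.wt w - 1) κ)
          ((F.covecs (G.color w) (G.wt w - 1) κ).flip.cast hcol.symm (by rw [h]))) := by
  classical
  let _ := Fintype.ofFinite G.Window
  let _ := Fintype.ofFinite G.Region
  let _ := Fintype.ofFinite G.Puncture
  by_cases hc : G.color w = Color.closed
  · have hc' : G.color w' = Color.closed := by rw [hcol, hc]; rfl
    have hw := hclosed w hc
    have hw' := hclosed w' hc'
    rw [F.sum_pureCorrelator_closed G a hne h hcol hc hw hw',
      F.pureCorrelator_selfGlueWith G hG hne h rel hrel _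
        (G.forall_mem_closedPairs hne h hw hw') _ 1 _ a, mul_one]
    · intro p _ hp
      refine G.countP_closedPairs hne h hw hw' p ?_
      have := ((G.gluedAlong_le_iff hne h (Setoid.ker p)).1
        fun r r' hr => propext (hp r r' hr)).1
      rw [hw'] at this
      exact Iff.of_eq this
    · intro Q _ mk _
      rw [F.newPunctureContent_eq G hne]
      rw [foldMul_one]
      simp [hc, hc']
  · obtain ⟨hS, hT⟩ := hopen w hc
    obtain ⟨hB, hE⟩ := hE.resolve_left hc
    have hc' : G.color w' ≠ Color.closed := by
      rw [hcol]
      cases hcw : G.color w with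
      | closed => exact absurd hcw hc
      | opn S T => simp [Color.bar]
    have hs' : (G.color w').src = (G.color w).tgt := by
      rw [hcol]
      cases G.color w <;> rfl
    rw [F.sum_pureCorrelator_open G a hne h hcol hB hE hl hc hS hT,
      F.pureCorrelator_selfGlueWith G hG hne h rel hrel _ (G.forall_mem_openPairs hne h) _
        (endContent G.pointRegion G.next w w'
            (F.resDagger (G.color w).src (F.euler (G.color w).src)) *
          endContent G.pointRegion (reroute G.next w w') w' w
            (F.resDagger (G.color w).tgt (F.euler (G.color w).tgt))) _ a, ← mul_assoc]
    · intro p _ hp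
      exact G.countP_openPairs hne h p (Iff.of_eq ((G.gluedAlong_le_iff hne h (Setoid.ker p)).1
        fun r r' hr => propext (hp r r' hr)).1)
    · intro Q _ mk hmk
      have hmw : mk (G.pointRegion w) = mk (G.pointRegion (G.next w')) :=
        ((G.gluedAlong_le_iff hne h (Setoid.ker mk)).1 hmk).1
      rw [F.newPunctureContent_eq G hne, foldMul_mul, if_pos hc, if_pos hc', hs']
      have hend : ∀ (σ : Equiv.Perm G.Window) (w₁ w₂ : G.Window) (p : F.A ∅),
          foldMul mk (endContent G.pointRegion σ w₁ w₂ p) =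
            if σ w₂ = w₁ then Pi.mulSingle (mk (G.pointRegion w₁)) p else 1 := by
        intro σ w₁ w₂ p
        rw [endContent]
        split_ifs
        exacts [foldMul_mulSingle _ _ _, foldMul_one _]
      rw [hend, hend]
      by_cases hw : G.next w = w
      · have e : reroute G.next w w' w = G.next w' := by simp [reroute, hw]
        have e' : G.next w' ≠ w := fun e' => hne (G.next.injective (hw.trans e'.symm))
        have ht : (G.color w).tgt = (G.color w).src := by rw [hl w, hw]
        by_cases hw' : G.next w' = w'
        · rw [hw'] at hmw
          simp [hw, hw', hne, hne.symm, e, hmw]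
          rw [ht]
        · simp [hw, hw', hne, e, e']
      · have e : reroute G.next w w' w = G.next w :=
          Equiv.swap_apply_of_ne_of_ne (G.next.injective.ne hne) hw
        simp [hw, e]

end BraneFrobenius

/-! ### Extension by multilinearity -/

section
variable {k : Type*} [Field k] {W : Type} {w w' : W}

theorem extendPair_eq_update_left [DecidableEq W] {V : W → Type*}
    (y : ∀ u : {u // u ≠ w ∧ u ≠ w'}, V u.1) (p p₀ : V w) (q : V w') :
    extendPair y p q = Function.update (extendPair y p₀ q) w p := by
  funext u
  by_cases h : u = w
  · subst h
    rw [Function.update_self, extendPair_left]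
  · rw [Function.update_of_ne h, extendPair, extendPair, dif_neg h, dif_neg h]

theorem extendPair_eq_update_right [DecidableEq W] {V : W → Type*} (hne : w ≠ w')
    (y : ∀ u : {u // u ≠ w ∧ u ≠ w'}, V u.1)
    (p : V w) (q q₀ : V w') : extendPair y p q = Function.update (extendPair y p q₀) w' q := by
  funext u
  by_cases h : u = w'
  · subst h
    rw [Function.update_self, extendPair_right _ _ _ hne]
  · rw [Function.update_of_ne h, extendPair, extendPair]
    simp [h]

theorem extendPair_update [DecidableEq W] [DecidableEq {u // u ≠ w ∧ u ≠ w'}] {V : W → Type*}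
    (y : ∀ u : {u // u ≠ w ∧ u ≠ w'}, V u.1) (p : V w) (q : V w')
    (t : {u // u ≠ w ∧ u ≠ w'}) (x : V t.1) :
    extendPair (V := V) (Function.update y t x) p q = Function.update (extendPair y p q) t.1 x := by
  funext u
  by_cases h : u = t.1
  · subst h
    rw [Function.update_self, extendPair_of_ne, Function.update_self]
  · rw [Function.update_of_ne h, extendPair, extendPair]
    split_ifs with e e'
    · rfl
    · rfl
    · rw [Function.update_of_ne]
      exact fun e => h (congrArg Subtype.val e)

variable {V : W → Type*} [∀ u, AddCommGroup (V u)] [∀ u, Module k (V u)]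

/-- The multilinear map obtained by fixing the arguments at `w` and `w'`. -/
def MultilinearMap.fixPair (f : MultilinearMap k V k) (p : V w) (q : V w') :
    MultilinearMap k (fun u : {u // u ≠ w ∧ u ≠ w'} => V u.1) k := by
  classical
  exact MultilinearMap.mk' (fun y => f (extendPair y p q))
    (fun y i a b => by simp only [extendPair_update, f.map_update_add])
    (fun y i c a => by simp only [extendPair_update, f.map_update_smul])

/-- The bilinear form obtained by fixing all arguments but those at `w` and `w'`. -/
def MultilinearMap.fixOthers (f : MultilinearMap k V k) (hne : w ≠ w')
    (y : ∀ u : {u // u ≠ w ∧ u ≠ w'}, V u.1) : V w →ₗ[k] V w' →ₗ[k] k := by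
  classical
  exact LinearMap.mk₂ k (fun p q => f (extendPair y p q))
    (fun p p' q => by
      rw [extendPair_eq_update_left y (p + p') 0, extendPair_eq_update_left y p 0,
        extendPair_eq_update_left y p' 0, f.map_update_add])
    (fun c p q => by
      rw [extendPair_eq_update_left y (c • p) 0, extendPair_eq_update_left y p 0,
        f.map_update_smul])
    (fun p q q' => by
      rw [extendPair_eq_update_right hne y p (q + q') 0, extendPair_eq_update_right hne y p q 0,
        extendPair_eq_update_right hne y p q' 0, f.map_update_add])
    (fun c p q => by
      rw [extendPair_eq_update_right hne y p (c • q) 0, extendPair_eq_update_right hne y p q 0,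
        f.map_update_smul])

theorem MultilinearMap.sum_fixPair_apply {ι : Type*} [Fintype ι] (f : MultilinearMap k V k)
    (p : ι → V w) (q : ι → V w') (y : ∀ u : {u // u ≠ w ∧ u ≠ w'}, V u.1) :
    (∑ i, f.fixPair (p i) (q i)) y = ∑ i, f (extendPair y (p i) (q i)) := by
  rw [sum_apply]
  rfl

/-- Multilinear forms on tensor products are determined by their values on pure tensors. -/
theorem MultilinearMap.ext_tprod [Finite W] {S : W → Type} [∀ w, Finite (S w)]
    {M : ∀ w, S w → Type v} [∀ w s, AddCommGroup (M w s)] [∀ w s, Module k (M w s)]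
    [∀ w s, Module.Finite k (M w s)] {f g : MultilinearMap k (fun w => ⨂[k] s, M w s) k}
    (h : ∀ a : ∀ w s, M w s, f (fun w => PiTensorProduct.tprod k (a w)) =
      g (fun w => PiTensorProduct.tprod k (a w))) : f = g := by
  classical
  let _ := fun w => Fintype.ofFinite (S w)
  refine Module.Basis.ext_multilinear
    (fun w => Basis.piTensorProduct (fun s => Module.finBasis k (M w s))) fun κ => ?_
  simp only [Basis.piTensorProduct_apply]
  exact h _

/-- The product of two multilinear forms in disjoint sets of variables. -/
def MultilinearMap.mulSum {W' : Type} {V : W ⊕ W' → Type*} [∀ u, AddCommGroup (V u)]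
    [∀ u, Module k (V u)] (f : MultilinearMap k (fun u => V (Sum.inl u)) k)
    (g : MultilinearMap k (fun u => V (Sum.inr u)) k) : MultilinearMap k V k := by
  classical
  have hl : ∀ (y : ∀ u, V u) (i : W) x, (fun u => Function.update y (Sum.inl i) x (Sum.inl u)) =
      Function.update (fun u => y (Sum.inl u)) i x := fun y i x =>
    Function.update_comp_eq_of_injective' y Sum.inl_injective i x
  have hr : ∀ (y : ∀ u, V u) (i : W') x, (fun u => Function.update y (Sum.inr i) x (Sum.inr u)) =
      Function.update (fun u => y (Sum.inr u)) i x := fun y i x =>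
    Function.update_comp_eq_of_injective' y Sum.inr_injective i x
  exact MultilinearMap.mk' (fun y => f (fun u => y (Sum.inl u)) * g (fun u => y (Sum.inr u)))
    (fun y i a b => by
      rcases i with i | i
      · simp only [hl, f.map_update_add, add_mul]
        simp
      · simp only [hr, g.map_update_add, mul_add]
        simp)
    (fun y i c a => by
      rcases i with i | i
      · simp only [hl, f.map_update_smul]
        simp [mul_assoc]
      · simp only [hr, g.map_update_smul]
        simp [mul_left_comm])

end

/-! ### Casimir elements of the bar complexes -/

namespace BraneFrobenius

variable {k : Type u} [Field k] {B : Type z} (F : BraneFrobenius.{u, v, z} k B)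

/-- The tensor products of dual families are dual to each other. -/
theorem sum_barToDual (c : Color B) (n : ℕ) {ι : c.Slot n → Type} [∀ s, Fintype (ι s)]
    [∀ s, DecidableEq (ι s)]
    (b d : ∀ s, ι s → F.A (c.slotLabel s))
    (h : ∀ s, IsDualPair (F.form (c.slotLabel s)) (b s) (d s)) (x : F.Bar c n) :
    ∑ κ : ∀ s, ι s, F.barToDual c n x (PiTensorProduct.tprod k fun s => d s (κ s)) •
      PiTensorProduct.tprod k (fun s => b s (κ s)) = x := by
  have key : (∑ κ : ∀ s, ι s, ((F.barToDual c n).toLinearMap.flip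
      (PiTensorProduct.tprod k fun s => d s (κ s))).smulRight
        (PiTensorProduct.tprod k (fun s => b s (κ s)))) = LinearMap.id := by
    refine PiTensorProduct.ext (MultilinearMap.ext fun a => ?_)
    have ha : a = fun s => ∑ i, F.form (c.slotLabel s) (a s) (d s i) • b s i :=
      funext fun s => ((h s).sum_left (a s)).symm
    simp only [LinearMap.compMultilinearMap_apply, LinearMap.sum_apply, LinearMap.smulRight_apply,
      LinearMap.flip_apply, LinearEquiv.coe_coe, barToDual_tprod, LinearMap.id_coe, id]
    conv_rhs => rw [ha, MultilinearMap.map_sum]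
    simp only [MultilinearMap.map_smul_univ]
  have := congrArg (fun f => f x) key
  simpa [LinearMap.sum_apply] using this

theorem isDualPair_bar (c : Color B) (n : ℕ) :
    IsDualPair (F.barToDual c n).toLinearMap (fun κ => PiTensorProduct.tprod k (F.vecs c n κ))
      (fun κ => PiTensorProduct.tprod k (F.covecs c n κ)) :=
  ⟨F.sum_barToDual c n _ _ fun _ => F.isDualPair_vec _,
    F.sum_barToDual c n _ _ fun _ => (F.isDualPair_vec _).symm⟩

theorem barFlip_tprod (c : Color B) (n : ℕ) (d : F.Decoration c n) :
    F.barFlip c n (PiTensorProduct.tprod k d) = PiTensorProduct.tprod k d.flip := by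
  rw [barFlip, LinearEquiv.trans_apply, PiTensorProduct.reindex_tprod,
    PiTensorProduct.congr_tprod]
  rfl

/-- The bar complex of the same colour and degree, given in a different form. -/
def barCast {c c' : Color B} {n n' : ℕ} (hc : c = c') (hn : n = n') :
    F.Bar c n ≃ₗ[k] F.Bar c' n' := hc ▸ hn ▸ LinearEquiv.refl k (F.Bar c n)

theorem barCast_tprod {c c' : Color B} {n n' : ℕ} (hc : c = c') (hn : n = n')
    (d : F.Decoration c n) :
    F.barCast hc hn (PiTensorProduct.tprod k d) = PiTensorProduct.tprod k (d.cast hc hn) := by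
  subst hc hn
  rfl

variable [hC : Fact F.ConditionC]

/-- The gluing formula in the degrees in which the correlators do not vanish. -/
theorem barCorrelatorPart_glue {G : ArcDiagram B} {w w' : G.Window} (hG : ∀ r, G.chi r ≤ 1)
    (hl : ∀ u, (G.color u).tgt = (G.color (G.next u)).src)
    (hclosed : ∀ u, G.color u = Color.closed → G.next u = u)
    (hopen : ∀ u, G.color u ≠ Color.closed → (G.color u).src.Nonempty ∧ (G.color u).tgt.Nonempty)
    (hne : w ≠ w') (h : G.wt w = G.wt w') (hcol : G.color w' = (G.color w).bar)
    (hE : G.color w = Color.closed ∨ (F.IsBasic ∧ F.ConditionE))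
    (rel : G.Region → G.Region → Prop)
    (hrel : ∀ t : Setoid G.Region, (∀ r r', rel r r' → t r r') ↔
      ∀ r r', G.GluedAlong w w' hne h r r' → t r r')
    (y : ∀ u : {u : G.Window // u ≠ w ∧ u ≠ w'}, F.Bar (G.color u) (G.wt u - 1)) :
    F.barCorrelatorPart hC.out (G.selfGlueWith w w' hne h rel) y =
      ∑ κ, F.barCorrelatorPart hC.out G
        (extendPair (V := fun u => F.Bar (G.color u) (G.wt u - 1)) y
          (PiTensorProduct.tprod k (F.vecs (G.color w) (G.wt w - 1) κ))
          (PiTensorProduct.tprod k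
            ((F.covecs (G.color w) (G.wt w - 1) κ).flip.cast hcol.symm (by rw [h])))) := by
  let p := fun κ => PiTensorProduct.tprod k (F.vecs (G.color w) (G.wt w - 1) κ)
  let q := fun κ => PiTensorProduct.tprod k
    ((F.covecs (G.color w) (G.wt w - 1) κ).flip.cast hcol.symm (by rw [h]))
  have happly := (F.barCorrelatorPart hC.out G).sum_fixPair_apply p q
  suffices hg : F.barCorrelatorPart hC.out (G.selfGlueWith w w' hne h rel) =
      ∑ κ, (F.barCorrelatorPart hC.out G).fixPair (p κ) (q κ) from
    (congrArg (fun f => f y) hg).trans (happly y)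
  refine MultilinearMap.ext_tprod fun a => ?_
  refine (F.barCorrelatorPart_tprod hC.out (G.selfGlueWith w w' hne h rel) a).trans ?_
  refine (F.pureCorrelator_glue G hG hl hclosed hopen hne h hcol hE rel hrel a).trans ?_
  refine Eq.trans (Finset.sum_congr rfl fun κ _ => ?_) (happly _).symm
  rw [← barCorrelatorPart_tprod]
  refine congrArg (F.barCorrelatorPart hC.out G) (funext fun u => ?_)
  exact map_extendPair (V := fun u => F.Decoration (G.color u) (G.wt u - 1)) a _ _
    (V' := fun u => F.Bar (G.color u) (G.wt u - 1)) (fun u d => PiTensorProduct.tprod k d) u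

end BraneFrobenius

/-! ### Disjoint unions -/

namespace ArcDiagram

variable {B : Type z} (G G' : ArcDiagram B)

/-- The inclusion of the flags of the first summand of a disjoint union. -/
def inlFlag (f : G.Flag) : (G.disjointUnion G').Flag := ⟨Sum.inl f.1, f.2⟩

/-- The inclusion of the flags of the second summand of a disjoint union. -/
def inrFlag (f : G'.Flag) : (G.disjointUnion G').Flag := ⟨Sum.inr f.1, f.2⟩

theorem inlFlag_injective : Function.Injective (G.inlFlag G') := by
  rintro ⟨w, i⟩ ⟨w', i'⟩ h
  obtain ⟨h1, h2⟩ := Sigma.mk.inj_iff.1 h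
  exact Sigma.ext (Sum.inl_injective h1) h2

theorem inrFlag_injective : Function.Injective (G.inrFlag G') := by
  rintro ⟨w, i⟩ ⟨w', i'⟩ h
  obtain ⟨h1, h2⟩ := Sigma.mk.inj_iff.1 h
  exact Sigma.ext (Sum.inr_injective h1) h2

end ArcDiagram

namespace BraneFrobenius

variable {k : Type u} [Field k] {B : Type z} (F : BraneFrobenius.{u, v, z} k B)

section
variable (hC : F.ConditionC) (G G' : ArcDiagram B)
  (a : ∀ w, F.Decoration ((G.disjointUnion G').color w) ((G.disjointUnion G').wt w - 1))

theorem regionCorrelator_disjointUnion_inl (r : G.Region) :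
    F.regionCorrelator (G.disjointUnion G') hC a (Sum.inl r) =
      F.regionCorrelator G hC (fun w => a (Sum.inl w)) r := by
  let _ : CommRing (F.A ∅) := F.emptyCommRing hC
  have e1 : (∏ᶠ f : {f : G.Flag // G.region f = r}, F.sideWeight G (fun w => a (Sum.inl w)) f.1) =
      ∏ᶠ f : {f : (G.disjointUnion G').Flag // (G.disjointUnion G').region f = Sum.inl r},
        F.sideWeight (G.disjointUnion G') a f.1 := by
    refine finprod_eq_of_bijective
      (fun f => ⟨G.inlFlag G' f.1, congrArg Sum.inl f.2⟩) ⟨?_, ?_⟩ fun f => rfl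
    · intro f f' h
      exact Subtype.ext (G.inlFlag_injective G' (congrArg Subtype.val h))
    · rintro ⟨⟨w | w, i⟩, hf⟩
      · exact ⟨⟨⟨w, i⟩, Sum.inl_injective hf⟩, rfl⟩
      · exact absurd hf Sum.inr_ne_inl
  have e2 : (∏ᶠ p : {p : G.Puncture // G.punctureRegion p = r},
        F.resDagger (G.punctureLabel p.1) (F.euler (G.punctureLabel p.1))) =
      ∏ᶠ p : {p : (G.disjointUnion G').Puncture //
          (G.disjointUnion G').punctureRegion p = Sum.inl r},
        F.resDagger ((G.disjointUnion G').punctureLabel p.1)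
          (F.euler ((G.disjointUnion G').punctureLabel p.1)) := by
    refine finprod_eq_of_bijective
      (fun p => ⟨Sum.inl p.1, congrArg Sum.inl p.2⟩) ⟨?_, ?_⟩ fun f => rfl
    · intro p p' h
      exact Subtype.ext (Sum.inl_injective (congrArg Subtype.val h))
    · rintro ⟨p | p, hp⟩
      · exact ⟨⟨p, Sum.inl_injective hp⟩, rfl⟩
      · exact absurd hp Sum.inr_ne_inl
  exact congrArg₂ (fun x y => F.integral ∅ (F.euler ∅ ^ (1 - G.chi r).toNat * x * y))
    e1.symm e2.symm

theorem regionCorrelator_disjointUnion_inr (r : G'.Region) :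
    F.regionCorrelator (G.disjointUnion G') hC a (Sum.inr r) =
      F.regionCorrelator G' hC (fun w => a (Sum.inr w)) r := by
  let _ : CommRing (F.A ∅) := F.emptyCommRing hC
  have e1 : (∏ᶠ f : {f : G'.Flag // G'.region f = r},
        F.sideWeight G' (fun w => a (Sum.inr w)) f.1) =
      ∏ᶠ f : {f : (G.disjointUnion G').Flag // (G.disjointUnion G').region f = Sum.inr r},
        F.sideWeight (G.disjointUnion G') a f.1 := by
    refine finprod_eq_of_bijective
      (fun f => ⟨G.inrFlag G' f.1, congrArg Sum.inr f.2⟩) ⟨?_, ?_⟩ fun f => rfl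
    · intro f f' h
      exact Subtype.ext (G.inrFlag_injective G' (congrArg Subtype.val h))
    · rintro ⟨⟨w | w, i⟩, hf⟩
      · exact absurd hf Sum.inl_ne_inr
      · exact ⟨⟨⟨w, i⟩, Sum.inr_injective hf⟩, rfl⟩
  have e2 : (∏ᶠ p : {p : G'.Puncture // G'.punctureRegion p = r},
        F.resDagger (G'.punctureLabel p.1) (F.euler (G'.punctureLabel p.1))) =
      ∏ᶠ p : {p : (G.disjointUnion G').Puncture //
          (G.disjointUnion G').punctureRegion p = Sum.inr r},
        F.resDagger ((G.disjointUnion G').punctureLabel p.1)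
          (F.euler ((G.disjointUnion G').punctureLabel p.1)) := by
    refine finprod_eq_of_bijective
      (fun p => ⟨Sum.inr p.1, congrArg Sum.inr p.2⟩) ⟨?_, ?_⟩ fun f => rfl
    · intro p p' h
      exact Subtype.ext (Sum.inr_injective (congrArg Subtype.val h))
    · rintro ⟨p | p, hp⟩
      · exact absurd hp Sum.inl_ne_inr
      · exact ⟨⟨p, Sum.inr_injective hp⟩, rfl⟩
  exact congrArg₂ (fun x y => F.integral ∅ (F.euler ∅ ^ (1 - G'.chi r).toNat * x * y))
    e1.symm e2.symm

theorem pureCorrelator_disjointUnion :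
    F.pureCorrelator (G.disjointUnion G') hC a =
      F.pureCorrelator G hC (fun w => a (Sum.inl w)) *
        F.pureCorrelator G' hC (fun w => a (Sum.inr w)) := by
  let _ := Fintype.ofFinite G.Region
  let _ := Fintype.ofFinite G'.Region
  let I : Fintype (G.disjointUnion G').Region := inferInstanceAs (Fintype (G.Region ⊕ G'.Region))
  simp only [pureCorrelator]
  rw [finprod_eq_prod_of_fintype, finprod_eq_prod_of_fintype, finprod_eq_prod_of_fintype]
  refine (Fintype.prod_sum_type _).trans ?_
  congr 1
  · exact Finset.prod_congr rfl fun r _ => F.regionCorrelator_disjointUnion_inl hC G G' a r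
  · exact Finset.prod_congr rfl fun r _ => F.regionCorrelator_disjointUnion_inr hC G G' a r

end

theorem barCorrelatorPart_disjointUnion (hC : F.ConditionC) (G G' : ArcDiagram B)
    (y : ∀ w, F.Bar ((G.disjointUnion G').color w) ((G.disjointUnion G').wt w - 1)) :
    F.barCorrelatorPart hC (G.disjointUnion G') y =
      F.barCorrelatorPart hC G (fun w => y (Sum.inl w)) *
        F.barCorrelatorPart hC G' (fun w => y (Sum.inr w)) := by
  suffices h : F.barCorrelatorPart hC (G.disjointUnion G') = MultilinearMap.mulSum
      (V := fun w => F.Bar ((G.disjointUnion G').color w) ((G.disjointUnion G').wt w - 1))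
      (F.barCorrelatorPart hC G) (F.barCorrelatorPart hC G') from congrArg (fun f => f y) h
  refine MultilinearMap.ext_tprod fun a => ?_
  refine (F.barCorrelatorPart_tprod hC (G.disjointUnion G') a).trans ?_
  refine (F.pureCorrelator_disjointUnion hC G G' a).trans ?_
  exact congrArg₂ (· * ·) (F.barCorrelatorPart_tprod hC G _).symm
    (F.barCorrelatorPart_tprod hC G' _).symm

/-! ### Coefficient systems isomorphic to the bar complexes -/

section
variable {M : CoefficientSystem.{u, max u v, z} k B}
  (θ : ∀ c n, M.V c n ≃ₗ[k] F.Bar c n)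

theorem component_cast {c c' : Color B} (h : c' = c) {n m : ℕ} (hn : n = m) (x : M.V c n) :
    θ c' m (DirectSum.component k ℕ (fun n => M.V c' n) m (h ▸ M.of x)) =
      F.barCast h.symm hn (θ c n x) := by
  subst h hn
  exact congrArg (θ c' n) (DirectSum.component.lof_self k n x)

/-- The component of a vector in the degree in which `Y(G)` does not vanish. -/
def windowPart (G : ArcDiagram B) (w : G.Window) (x : M.Total (G.color w)) :
    F.Bar (G.color w) (G.wt w - 1) :=
  θ (G.color w) (G.wt w - 1) (DirectSum.component k ℕ (fun n => M.V (G.color w) n) (G.wt w - 1) x)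

variable [hC : Fact F.ConditionC]

/-- The correlator `Y(G)` carried over along isomorphisms `θ` to the bar complexes. -/
def correlatorVia (G : ArcDiagram B) : M.Correlator G.color :=
  (F.barCorrelatorPart hC.out G).compLinearMap (fun w =>
    (θ (G.color w) (G.wt w - 1)).toLinearMap ∘ₗ
      DirectSum.component k ℕ (fun n => M.V (G.color w) n) (G.wt w - 1))

theorem correlatorVia_apply (G : ArcDiagram B) (x : ∀ w, M.Total (G.color w)) :
    F.correlatorVia θ G x = F.barCorrelatorPart hC.out G (fun w => F.windowPart θ G w (x w)) := rfl

/-- In the self-composition along windows of the same weight, only the degree `wt w - 1` of the Casimir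
element contributes, and there it can be computed with the tuples of dual basis vectors. -/
theorem selfCompose_correlatorVia
    (hform : ∀ c n x y, M.form c n x y = F.barToDual c n (θ c n x) (θ c n y))
    (hflip : ∀ c n x, θ c.bar n (M.flip c n x) = F.barFlip c n (θ c n x))
    {G : ArcDiagram B} {w w' : G.Window} (hne : w ≠ w') (h : G.wt w = G.wt w')
    (hcol : G.color w' = (G.color w).bar)
    (x : ∀ u : {u : G.Window // u ≠ w ∧ u ≠ w'}, M.Total (G.color u.1)) :
    M.selfCompose (F.correlatorVia θ G) w w' hcol x =
      ∑ κ, F.barCorrelatorPart hC.out G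
        (extendPair (V := fun u => F.Bar (G.color u) (G.wt u - 1))
          (fun u => F.windowPart θ G u.1 (x u))
          (PiTensorProduct.tprod k (F.vecs (G.color w) (G.wt w - 1) κ))
          (PiTensorProduct.tprod k
            ((F.covecs (G.color w) (G.wt w - 1) κ).flip.cast hcol.symm (by rw [h])))) := by
  classical
  set y : ∀ u : {u : G.Window // u ≠ w ∧ u ≠ w'}, F.Bar (G.color u) (G.wt u - 1) :=
    fun u => F.windowPart θ G u.1 (x u)
  have hY : ∀ (p : M.Total (G.color w)) (q : M.Total (G.color w')),
      F.correlatorVia θ G (extendPair (V := fun u => M.Total (G.color u)) x p q) =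
        F.barCorrelatorPart hC.out G (extendPair (V := fun u => F.Bar (G.color u) (G.wt u - 1)) y
          (F.windowPart θ G w p) (F.windowPart θ G w' q)) := by
    intro p q
    rw [correlatorVia_apply]
    refine congrArg (F.barCorrelatorPart hC.out G) (funext fun u => ?_)
    exact map_extendPair (V := fun u => M.Total (G.color u)) x p q
      (V' := fun u => F.Bar (G.color u) (G.wt u - 1)) (F.windowPart θ G) u
  have hsc : M.selfCompose (F.correlatorVia θ G) w w' hcol x =
      ∑ᶠ n : ℕ, insertCasimir (M.form (G.color w) n) (fun Δ Δ' =>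
        F.correlatorVia θ G (extendPair (V := fun u => M.Total (G.color u)) x (M.of Δ)
          (hcol ▸ M.of (M.flip (G.color w) n Δ')))) := by
    unfold CoefficientSystem.selfCompose
    refine finsum_congr fun n => congrArg _ (funext fun Δ => funext fun Δ' => ?_)
    refine congrArg (F.correlatorVia θ G) (funext fun u => ?_)
    by_cases e : u = w
    · subst e
      rw [dif_pos rfl, extendPair_left]
    · by_cases e' : u = w'
      · subst e'
        rw [dif_neg e, dif_pos rfl, extendPair_right _ _ _ hne]
      · rw [dif_neg e, dif_neg e', extendPair, dif_neg e, dif_neg e']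
  rw [hsc, finsum_eq_single _ (G.wt w - 1)]
  · let n := G.wt w - 1
    have hn : n = G.wt w' - 1 := by rw [← h]
    let T : M.V (G.color w) n →ₗ[k] F.Bar (G.color w') (G.wt w' - 1) :=
      (θ (G.color w) n ≪≫ₗ F.barFlip (G.color w) n ≪≫ₗ F.barCast hcol.symm hn).toLinearMap
    let L := ((F.barCorrelatorPart hC.out G).fixOthers hne y).compl₁₂
      (θ (G.color w) n).toLinearMap T
    have hL : (fun Δ Δ' => F.correlatorVia θ G (extendPair (V := fun u => M.Total (G.color u)) x
        (M.of Δ) (hcol ▸ M.of (M.flip (G.color w) n Δ')))) = fun Δ Δ' => L Δ Δ' := by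
      funext Δ Δ'
      rw [hY]
      have h1 : F.windowPart θ G w (M.of Δ) = θ (G.color w) n Δ :=
        congrArg (θ (G.color w) n) (DirectSum.component.lof_self k n Δ)
      have h2 : F.windowPart θ G w' (hcol ▸ M.of (M.flip (G.color w) n Δ')) = T Δ' := by
        refine (F.component_cast θ hcol hn _).trans ?_
        rw [hflip]
        rfl
      rw [h1, h2]
      rfl
    have hdual : IsDualPair (M.form (G.color w) n)
        (fun κ => (θ (G.color w) n).symm (PiTensorProduct.tprod k (F.vecs (G.color w) n κ)))
        (fun κ => (θ (G.color w) n).symm (PiTensorProduct.tprod k (F.covecs (G.color w) n κ))) := by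
      have hd := F.isDualPair_bar (G.color w) n
      constructor
      · intro x
        apply (θ (G.color w) n).injective
        simp only [hform, LinearEquiv.apply_symm_apply, map_sum, map_smul]
        exact hd.sum_left _
      · intro x
        apply (θ (G.color w) n).injective
        simp only [hform, LinearEquiv.apply_symm_apply, map_sum, map_smul]
        exact hd.sum_right _
    rw [hL, insertCasimir_eq_sum (M.form_symm _ _) (M.form_nondegenerate _ _) hdual L]
    refine Finset.sum_congr rfl fun κ _ => ?_
    change F.barCorrelatorPart hC.out G (extendPair y _ (F.barCast _ _ (F.barFlip _ _ _))) = _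
    simp only [LinearEquiv.coe_coe, LinearEquiv.apply_symm_apply, barFlip_tprod, barCast_tprod]
    rfl
  · intro n hn
    have h0 : ∀ Δ : M.V (G.color w) n, F.windowPart θ G w (M.of Δ) = 0 := by
      intro Δ
      rw [windowPart]
      refine (congrArg (θ _ _) ?_).trans (map_zero _)
      exact (DirectSum.component.of k (G.wt w - 1) n Δ).trans (dif_neg hn)
    have hz : (fun (Δ Δ' : M.V (G.color w) n) => F.correlatorVia θ G
        (extendPair (V := fun u => M.Total (G.color u)) x
        (M.of Δ) (hcol ▸ M.of (M.flip (G.color w) n Δ')))) = fun _ _ => 0 := by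
      funext Δ Δ'
      rw [hY]
      exact MultilinearMap.map_coord_zero _ w (by rw [extendPair_left, h0])
    rw [hz]
    simp [insertCasimir]

/-- Composition of two correlators is self-composition of the correlator of the disjoint union. -/
theorem compose_correlatorVia {G G' : ArcDiagram B} {w : G.Window} {w' : G'.Window}
    (hcol : G'.color w' = (G.color w).bar)
    (x : ∀ t : {t : G.Window ⊕ G'.Window // t ≠ Sum.inl w ∧ t ≠ Sum.inr w'},
      M.Total (Sum.elim G.color G'.color t.1)) :
    M.compose (F.correlatorVia θ G) (F.correlatorVia θ G') w w' hcol x =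
      M.selfCompose (F.correlatorVia θ (G.disjointUnion G')) (Sum.inl w) (Sum.inr w') hcol x := by
  unfold CoefficientSystem.compose CoefficientSystem.selfCompose
  refine finsum_congr fun n => congrArg _ (funext fun Δ => funext fun Δ' => ?_)
  refine Eq.trans ?_ (F.barCorrelatorPart_disjointUnion hC.out G G' _).symm
  rw [correlatorVia_apply, correlatorVia_apply]
  congr 1
  · refine congrArg (F.barCorrelatorPart hC.out G) (funext fun u => ?_)
    change F.windowPart θ G u _ = F.windowPart θ G u _
    refine congrArg (F.windowPart θ G u) ?_
    by_cases e : u = w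
    · subst e
      refine (dif_pos rfl).trans (Eq.symm ?_)
      exact dif_pos rfl
    · exact (dif_neg e).trans
        ((dif_neg (fun h => e (Sum.inl_injective h))).trans (dif_neg Sum.inl_ne_inr)).symm
  · refine congrArg (F.barCorrelatorPart hC.out G') (funext fun u => ?_)
    change F.windowPart θ G' u _ = F.windowPart θ G' u _
    refine congrArg (F.windowPart θ G' u) ?_
    by_cases e : u = w'
    · subst e
      exact (dif_pos rfl).trans ((dif_neg Sum.inr_ne_inl).trans (dif_pos rfl)).symm
    · exact (dif_neg e).trans
        ((dif_neg Sum.inr_ne_inl).trans (dif_neg (fun h => e (Sum.inr_injective h)))).symm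

end
end BraneFrobenius

/-! ### The action on coefficient systems -/

namespace ArcDiagram

variable {B : Type z}

/-- The properties of an arc graph that are relevant for the gluing of correlators.  They are local,
and hence hold for disjoint unions of arc graphs as well. -/
structure IsLocallyArcGraph (G : ArcDiagram B) : Prop where
  chi_le_one : ∀ r, G.chi r ≤ 1
  label_next : ∀ w, (G.color w).tgt = (G.color (G.next w)).src
  closed_next : ∀ w, G.color w = Color.closed → G.next w = w
  open_label : ∀ w, G.color w ≠ Color.closed → (G.color w).src.Nonempty ∧ (G.color w).tgt.Nonempty

theorem IsArcGraph.isLocallyArcGraph {G : ArcDiagram B} (hG : G.IsArcGraph) :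
    G.IsLocallyArcGraph := by
  refine ⟨fun r => ?_, hG.label_next, hG.closed_next, hG.open_label⟩
  obtain ⟨g, hg⟩ := hG.chi_eq r
  obtain ⟨f, hf⟩ := hG.region_surjective r
  have : Nonempty (G.Circle r) := ⟨Quot.mk _ ⟨f, hf⟩⟩
  have : Finite (G.Circle r) := Quot.finite _
  have hc : 0 < Nat.card (G.Circle r) := Nat.card_pos
  omega

theorem IsLocallyArcGraph.disjointUnion {G G' : ArcDiagram B} (hG : G.IsLocallyArcGraph)
    (hG' : G'.IsLocallyArcGraph) : (G.disjointUnion G').IsLocallyArcGraph where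
  chi_le_one r := by rcases r with r | r; exacts [hG.chi_le_one r, hG'.chi_le_one r]
  label_next w := by rcases w with w | w; exacts [hG.label_next w, hG'.label_next w]
  closed_next w h := by
    rcases w with w | w
    exacts [congrArg Sum.inl (hG.closed_next w h), congrArg Sum.inr (hG'.closed_next w h)]
  open_label w h := by rcases w with w | w; exacts [hG.open_label w h, hG'.open_label w h]

/-- If closed leaves do not separate regions, then deleting them does not change the regions. -/
theorem ClosedLeavesNonseparating.le_iff {G : ArcDiagram B} {w w' : G.Window} {hne : w ≠ w'}
    {h : G.wt w = G.wt w'} (hc : G.ClosedLeavesNonseparating w w' hne h) (t : Setoid G.Region) :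
    (∀ r r', G.GluedAlong w w' hne h r r' ∨ G.AlongClosedLeaf w w' hne h r r' → t r r') ↔
      ∀ r r', G.GluedAlong w w' hne h r r' → t r r' := by
  refine ⟨fun H r r' hr => H r r' (Or.inl hr), fun H r r' hr => ?_⟩
  rcases hr with hr | hr
  · exact H r r' hr
  · replace hr := hc r r' hr
    induction hr with
    | rel _ _ h => exact H _ _ h
    | refl _ => exact t.refl' _
    | symm _ _ _ ih => exact t.symm' ih
    | trans _ _ _ _ _ ih ih' => exact t.trans' ih ih'

end ArcDiagram

namespace BraneFrobenius

variable {k : Type u} [Field k] {B : Type z} (F : BraneFrobenius.{u, v, z} k B)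
  [hC : Fact F.ConditionC] {M : CoefficientSystem.{u, max u v, z} k B}
  (θ : ∀ c n, M.V c n ≃ₗ[k] F.Bar c n)

/-- The correlators of a gluing that identifies exactly the regions which become adjacent along the
glued windows, up to the equivalence relation generated by this. -/
theorem correlatorVia_selfGlueWith
    (hform : ∀ c n x y, M.form c n x y = F.barToDual c n (θ c n x) (θ c n y))
    (hflip : ∀ c n x, θ c.bar n (M.flip c n x) = F.barFlip c n (θ c n x))
    {G : ArcDiagram B} (hG : G.IsLocallyArcGraph) {w w' : G.Window} (hne : w ≠ w')
    (h : G.wt w = G.wt w') (hcol : G.color w' = (G.color w).bar)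
    (hE : G.color w = Color.closed ∨ (F.IsBasic ∧ F.ConditionE))
    (rel : G.Region → G.Region → Prop)
    (hrel : ∀ t : Setoid G.Region, (∀ r r', rel r r' → t r r') ↔
      ∀ r r', G.GluedAlong w w' hne h r r' → t r r')
    (x : ∀ u : {u : G.Window // u ≠ w ∧ u ≠ w'}, M.Total (G.color u.1)) :
    F.correlatorVia θ (G.selfGlueWith w w' hne h rel) x =
      M.selfCompose (F.correlatorVia θ G) w w' hcol x :=
  (F.barCorrelatorPart_glue hG.chi_le_one hG.label_next hG.closed_next hG.open_label hne h hcol hE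
    rel hrel fun u => F.windowPart θ G u.1 (x u)).trans
    (F.selfCompose_correlatorVia θ hform hflip hne h hcol x).symm

theorem actsViaCorrelators_correlatorVia
    (hform : ∀ c n x y, M.form c n x y = F.barToDual c n (θ c n x) (θ c n y))
    (hflip : ∀ c n x, θ c.bar n (M.flip c n x) = F.barFlip c n (θ c n x)) {P : Color B → Prop}
    (hP : ∀ c, P c → c = Color.closed ∨ (F.IsBasic ∧ F.ConditionE)) :
    ActsViaCorrelators M (F.correlatorVia θ) P := by
  refine ⟨fun G G' hG hG' w w' hwt hcol hw => ?_, fun G hG w w' hne hwt hcol hw => ?_⟩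
  · have hU := hG.isLocallyArcGraph.disjointUnion hG'.isLocallyArcGraph
    refine ⟨fun x => ?_, fun hc x => ?_⟩
    · exact (F.correlatorVia_selfGlueWith θ hform hflip hU Sum.inl_ne_inr hwt hcol (hP _ hw) _
        (fun _ => Iff.rfl) x).trans (F.compose_correlatorVia θ hcol x).symm
    · exact (F.correlatorVia_selfGlueWith θ hform hflip hU Sum.inl_ne_inr hwt hcol (hP _ hw) _
        hc.le_iff x).trans (F.compose_correlatorVia θ hcol x).symm
  · have hL := hG.isLocallyArcGraph
    exact ⟨F.correlatorVia_selfGlueWith θ hform hflip hL hne hwt hcol (hP _ hw) _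
        (fun _ => Iff.rfl),
      fun hc => F.correlatorVia_selfGlueWith θ hform hflip hL hne hwt hcol (hP _ hw) _ hc.le_iff⟩

theorem actsViaCorrelators_bar {P : Color B → Prop}
    (hP : ∀ c, P c → c = Color.closed ∨ (F.IsBasic ∧ F.ConditionE)) :
    ActsViaCorrelators F.barSystem (F.barCorrelator hC.out) P :=
  F.actsViaCorrelators_correlatorVia (M := F.barSystem) (fun c n => LinearEquiv.refl k (F.Bar c n))
    (fun _ _ _ _ => rfl) (fun _ _ _ => rfl) hP

theorem actsViaCorrelators_hoch {P : Color B → Prop}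
    (hP : ∀ c, P c → c = Color.closed ∨ (F.IsBasic ∧ F.ConditionE)) :
    ActsViaCorrelators F.hochSystem (F.hochCorrelator hC.out) P :=
  F.actsViaCorrelators_correlatorVia (M := F.hochSystem) F.hochToBar
    (fun _ _ _ _ => rfl) (fun c n _ => (F.hochToBar c.bar n).apply_symm_apply _) hP

end BraneFrobenius

end

theorem mainTheorem2 {k : Type u} [Field k] {B : Type z} (F : BraneFrobenius.{u, v, z} k B)
    (hF : F.IsBasic) (hC : F.ConditionC) :
    (F.ConditionE →
      ActsViaCorrelators F.barSystem (F.barCorrelator hC) (fun _ => True) ∧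
      ActsViaCorrelators F.hochSystem (F.hochCorrelator hC) (fun _ => True)) ∧
    ActsViaCorrelators F.barSystem (F.barCorrelator hC) (fun c => c = Color.closed) ∧
    ActsViaCorrelators F.hochSystem (F.hochCorrelator hC) (fun c => c = Color.closed) := by
  have : Fact F.ConditionC := ⟨hC⟩
  exact ⟨fun hE => ⟨F.actsViaCorrelators_bar fun _ _ => Or.inr ⟨hF, hE⟩,
      F.actsViaCorrelators_hoch fun _ _ => Or.inr ⟨hF, hE⟩⟩,
    F.actsViaCorrelators_bar fun _ h => Or.inl h, F.actsViaCorrelators_hoch fun _ h => Or.inl h⟩
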